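/- Let $\zeta_3=e^{2\pi i/3}$, $t=(1+2\zeta_3)/3$, and let $E=\mathbb C/\mathbb Z[\zeta_3]$ be the Fermat elliptic curve. Consider quotients $X=T/G$ of a 3-dimensional complex torus $T=\mathbb C^3/\Lambda$ by a group $G\cong\mathbb Z_3^3$ of biholomorphic maps of $T$ which contains no translation other than the identity, has isolated fixed points (only finitely many points of $T$ have non-trivial stabilizer), and acts rigidly, i.e. $H^1(T,\Theta_T)^G=0$, where $\Theta_T$ is the holomorphic tangent sheaf. The structure sheaf of holomorphic (resp. smooth) functions on $X$ consists of the $G$-invariant holomorphic (resp. smooth) functions on $T$; a biholomorphism (resp. diffeomorphism) between two such quotients is a homeomorphism that identifies these sheaves. There are exactly $3$ biholomorphism classes of such quotients. They are represented by the following quotients $T/\langle h,g,k\rangle$, where in each case $k(z)=\zeta_3 z$, and $h(z)=\mathrm{diag}(1,\zeta_3^2,\zeta_3)z+a$, $g(z)=\mathrm{diag}(\zeta_3,1,1)z+b$: - $Y_9$: $T=E^3=\mathbb C^3/\mathbb Z[\zeta_3]^3$, $a=(-t,-t,t)$, $b=(-t,0,-t)$; - $Y_{10}$: $T=E^3/\langle(t,t,0)\rangle=\mathbb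 C^3/(\mathbb Z[\zeta_3]^3+\mathbb Z(t,t,0))$, $a=\tfrac13(-\zeta_3^2,2,3t)$, $b=\tfrac13(-\zeta_3^2,2\zeta_3,0)$; - $Y_{10'}$: $T=E^3/\langle(t,t,0)\rangle$, $a=\tfrac13(\zeta_3,\zeta_3^2,3t)$, $b=\tfrac13(\zeta_3^2,\zeta_3^2,0)$. That is, each of these three is a quotient of the kind considered, they are pairwise not biholomorphic, and every quotient of the kind considered is biholomorphic to one of them. Moreover, $(z_1,z_2,z_3)\mapsto(\overline{z_1},\overline{z_2},\overline{z_3})$ induces a diffeomorphism $Y_{10}\to Y_{10'}$, and neither $Y_{10}$ nor $Y_{10'}$ is diffeomorphic to $Y_9$. -/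

import Mathlib

noncomputable section

namespace TorusQuotient

/-! ### Quotients of complex tori of dimension 3 -/

/-- The vector space `ℂ³`. Only its topology and its linear structure matter below. -/
abbrev V : Type := Fin 3 → ℂ

/-- A subgroup `Λ` of `ℂ³` together with a group `G` of bijections of `T = ℂ³ / Λ`.
That `T` is a complex torus and that `G` acts holomorphically are predicates below. -/
structure TorusGroup where
  /-- the lattice -/
  Λ : Submodule ℤ V
  /-- the group acting on the torus -/
  G : Subgroup (Equiv.Perm (V ⧸ Λ))

namespace TorusGroup

variable (A B : TorusGroup)

/-- The torus `T = ℂ³ / Λ`, with the quotient topology. -/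
abbrev Torus : Type := V ⧸ A.Λ

/-- The projection `ℂ³ → T`. -/
def torusProj : V → A.Torus := fun z => Submodule.Quotient.mk z

/-- The quotient `X = T / G`, the space of `G`-orbits, with the quotient topology. -/
abbrev Space : Type := MulAction.orbitRel.Quotient A.G A.Torus

/-- The projection `ℂ³ → T → X = T / G`. -/
def proj : V → A.Space := fun z => Quotient.mk (MulAction.orbitRel A.G A.Torus) (A.torusProj z)

end TorusGroup

/-! ### Holomorphic and smooth functions and maps

The structure sheaf of a torus `T = ℂ³ / Λ` consists of the functions whose pull-back to `ℂ³` is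
holomorphic, and the structure sheaf of `X = T / G` consists of the `G`-invariant holomorphic
functions on `T`, that is, again of the functions on `X` whose pull-back to `ℂ³` is holomorphic.
Likewise for smooth functions. So both cases are treated through a projection `p : ℂ³ → Y`. -/

section Maps

variable {Y Z : Type} [TopologicalSpace Y] [TopologicalSpace Z]

/-- The function `φ` is holomorphic on the subset `U` of `Y`. -/
def HolomorphicOn (p : V → Y) (U : Set Y) (φ : Y → ℂ) : Prop :=
  DifferentiableOn ℂ (φ ∘ p) (p ⁻¹' U)

/-- The function `φ` is smooth (in the real sense) on the subset `U` of `Y`. -/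
def SmoothOn (p : V → Y) (U : Set Y) (φ : Y → ℝ) : Prop :=
  ContDiffOn ℝ (⊤ : ℕ∞) (φ ∘ p) (p ⁻¹' U)

/-- A holomorphic map: a continuous map which pulls back holomorphic functions on open sets to
holomorphic functions. -/
def IsHolomorphicMap (p : V → Y) (q : V → Z) (f : Y → Z) : Prop :=
  Continuous f ∧ ∀ (U : Set Z) (φ : Z → ℂ), IsOpen U → HolomorphicOn q U φ →
    HolomorphicOn p (f ⁻¹' U) (φ ∘ f)

/-- A biholomorphic map: a homeomorphism which identifies the sheaves of holomorphic functions. -/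
def IsBiholomorphism (p : V → Y) (q : V → Z) (f : Y ≃ₜ Z) : Prop :=
  ∀ (U : Set Z) (φ : Z → ℂ), IsOpen U →
    (HolomorphicOn q U φ ↔ HolomorphicOn p (f ⁻¹' U) (φ ∘ f))

/-- A diffeomorphism: a homeomorphism which identifies the sheaves of smooth functions. -/
def IsDiffeomorphism (p : V → Y) (q : V → Z) (f : Y ≃ₜ Z) : Prop :=
  ∀ (U : Set Z) (φ : Z → ℝ), IsOpen U →
    (SmoothOn q U φ ↔ SmoothOn p (f ⁻¹' U) (φ ∘ f))

end Maps

/-- The quotients `T / G` and `T' / G'` are biholomorphic. -/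
def Biholomorphic (A B : TorusGroup) : Prop :=
  ∃ f : A.Space ≃ₜ B.Space, IsBiholomorphism A.proj B.proj f

/-- The quotients `T / G` and `T' / G'` are diffeomorphic. -/
def Diffeomorphic (A B : TorusGroup) : Prop :=
  ∃ f : A.Space ≃ₜ B.Space, IsDiffeomorphism A.proj B.proj f

/-! ### Infinitesimal rigidity: `H¹(T, Θ_T)^G = 0`

`H¹(T, Θ_T)` is computed by the Dolbeault complex. A smooth `(0,1)`-form on `T` with values in the
holomorphic tangent bundle is `∑ ω i j • (∂/∂z_i ⊗ d z̄_j)` with smooth `Λ`-periodic coefficients. -/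

/-- `∂f / ∂z̄_j = (∂f / ∂x_j + i ∂f / ∂y_j) / 2` -/
def dbar (j : Fin 3) (f : V → ℂ) (z : V) : ℂ :=
  (fderiv ℝ f z (Pi.single j 1) + Complex.I * fderiv ℝ f z (Pi.single j Complex.I)) / 2

/-- A smooth vector field `∑ v i • ∂/∂z_i` of type `(1,0)` on the torus `ℂ³ / Λ`. -/
def IsVectorField (Λ : Submodule ℤ V) (v : V → Fin 3 → ℂ) : Prop :=
  ContDiff ℝ (⊤ : ℕ∞) v ∧ ∀ l ∈ Λ, ∀ z, v (z + l) = v z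

/-- A smooth `(0,1)`-form on the torus `ℂ³ / Λ` with values in the tangent bundle. -/
def IsForm (Λ : Submodule ℤ V) (ω : V → Matrix (Fin 3) (Fin 3) ℂ) : Prop :=
  (∀ i j, ContDiff ℝ (⊤ : ℕ∞) fun z => ω z i j) ∧ ∀ l ∈ Λ, ∀ z, ω (z + l) = ω z

/-- The form `ω` satisfies `∂̄ω = 0`. -/
def IsDbarClosed (ω : V → Matrix (Fin 3) (Fin 3) ℂ) : Prop :=
  ∀ i j k z, dbar k (fun w => ω w i j) z = dbar j (fun w => ω w i k) z

/-- The form `ω` is `∂̄v` for a smooth vector field `v` on the torus `ℂ³ / Λ`. -/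
def IsDbarExact (Λ : Submodule ℤ V) (ω : V → Matrix (Fin 3) (Fin 3) ℂ) : Prop :=
  ∃ v, IsVectorField Λ v ∧ ∀ z i j, ω z i j = dbar j (fun w => v w i) z

/-- The complex Jacobian matrix `∂F_i / ∂z_j`. -/
def jacobian (F : V → V) (z : V) : Matrix (Fin 3) (Fin 3) ℂ :=
  Matrix.of fun i j => fderiv ℂ F z (Pi.single j 1) i

/-- The form `η` is the pull-back of `ω` along the automorphism `σ` of the torus `ℂ³ / Λ`: if `F` is
a holomorphic lift of `σ` with Jacobian matrix `J`, then `η = J⁻¹ · (ω ∘ F) · J̄`. -/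
def IsPullback {Λ : Submodule ℤ V} (σ : Equiv.Perm (V ⧸ Λ))
    (ω η : V → Matrix (Fin 3) (Fin 3) ℂ) : Prop :=
  ∃ F : V → V, Differentiable ℂ F ∧
    (∀ z, σ (Submodule.Quotient.mk z) = Submodule.Quotient.mk (F z)) ∧
    ∀ z, jacobian F z * η z = ω (F z) * (jacobian F z).map (starRingEnd ℂ)

/-- The action of `G` on `T` is infinitesimally rigid, `H¹(T, Θ_T)^G = 0`: a `∂̄`-closed form whose
Dolbeault class is fixed by every element of `G` is `∂̄`-exact. -/
def IsRigidAction (A : TorusGroup) : Prop :=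
  ∀ ω, IsForm A.Λ ω → IsDbarClosed ω →
    (∀ σ ∈ A.G, ∃ η, IsPullback σ ω η ∧ IsDbarExact A.Λ fun z => η z - ω z) →
    IsDbarExact A.Λ ω

/-! ### The class of quotients to be classified -/

/-- `T = ℂ³ / Λ` is a complex torus, and `G ≃ (ℤ/3)³` is a group of biholomorphic maps of `T`
without translations whose action is rigid and has isolated fixed points. -/
structure IsRigidZ3CubeQuotient (A : TorusGroup) : Prop where
  /-- `Λ` is a lattice: discrete and spanning `ℂ³` over `ℝ`. -/
  discrete : DiscreteTopology A.Λ
  span_top : Submodule.span ℝ (A.Λ : Set V) = ⊤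
  /-- Every element of `G` (hence also its inverse) is holomorphic. -/
  holomorphic : ∀ σ ∈ A.G, IsHolomorphicMap A.torusProj A.torusProj σ
  group_iso : Nonempty (A.G ≃* Multiplicative (Fin 3 → ZMod 3))
  /-- No element of `G` other than the identity is a translation. -/
  translation_free : ∀ σ ∈ A.G, (∃ b : A.Torus, ∀ x, σ x = x + b) → σ = 1
  /-- The points with non-trivial stabilizer are isolated, i.e. (`T` being compact) finite in
  number. -/
  isolated : {x : A.Torus | ∃ σ ∈ A.G, σ ≠ 1 ∧ σ x = x}.Finite
  rigid : IsRigidAction A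

/-! ### The three examples -/

/-- `ζ₃ = exp(2πi/3)` -/
def ζ : ℂ := Complex.exp (2 * Real.pi * Complex.I / 3)

/-- `t = (1 + 2ζ₃) / 3` -/
def t : ℂ := (1 + 2 * ζ) / 3

/-- The lattice `ℤ[ζ₃]³`, so that `ℂ³ / Λ₁ = E³` for the Fermat elliptic curve `E = ℂ / ℤ[ζ₃]`. -/
def Λ₁ : Submodule ℤ V := Submodule.pi Set.univ fun _ => Submodule.span ℤ {1, ζ}

/-- The lattice `ℤ[ζ₃]³ + ℤ(t,t,0)`, so that `ℂ³ / Λ₂ = E³ / ⟨(t,t,0)⟩`. -/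
def Λ₂ : Submodule ℤ V := Λ₁ ⊔ Submodule.span ℤ {![t, t, 0]}

/-- The affine map `z ↦ diag(d) z + b`. -/
def affine (d b : V) : V → V := fun z => d * z + b

/-- The group generated by the bijections of `ℂ³ / Λ` which are induced by the maps in `S`. -/
def generated (Λ : Submodule ℤ V) (S : Set (V → V)) : Subgroup (Equiv.Perm (V ⧸ Λ)) :=
  Subgroup.closure
    {σ | ∃ F ∈ S, ∀ z, σ (Submodule.Quotient.mk z) = Submodule.Quotient.mk (F z)}

/-- The generators of the action, in the order `h`, `g`, `k`; the translation parts of `h` and `g`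
are `a` and `b`, that of `k` is zero. -/
def generators (a b : V) : Set (V → V) :=
  {affine ![1, ζ ^ 2, ζ] a, affine ![ζ, 1, 1] b, affine ![ζ, ζ, ζ] 0}

/-- `Y₉` -/
def Y9 : TorusGroup where
  Λ := Λ₁
  G := generated Λ₁ (generators ![-t, -t, t] ![-t, 0, -t])

/-- `Y₁₀` -/
def Y10 : TorusGroup where
  Λ := Λ₂
  G := generated Λ₂ (generators ![-ζ ^ 2 / 3, 2 / 3, t] ![-ζ ^ 2 / 3, 2 * ζ / 3, 0])

/-- `Y₁₀'` -/
def Y10' : TorusGroup where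
  Λ := Λ₂
  G := generated Λ₂ (generators ![ζ / 3, ζ ^ 2 / 3, t] ![ζ ^ 2 / 3, ζ ^ 2 / 3, 0])

end TorusQuotient

end

/-! Classification. Holomorphic automorphisms of a torus are affine. As `G` contains no translation,
its linear parts form a faithful commuting family of 27 matrices of order dividing 3. They are
simultaneously diagonal, hence are exactly the matrices `dz e` with third roots of unity on the
diagonal. In particular multiplication by `ζ` occurs. Its fixed point can be moved to the origin,
and the axes scaled so that each meets the lattice in `ℤ[ζ]` (`exists_isNormal`). The reflections
`dz (Pi.single i 1)` then force `(1 - ζ) Λ ⊆ ℤ[ζ]³`, so `Λ` amounts to a subspace `K` of `𝔽₃³`, the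
code of all `κ` with `tors 0 κ ∈ Λ`. Commuting with `ζ` makes all translation parts 3-torsion points
`tors n m`. Isolated fixed points mean that nontrivial elements with an eigenvalue one act freely.
What remains is linear algebra over `𝔽₃`: up to permutations and signs of the coordinates `K` is
zero, which leaves `Y9`, or is spanned by `(1,1,0)`, which leaves a sign separating `Y10` from
`Y10'`.

Rigidity. By Fourier series a `∂̄`-closed form is constant up to an exact one. Pull-back along
multiplication by `ζ` multiplies constant forms by `ζ`, so no nonzero class is invariant.

Distinctness. A homeomorphism of quotients lifts to `ℂ³` outside a countable closed set, because the
complement of that set is simply connected and the quotient map is a covering away from its singular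
points. The lift conjugates the groups of affine maps (`exists_equivariant_lift`), so it identifies
lattices and permutes linear parts compatibly. Axis vectors must go to axis vectors. They generate
`Λ₁` but not `Λ₂`, so `Y9` is not even homeomorphic to the other two. The lift of a biholomorphism
is moreover affine and monomial (`exists_monomial_lift`). From `Y10` to `Y10'`, the residue modulo
`1 - ζ` of its first two coefficients would have to be both `1` and `-1`. Complex conjugation fixes
`1/3` and negates `t`, which flips exactly the sign in question. -/

namespace ComplCountable

/-! ### Simple connectivity of the complement of a countable closed set -/

open Set unitInterval

variable {E : Type*} [NormedAddCommGroup E] {S : Set E}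

theorem homotopic_of_map {x y : ↥Sᶜ} (p q : Path x y) (H : I × I → E) (hH : Continuous H)
    (hS : ∀ z, H z ∉ S) (h0 : ∀ t, H (0, t) = p t) (h1 : ∀ t, H (1, t) = q t)
    (hx : ∀ s, H (s, 0) = x) (hy : ∀ s, H (s, 1) = y) : p.Homotopic q := by
  refine ⟨⟨⟨⟨fun z => ⟨H z, hS z⟩, by fun_prop⟩, fun t => Subtype.ext (h0 t),
    fun t => Subtype.ext (h1 t)⟩, ?_⟩⟩
  rintro s t (rfl | rfl)
  · refine Subtype.ext ?_
    simpa using hx s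
  · refine Subtype.ext ?_
    simpa using hy s

variable [NormedSpace ℝ E]

/-- The compact image of `p` has positive distance from `S`. A Bernstein polynomial closer to `p`
than that distance is joined to it by the straight-line homotopy, which misses `S`. -/
theorem exists_contDiff_homotopic (hS : IsClosed S) {x y : ↥Sᶜ} (p : Path x y) :
    ∃ (g : ℝ → E) (q : Path x y), ContDiff ℝ 1 g ∧ (∀ s : I, (q s : E) = g s) ∧
      p.Homotopic q := by
  set f : C(I, E) := ⟨fun s => (p s : E), by fun_prop⟩ with hf
  have hK : IsCompact (range f) := isCompact_range f.continuous
  have hd : Disjoint (range f) S := by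
    rw [Set.disjoint_left]
    rintro _ ⟨s, rfl⟩
    exact (p s).2
  obtain ⟨δ, hδ, hdis⟩ := hd.exists_thickenings hK hS
  have happ : ∀ᶠ n : ℕ in Filter.atTop, bernsteinApproximation n f ∈ Metric.ball f δ :=
    (bernsteinApproximation_uniform f).eventually (Metric.ball_mem_nhds f hδ)
  obtain ⟨n, hn, hn0⟩ := (happ.and (Filter.eventually_ge_atTop 1)).exists
  set B := bernsteinApproximation n f with hB
  have hBf : ∀ s, dist (B s) (f s) < δ := fun s =>
    (ContinuousMap.dist_apply_le_dist s).trans_lt hn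
  have hseg : ∀ s r : I, (1 - (r : ℝ)) • f s + (r : ℝ) • B s ∉ S := by
    intro s r hmem
    refine (Set.disjoint_left.1 hdis) (a := (1 - (r : ℝ)) • f s + (r : ℝ) • B s) ?_
      (Metric.self_subset_thickening hδ S hmem)
    refine Metric.mem_thickening_iff.2 ⟨f s, mem_range_self s, ?_⟩
    have : (1 - (r : ℝ)) • f s + (r : ℝ) • B s - f s = (r : ℝ) • (B s - f s) := by module
    rw [dist_eq_norm, this, norm_smul, Real.norm_of_nonneg r.2.1, ← dist_eq_norm]
    exact (mul_le_of_le_one_left dist_nonneg r.2.2).trans_lt (hBf s)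
  have hB0 : B 0 = x := by simp [hB, hf]
  -- For `n = 0` the only node is `0` and the approximation is constant; the right endpoint is kept
  -- only when `1 ≤ n`.
  have hB1 : B 1 = y := by
    rw [hB, bernsteinApproximation.apply_one (by omega)]; simp [hf]
  have hBS : ∀ s, B s ∉ S := fun s => by simpa using hseg s 1
  refine ⟨fun r => ∑ k : Fin (n + 1), ((n.choose k : ℝ) * r ^ (k : ℕ) * (1 - r) ^ (n - k)) •
      f (bernstein.z k), ⟨⟨fun s => ⟨B s, hBS s⟩, by fun_prop⟩, Subtype.ext hB0,
      Subtype.ext hB1⟩, by fun_prop, fun s => ?_, ?_⟩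
  · change B s = _
    rw [hB, bernsteinApproximation.apply]
    simp [bernstein_apply]
  · refine homotopic_of_map _ _ (fun z => (1 - (z.1 : ℝ)) • f z.2 + (z.1 : ℝ) • B z.2)
      (by fun_prop) (fun z => hseg z.2 z.1) ?_ ?_ ?_ ?_
    · intro s; simp [hf]
    · intro s; simp
    · intro s
      have : f 0 = x := by simp [hf]
      simp only [hB0, this]; module
    · intro s
      have : f 1 = y := by simp [hf]
      simp only [hB1, this]; module

/-- General position: the straight-line homotopy `l` is perturbed by `w • c`, where `w` vanishes on
the boundary of the square. The vectors `c` for which it hits a given point form a `C¹` image of an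
open square, of Hausdorff dimension at most 2. A countable union of such sets cannot fill `E`. -/
theorem homotopic_of_contDiff [FiniteDimensional ℝ E] (hE : 2 < Module.finrank ℝ E)
    (hS : S.Countable) {x y : ↥Sᶜ} (p q : Path x y) {f g : ℝ → E} (hf : ContDiff ℝ 1 f)
    (hg : ContDiff ℝ 1 g) (hpf : ∀ s : I, (p s : E) = f s) (hqg : ∀ s : I, (q s : E) = g s) :
    p.Homotopic q := by
  let O : Set (ℝ × ℝ) := Ioo 0 1 ×ˢ Ioo 0 1
  let w : ℝ × ℝ → ℝ := fun z => z.1 * (1 - z.1) * (z.2 * (1 - z.2))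
  let l : ℝ × ℝ → E := fun z => (1 - z.1) • f z.2 + z.1 • g z.2
  have hw : ∀ z ∈ O, w z ≠ 0 := by
    rintro ⟨a, b⟩ ⟨⟨h1, h2⟩, h3, h4⟩
    have := sub_pos.2 h2
    have := sub_pos.2 h4
    simp only at h1 h3
    simp only [w]
    positivity
  -- The perturbed homotopy passes through `s` at `z` exactly when `c = b s z`.
  let b : E → ℝ × ℝ → E := fun s z => (w z)⁻¹ • (s - l z)
  have hb : ∀ s, ContDiffOn ℝ 1 (b s) O := by
    intro s
    refine ContDiffOn.smul (ContDiffOn.inv ?_ hw) ?_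
    · exact ContDiff.contDiffOn (by fun_prop)
    · exact ContDiff.contDiffOn (by fun_prop)
  have hO : Convex ℝ O := (convex_Ioo 0 1).prod (convex_Ioo 0 1)
  have hdim : dimH (⋃ s ∈ S, b s '' O) < Module.finrank ℝ E := by
    rw [dimH_bUnion hS]
    refine lt_of_le_of_lt (b := (2 : ENNReal)) ?_ (by exact_mod_cast hE)
    refine iSup₂_le fun s _ => ((hb s).dimH_image_le hO subset_rfl).trans ?_
    refine (dimH_mono (subset_univ O)).trans ?_
    rw [Real.dimH_univ_eq_finrank]
    simp
  obtain ⟨c, hc⟩ := (dense_compl_of_dimH_lt_finrank hdim).nonempty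
  simp only [mem_compl_iff, mem_iUnion, not_exists] at hc
  have hf0 : f 0 = x := by simpa using (hpf 0).symm
  have hf1 : f 1 = y := by simpa using (hpf 1).symm
  have hg0 : g 0 = x := by simpa using (hqg 0).symm
  have hg1 : g 1 = y := by simpa using (hqg 1).symm
  have hfc := hf.continuous
  have hgc := hg.continuous
  refine homotopic_of_map p q (fun z => l (z.1, z.2) + w (z.1, z.2) • c) (by fun_prop) ?_ ?_ ?_
    ?_ ?_
  · rintro ⟨s, r⟩ hmem
    by_cases hsr : ((s : ℝ), (r : ℝ)) ∈ O
    · refine hc _ hmem ⟨(s, r), hsr, ?_⟩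
      simp only [b, add_sub_cancel_left]
      rw [smul_smul, inv_mul_cancel₀ (hw _ hsr), one_smul]
    · have hx := x.2
      have hy := y.2
      have : s = 0 ∨ s = 1 ∨ r = 0 ∨ r = 1 := by
        by_contra! hcon
        exact hsr ⟨⟨unitInterval.pos_iff_ne_zero.2 hcon.1, unitInterval.lt_one_iff_ne_one.2 hcon.2.1⟩,
          unitInterval.pos_iff_ne_zero.2 hcon.2.2.1, unitInterval.lt_one_iff_ne_one.2 hcon.2.2.2⟩
      rcases this with rfl | rfl | rfl | rfl
      · have := (p r).2
        simp [l, w, ← hpf] at hmem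
        exact this hmem
      · have := (q r).2
        simp [l, w, ← hqg] at hmem
        exact this hmem
      · simp only [l, w, Icc.coe_zero, hf0, hg0] at hmem
        rw [show (1 - (s : ℝ)) • (x : E) + (s : ℝ) • (x : E) +
          (s * (1 - s) * (0 * (1 - 0)) : ℝ) • c = x by module] at hmem
        exact hx hmem
      · simp only [l, w, Icc.coe_one, hf1, hg1] at hmem
        rw [show (1 - (s : ℝ)) • (y : E) + (s : ℝ) • (y : E) +
          (s * (1 - s) * (1 * (1 - 1)) : ℝ) • c = y by module] at hmem
        exact hy hmem
  · intro r; simp [l, w, hpf]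
  · intro r; simp [l, w, hqg]
  · intro s; simp only [l, w, Icc.coe_zero, hf0, hg0]; module
  · intro s; simp only [l, w, Icc.coe_one, hf1, hg1]; module

theorem simplyConnectedSpace [FiniteDimensional ℝ E] (hE : 2 < Module.finrank ℝ E)
    (hS : S.Countable) (hc : IsClosed S) : SimplyConnectedSpace ↥Sᶜ := by
  rw [simply_connected_iff_paths_homotopic']
  refine ⟨isPathConnected_iff_pathConnectedSpace.1 (hS.isPathConnected_compl_of_one_lt_rank ?_),
    fun p q => ?_⟩
  · rw [← Module.finrank_eq_rank ℝ E]
    exact_mod_cast (by omega : 1 < Module.finrank ℝ E)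
  · obtain ⟨f, p', hf, hpf, hp⟩ := exists_contDiff_homotopic hc p
    obtain ⟨g, q', hg, hqg, hq⟩ := exists_contDiff_homotopic hc q
    exact hp.trans ((homotopic_of_contDiff hE hS p' q' hf hg hpf hqg).trans hq.symm)

end ComplCountable

/-! ### The projections from `ℂ³` to the torus and to the quotient as coverings -/

noncomputable section

namespace TorusQuotient

open Topology

namespace TorusGroup

variable (A : TorusGroup)

theorem isOpenQuotientMap_torusProj : IsOpenQuotientMap A.torusProj :=
  A.Λ.isOpenQuotientMap_mkQ

theorem torusProj_eq_iff {z w : V} : A.torusProj z = A.torusProj w ↔ z - w ∈ A.Λ :=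
  Submodule.Quotient.eq A.Λ

@[simp] theorem torusProj_add (z w : V) : A.torusProj (z + w) = A.torusProj z + A.torusProj w := rfl

theorem torusProj_surjective : Function.Surjective A.torusProj :=
  A.isOpenQuotientMap_torusProj.surjective

theorem torusProj_continuous : Continuous A.torusProj := A.isOpenQuotientMap_torusProj.continuous

theorem isAddQuotientCoveringMap_torusProj [DiscreteTopology A.Λ] :
    IsAddQuotientCoveringMap A.torusProj A.Λ.toAddSubgroup :=
  A.isOpenQuotientMap_torusProj.isQuotientMap.isAddQuotientCoveringMap_of_addSubgroup
    A.Λ.toAddSubgroup ⟨‹_›⟩ (fun {e₁ e₂} => by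
      rw [eq_comm, torusProj_eq_iff, sub_eq_add_neg]; rfl)

theorem isCoveringMap_torusProj [DiscreteTopology A.Λ] : IsCoveringMap A.torusProj :=
  A.isAddQuotientCoveringMap_torusProj.isCoveringMap

instance [DiscreteTopology A.Λ] : T2Space A.Torus := by
  have : DiscreteTopology A.Λ.toAddSubgroup := ‹_›
  have hc : IsClosed (A.Λ : Set V) := AddSubgroup.isClosed_of_discrete (H := A.Λ.toAddSubgroup)
  have := @Submodule.t3_quotient_of_isClosed ℤ V _ _ _ _ A.Λ _ hc
  infer_instance

instance : LocallyCompactSpace A.Torus :=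
  A.isOpenQuotientMap_torusProj.locallyCompactSpace

/-- A continuous map with values in the lattice is constant. -/
theorem const_of_mem [DiscreteTopology A.Λ] {F : V → V} (hF : Continuous F) (h : ∀ z, F z ∈ A.Λ) (z w : V) :
    F z = F w := by
  have hc : Continuous fun z => (⟨F z, h z⟩ : A.Λ) := by fun_prop
  exact congrArg Subtype.val (PreconnectedSpace.constant inferInstance hc (x := z) (y := w))

/-- The map `F` of `ℂ³` induces an element of `G`. -/
def Lifts (F : V → V) : Prop := ∃ σ ∈ A.G, ∀ z, σ (A.torusProj z) = A.torusProj (F z)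

variable {A}

theorem Lifts.comp {F F' : V → V} (h : A.Lifts F) (h' : A.Lifts F') : A.Lifts (F ∘ F') := by
  obtain ⟨σ, hσ, h⟩ := h
  obtain ⟨τ, hτ, h'⟩ := h'
  exact ⟨σ * τ, mul_mem hσ hτ, fun z => by simp [h, h']⟩

theorem Lifts.inv {F F' : V → V} (h : A.Lifts F) (hF : ∀ z, F (F' z) = z) : A.Lifts F' := by
  obtain ⟨σ, hσ, h⟩ := h
  exact ⟨σ⁻¹, inv_mem hσ, fun z => by rw [Equiv.Perm.inv_eq_iff_eq, h, hF]⟩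

theorem lifts_id : A.Lifts id := ⟨1, one_mem _, fun _ => rfl⟩

theorem Lifts.congr {F F' : V → V} (h : A.Lifts F) (hF : ∀ z, F' z - F z ∈ A.Λ) : A.Lifts F' := by
  obtain ⟨σ, hσ, h⟩ := h
  exact ⟨σ, hσ, fun z => by rw [h, eq_comm, torusProj_eq_iff]; exact hF z⟩

theorem proj_eq_iff {z w : V} :
    A.proj z = A.proj w ↔ ∃ σ ∈ A.G, σ (A.torusProj w) = A.torusProj z := by
  unfold proj
  rw [Quotient.eq, MulAction.orbitRel_apply, MulAction.mem_orbit_iff]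
  simp [Subgroup.smul_def]

variable (A) in
/-- The points of `ℂ³` which lie over points of the torus with non-trivial stabilizer. -/
def sing : Set V := {z | ∃ σ ∈ A.G, σ ≠ 1 ∧ σ (A.torusProj z) = A.torusProj z}

variable (A) in
/-- The group of all affine maps of `ℂ³` which induce elements of `G`. -/
def crystal : Subgroup (V ≃ᵃ[ℂ] V) where
  carrier := {γ | A.Lifts γ}
  mul_mem' h h' := h.comp h'
  one_mem' := lifts_id
  inv_mem' {γ} h := h.inv fun z => γ.apply_symm_apply z

theorem mem_crystal {γ : V ≃ᵃ[ℂ] V} : γ ∈ A.crystal ↔ A.Lifts γ := Iff.rfl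

end TorusGroup

/-- A quotient of a complex torus by a group of affine maps, isomorphic to `(ℤ/3)³`, without
translations and with isolated fixed points. -/
structure IsAffineQuotient (A : TorusGroup) : Prop where
  discrete : DiscreteTopology A.Λ
  span_top : Submodule.span ℝ (A.Λ : Set V) = ⊤
  exists_affine : ∀ σ ∈ A.G, ∃ γ : V ≃ᵃ[ℂ] V, ∀ z, σ (A.torusProj z) = A.torusProj (γ z)
  group_iso : Nonempty (A.G ≃* Multiplicative (Fin 3 → ZMod 3))
  translation_free : ∀ σ ∈ A.G, (∃ b : A.Torus, ∀ x, σ x = x + b) → σ = 1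
  isolated : {x : A.Torus | ∃ σ ∈ A.G, σ ≠ 1 ∧ σ x = x}.Finite

namespace IsAffineQuotient

variable {A : TorusGroup} (hA : IsAffineQuotient A)
include hA

theorem finite : Finite A.G :=
  let ⟨e⟩ := hA.group_iso
  have : Finite (Multiplicative (Fin 3 → ZMod 3)) := inferInstanceAs (Finite (Fin 3 → ZMod 3))
  Finite.of_equiv _ e.symm.toEquiv

theorem continuous {σ : Equiv.Perm A.Torus} (hσ : σ ∈ A.G) : Continuous σ := by
  obtain ⟨γ, hγ⟩ := hA.exists_affine σ hσ
  rw [A.isOpenQuotientMap_torusProj.isQuotientMap.continuous_iff]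
  refine (A.torusProj_continuous.comp (f := γ) ?_).congr fun z => (hγ z).symm
  exact γ.continuous_of_finiteDimensional

theorem continuousConstSMul : ContinuousConstSMul A.G A.Torus :=
  ⟨fun σ => hA.continuous σ.2⟩

theorem isOpenQuotientMap_proj : IsOpenQuotientMap A.proj :=
  have := hA.continuousConstSMul
  (MulAction.isOpenQuotientMap_quotientMk (Γ := A.G) (T := A.Torus)).comp
    A.isOpenQuotientMap_torusProj

theorem isCoveringMapOn : IsCoveringMapOn (Quotient.mk (MulAction.orbitRel A.G A.Torus))
    (A.proj '' A.singᶜ) := by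
  have := hA.continuousConstSMul
  have := hA.finite
  have := hA.discrete
  refine (isCoveringMapOn_quotientMk_of_properlyDiscontinuousSMul
    (E := A.Torus) (G := A.G)).mono ?_
  rintro _ ⟨z, hz, rfl⟩
  refine ⟨A.torusProj z, ?_, rfl⟩
  rw [Set.mem_ofPred_eq, Subgroup.eq_bot_iff_forall]
  intro σ hσ
  by_contra h
  exact hz ⟨σ, σ.2, fun h' => h (Subtype.ext h'), hσ⟩

/-- Lifting in two stages: to the torus, by the covering over the regular part of the quotient, and
then to `ℂ³`, by the universal covering of the torus. -/
theorem exists_lift {Z : Type*} [TopologicalSpace Z] [SimplyConnectedSpace Z]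
    [LocallyPathConnectedSpace Z] (f : C(Z, A.Space)) (hf : ∀ z, f z ∈ A.proj '' A.singᶜ) :
    ∃ F : C(Z, V), ∀ z, A.proj (F z) = f z := by
  have := hA.discrete
  let z₀ : Z := Classical.arbitrary Z
  obtain ⟨e₀, he₀⟩ := A.torusProj_surjective (Quotient.out (f z₀))
  obtain ⟨F₁, ⟨-, hF₁⟩, -⟩ := hA.isCoveringMapOn.existsUnique_continuousMap_lifts f
    (a₀ := z₀) (e₀ := Quotient.out (f z₀)) (Quotient.out_eq _) hf
  obtain ⟨e₁, he₁⟩ := A.torusProj_surjective (F₁ z₀)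
  obtain ⟨F₂, ⟨-, hF₂⟩, -⟩ := A.isCoveringMap_torusProj.existsUnique_continuousMap_lifts F₁ z₀ e₁
    he₁
  refine ⟨F₂, fun z => ?_⟩
  rw [← congrFun hF₁ z, Function.comp_apply, ← congrFun hF₂ z]
  rfl

/-- At a base point the two maps differ by some `σ`. Uniqueness of lifts spreads this over `Z` on
the torus, and once more on `ℂ³`, where the remaining lattice vector `l` is absorbed into the affine
map. -/
theorem exists_crystal_of_proj_eq {Z : Type*} [TopologicalSpace Z] [PreconnectedSpace Z]
    [Nonempty Z] {u v : Z → V} (hu : Continuous u) (hv : Continuous v)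
    (h : ∀ z, A.proj (v z) = A.proj (u z)) (hs : ∀ z, u z ∉ A.sing) :
    ∃ γ ∈ A.crystal, ∀ z, v z = γ (u z) := by
  have := hA.discrete
  let z₀ : Z := Classical.arbitrary Z
  obtain ⟨σ, hσ, hz₀⟩ := TorusGroup.proj_eq_iff.1 (h z₀)
  obtain ⟨γ, hγ⟩ := hA.exists_affine σ hσ
  have hγm : A.crystal.1.1.1 γ := ⟨σ, hσ, hγ⟩
  have hγc : Continuous γ := γ.continuous_of_finiteDimensional
  have hpγ : ∀ z, A.proj (γ z) = A.proj z := fun z =>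
    TorusGroup.proj_eq_iff.2 ⟨σ, hσ, hγ z⟩
  let q : A.Torus → A.Space := Quotient.mk (MulAction.orbitRel A.G A.Torus)
  have hmem : ∀ z, A.proj (u z) ∈ A.proj '' A.singᶜ := fun z => ⟨_, hs z, rfl⟩
  have key := hA.isCoveringMapOn.isCoveringMap_restrictPreimage.eq_of_comp_eq
    (g₁ := fun z => (⟨A.torusProj (v z), by
      change A.proj (v z) ∈ A.proj '' A.singᶜ; rw [h]; exact hmem z⟩ : q ⁻¹' (A.proj '' A.singᶜ)))
    (g₂ := fun z => (⟨A.torusProj (γ (u z)), by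
      change A.proj (γ (u z)) ∈ A.proj '' A.singᶜ; rw [hpγ]; exact hmem z⟩ : q ⁻¹' (A.proj '' A.singᶜ)))
    (by have := A.torusProj_continuous; fun_prop) (by have := A.torusProj_continuous; fun_prop)
    (funext fun z => Subtype.ext (by
      change A.proj (v z) = A.proj (γ (u z)); rw [h, hpγ])) z₀
    (Subtype.ext (hz₀.symm.trans (hγ _)))
  have hT : ∀ z, A.torusProj (v z) = A.torusProj (γ (u z)) := fun z =>
    congrArg Subtype.val (congrFun key z)
  set l : V := v z₀ - γ (u z₀) with hl
  have hlΛ : l ∈ A.Λ := A.torusProj_eq_iff.1 (hT z₀)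
  have hfin : v = fun z => γ (u z) + l :=
    A.isCoveringMap_torusProj.eq_of_comp_eq hv (by fun_prop) (funext fun z => by
      simp only [Function.comp_apply, hT, TorusGroup.torusProj_add]
      rw [show A.torusProj l = 0 from (Submodule.Quotient.mk_eq_zero _).2 hlΛ, add_zero]) z₀
      (by simp [hl])
  refine ⟨γ.trans (AffineEquiv.constVAdd ℂ V l), ?_, fun z => ?_⟩
  · refine TorusGroup.Lifts.congr (F := γ) hγm fun z => ?_
    simpa using hlΛ
  · rw [hfin]; simp [add_comm]

theorem isClosed_sing : IsClosed A.sing := by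
  have := hA.discrete
  exact hA.isolated.isClosed.preimage A.torusProj_continuous

theorem countable_sing : A.sing.Countable := by
  have := hA.discrete
  have hc : (A.Λ : Set V).Countable := by
    have : Countable A.Λ := TopologicalSpace.separableSpace_iff_countable.1 inferInstance
    exact Set.countable_coe_iff.1 this
  have : A.sing = A.torusProj ⁻¹' {x : A.Torus | ∃ σ ∈ A.G, σ ≠ 1 ∧ σ x = x} := rfl
  rw [this, ← Set.biUnion_preimage_singleton]
  refine hA.isolated.countable.biUnion fun x _ => ?_
  obtain ⟨z, rfl⟩ := A.torusProj_surjective x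
  refine Set.Countable.mono (fun w hw => ?_) (hc.image fun l => l + z)
  exact ⟨w - z, A.torusProj_eq_iff.1 hw, by simp⟩

end IsAffineQuotient

end TorusQuotient
end

/-! ### Lifting homeomorphisms between quotients -/

noncomputable section

namespace TorusQuotient

open Topology

namespace IsAffineQuotient

variable {A B : TorusGroup} (hA : IsAffineQuotient A) (hB : IsAffineQuotient B)

section
include hA

theorem exists_mem_crystal {z w : V} (h : A.proj z = A.proj w) : ∃ γ ∈ A.crystal, z = γ w := by
  obtain ⟨σ, hσ, hz⟩ := TorusGroup.proj_eq_iff.1 h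
  obtain ⟨γ, hγ⟩ := hA.exists_affine σ hσ
  rw [hγ, eq_comm, TorusGroup.torusProj_eq_iff] at hz
  refine ⟨γ.trans (AffineEquiv.constVAdd ℂ V (z - γ w)),
    TorusGroup.Lifts.congr (F := γ) ⟨σ, hσ, hγ⟩ fun x => by simpa using hz, by simp⟩

omit hA in
theorem proj_crystal {γ : V ≃ᵃ[ℂ] V} (h : γ ∈ A.crystal) (z : V) : A.proj (γ z) = A.proj z := by
  obtain ⟨σ, hσ, hγ⟩ := h
  exact TorusGroup.proj_eq_iff.2 ⟨σ, hσ, hγ z⟩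

omit hA in
theorem mem_sing_of_proj_eq {z w : V} (h : A.proj z = A.proj w) (hw : w ∈ A.sing) :
    z ∈ A.sing := by
  obtain ⟨σ, hσ, h⟩ := TorusGroup.proj_eq_iff.1 h
  obtain ⟨τ, hτ, hτ1, hw⟩ := hw
  refine ⟨σ * τ * σ⁻¹, mul_mem (mul_mem hσ hτ) (inv_mem hσ), ?_, ?_⟩
  · rwa [Ne, conj_eq_one_iff]
  · simp [← h, hw]

omit hA in
theorem proj_mem_image_sing {z : V} : A.proj z ∈ A.proj '' A.sing ↔ z ∈ A.sing :=
  ⟨fun ⟨_, hw, h⟩ => mem_sing_of_proj_eq h.symm hw, fun h => ⟨z, h, rfl⟩⟩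

theorem isClosed_image_sing : IsClosed (A.proj '' A.sing) := by
  rw [← hA.isOpenQuotientMap_proj.isQuotientMap.isClosed_preimage]
  convert hA.isClosed_sing using 1
  ext z
  exact proj_mem_image_sing

theorem countable_preimage {S : Set A.Space} (hS : S.Countable) : (A.proj ⁻¹' S).Countable := by
  have := hA.discrete
  have := hA.finite
  have hc : (A.Λ : Set V).Countable := by
    have : Countable A.Λ := TopologicalSpace.separableSpace_iff_countable.1 inferInstance
    exact Set.countable_coe_iff.1 this
  rw [← Set.biUnion_preimage_singleton]
  refine hS.biUnion fun x _ => ?_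
  obtain ⟨z, rfl⟩ := hA.isOpenQuotientMap_proj.surjective x
  choose γ hγ using fun σ : A.G => hA.exists_affine σ σ.2
  refine Set.Countable.mono (s₂ := ⋃ σ : A.G, (fun l => l + γ σ z) '' (A.Λ : Set V)) ?_
    (Set.countable_iUnion fun σ => hc.image _)
  intro w hw
  obtain ⟨σ, hσ, h⟩ := TorusGroup.proj_eq_iff.1 hw
  rw [hγ ⟨σ, hσ⟩, eq_comm, TorusGroup.torusProj_eq_iff] at h
  exact Set.mem_iUnion.2 ⟨⟨σ, hσ⟩, _, h, by simp⟩

/-- The group of affine lifts acts freely off `sing`: such a `γ` induces the identity of the torus,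
so it is a translation, and it fixes `w`. -/
theorem eq_one_of_apply_eq {γ : V ≃ᵃ[ℂ] V} (hγ : γ ∈ A.crystal) {w : V} (hw : w ∉ A.sing)
    (h : γ w = w) : γ = 1 := by
  obtain ⟨σ, hσ, hσγ⟩ := hγ
  have h1 : σ = 1 := by
    by_contra h1
    exact hw ⟨σ, hσ, h1, by rw [hσγ, h]⟩
  ext1 z
  have := hA.discrete
  have := A.const_of_mem (F := fun z => γ z - z)
    (γ.continuous_of_finiteDimensional.sub continuous_id) (fun z => by
      rw [← TorusGroup.torusProj_eq_iff, ← hσγ, h1]; rfl) z w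
  rw [h, sub_self, sub_eq_zero] at this
  exact this

/-- The points of `ℂ³` which are singular for `A` or mapped to points singular for `B`. -/
theorem countable_singPreimage (hB : IsAffineQuotient B) (f : A.Space ≃ₜ B.Space) :
    (A.sing ∪ A.proj ⁻¹' (f ⁻¹' (B.proj '' B.sing))).Countable := by
  refine hA.countable_sing.union (hA.countable_preimage ?_)
  exact (hB.countable_sing.image _).preimage f.injective

theorem isClosed_singPreimage (hB : IsAffineQuotient B) (f : A.Space ≃ₜ B.Space) :
    IsClosed (A.sing ∪ A.proj ⁻¹' (f ⁻¹' (B.proj '' B.sing))) :=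
  hA.isClosed_sing.union ((hB.isClosed_image_sing.preimage f.continuous).preimage
    hA.isOpenQuotientMap_proj.continuous)

end

theorem finrank_V : Module.finrank ℝ V = 6 := by
  simp [V, Module.finrank_pi_fintype, Complex.finrank_real_complex]

include hA in
theorem exists_homeomorph_lift (hB : IsAffineQuotient B) (f : A.Space ≃ₜ B.Space) {N : Set V}
    (hN : N = A.sing ∪ A.proj ⁻¹' (f ⁻¹' (B.proj '' B.sing))) :
    ∃ F : C(↥Nᶜ, V), ∀ z, B.proj (F z) = f (A.proj z) := by
  have hc : IsClosed N := hN ▸ hA.isClosed_singPreimage hB f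
  have : SimplyConnectedSpace ↥Nᶜ := ComplCountable.simplyConnectedSpace
    (by rw [finrank_V]; norm_num) (hN ▸ hA.countable_singPreimage hB f) hc
  have : LocallyPathConnectedSpace ↥Nᶜ := hc.isOpen_compl.locallyPathConnectedSpace
  have hp := hA.isOpenQuotientMap_proj.continuous
  refine hB.exists_lift ⟨fun z : ↥Nᶜ => f (A.proj z), by fun_prop⟩ fun z => ?_
  obtain ⟨w, hw⟩ := hB.isOpenQuotientMap_proj.surjective (f (A.proj z))
  refine ⟨w, fun hws => ?_, hw⟩
  refine z.2 ?_
  refine hN.ge (Or.inr ?_)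
  change f (A.proj z) ∈ B.proj '' B.sing
  rw [← hw]
  exact ⟨w, hws, rfl⟩

include hA in
/-- A homeomorphism of quotients lifts to `ℂ³`, away from countably many points, and conjugates
the crystallographic groups. -/
theorem exists_equivariant_lift (hB : IsAffineQuotient B) (f : A.Space ≃ₜ B.Space) :
    ∃ (N : Set V) (F : V → V) (α : A.crystal ≃* B.crystal), N.Countable ∧ IsClosed N ∧
      ContinuousOn F Nᶜ ∧ (∀ z ∉ N, F z ∉ B.sing) ∧ (∀ z ∉ N, B.proj (F z) = f (A.proj z)) ∧
      ∀ γ : A.crystal, ∀ z ∉ N, γ.1 z ∉ N ∧ F (γ.1 z) = (α γ).1 (F z) := by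
  classical
  obtain ⟨N, hN⟩ : ∃ N, N = A.sing ∪ A.proj ⁻¹' (f ⁻¹' (B.proj '' B.sing)) := ⟨_, rfl⟩
  obtain ⟨N', hN'⟩ : ∃ N', N' = B.sing ∪ B.proj ⁻¹' (f.symm ⁻¹' (A.proj '' A.sing)) := ⟨_, rfl⟩
  obtain ⟨F, hF⟩ := hA.exists_homeomorph_lift hB f hN
  obtain ⟨F', hF'⟩ := hB.exists_homeomorph_lift hA f.symm hN'
  have hNc : N.Countable := hN ▸ hA.countable_singPreimage hB f
  have hNcl : IsClosed N := hN ▸ hA.isClosed_singPreimage hB f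
  have hpc : IsPathConnected Nᶜ := by
    refine hNc.isPathConnected_compl_of_one_lt_rank ?_
    rw [← Module.finrank_eq_rank ℝ V, finrank_V]
    norm_num
  have : PathConnectedSpace ↥Nᶜ := isPathConnected_iff_pathConnectedSpace.1 hpc
  have hpc' : IsPathConnected N'ᶜ := by
    refine (hN' ▸ hB.countable_singPreimage hA f.symm :
      N'.Countable).isPathConnected_compl_of_one_lt_rank ?_
    rw [← Module.finrank_eq_rank ℝ V, finrank_V]
    norm_num
  have : PathConnectedSpace ↥N'ᶜ := isPathConnected_iff_pathConnectedSpace.1 hpc'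
  have hmem : ∀ z, z ∈ Nᶜ ↔ A.proj z ∉ A.proj '' A.sing ∧ f (A.proj z) ∉ B.proj '' B.sing := by
    intro z
    rw [hN, Set.mem_compl_iff, Set.mem_union, not_or, proj_mem_image_sing]
    rfl
  have hmem' : ∀ z, z ∈ N'ᶜ ↔
      B.proj z ∉ B.proj '' B.sing ∧ f.symm (B.proj z) ∉ A.proj '' A.sing := by
    intro z
    rw [hN', Set.mem_compl_iff, Set.mem_union, not_or, proj_mem_image_sing]
    rfl
  have hFN : ∀ z : ↥Nᶜ, F z ∈ N'ᶜ := fun z => by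
    have := (hmem z).1 z.2
    rw [hmem', hF, f.symm_apply_apply]
    exact ⟨this.2, this.1⟩
  have hFs : ∀ z : ↥Nᶜ, F z ∉ B.sing := fun z => by
    have := ((hmem' _).1 (hFN z)).1
    rwa [proj_mem_image_sing] at this
  have hNs : ∀ z : ↥Nᶜ, (z : V) ∉ A.sing := fun z => by
    have := ((hmem _).1 z.2).1
    rwa [proj_mem_image_sing] at this
  have hN's : ∀ z : ↥N'ᶜ, (z : V) ∉ B.sing := fun z => by
    have := ((hmem' _).1 z.2).1
    rwa [proj_mem_image_sing] at this
  have hγN : ∀ γ ∈ A.crystal, ∀ z ∈ Nᶜ, γ z ∈ Nᶜ := fun γ hγ z hz => by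
    rw [hmem, proj_crystal hγ]
    exact (hmem z).1 hz
  have hγN' : ∀ γ ∈ B.crystal, ∀ z ∈ N'ᶜ, γ z ∈ N'ᶜ := fun γ hγ z hz => by
    rw [hmem', proj_crystal hγ]
    exact (hmem' z).1 hz
  have hα : ∀ γ : A.crystal, ∃ δ : B.crystal, ∀ z : ↥Nᶜ, F ⟨γ.1 z, hγN _ γ.2 z z.2⟩ =
      δ.1 (F z) := by
    intro γ
    have hγc := γ.1.continuous_of_finiteDimensional
    obtain ⟨δ, hδ, h⟩ := hB.exists_crystal_of_proj_eq (u := F)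
      (v := fun z : ↥Nᶜ => F ⟨γ.1 z, hγN _ γ.2 z z.2⟩) F.continuous (by fun_prop)
      (fun z => by rw [hF, hF, proj_crystal γ.2]) hFs
    exact ⟨⟨δ, hδ⟩, h⟩
  choose α hα using hα
  -- The map `F' ∘ δ ∘ F` covers the identity of the quotient of `A`, so it is itself an element of
  -- `A.crystal`.
  have hsec : ∀ δ : B.crystal, ∃ γ : A.crystal, ∀ z : ↥Nᶜ,
      F' ⟨δ.1 (F z), hγN' _ δ.2 _ (hFN z)⟩ = γ.1 z := by
    intro δ
    have hδc := δ.1.continuous_of_finiteDimensional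
    obtain ⟨γ, hγ, h⟩ := hA.exists_crystal_of_proj_eq (u := fun z : ↥Nᶜ => (z : V))
      (v := fun z : ↥Nᶜ => F' ⟨δ.1 (F z), hγN' _ δ.2 _ (hFN z)⟩) (by fun_prop) (by fun_prop)
      (fun z => by rw [hF', proj_crystal δ.2, hF, f.symm_apply_apply]) hNs
    exact ⟨⟨γ, hγ⟩, h⟩
  have hF'N : ∀ z : ↥N'ᶜ, F' z ∈ Nᶜ := fun z => by
    have := (hmem' z).1 z.2
    rw [hmem, hF', f.apply_symm_apply]
    exact ⟨this.2, this.1⟩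
  -- `F'` need not be inverse to `F`, but `F ∘ F'` covers the identity and therefore equals some
  -- `δ₁`.
  obtain ⟨δ₁, hδ₁, hδ₁F⟩ := hB.exists_crystal_of_proj_eq (u := fun z : ↥N'ᶜ => (z : V))
    (v := fun z : ↥N'ᶜ => F ⟨F' z, hF'N z⟩) (by fun_prop) (by fun_prop)
    (fun z => by rw [hF, hF', f.apply_symm_apply]) hN's
  have huniq : ∀ δ δ' : B.crystal, ∀ z : ↥Nᶜ, δ.1 (F z) = δ'.1 (F z) → δ = δ' := by
    intro δ δ' z h
    have := hB.eq_one_of_apply_eq (γ := (δ'⁻¹ * δ).1) (δ'⁻¹ * δ).2 (hFs z) (by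
      change δ'.1.symm (δ.1 (F z)) = F z
      rw [h, AffineEquiv.symm_apply_apply])
    have h1 : δ'⁻¹ * δ = 1 := Subtype.ext this
    exact (inv_mul_eq_one.1 h1).symm
  let z₀ : ↥Nᶜ := Classical.arbitrary _
  let αh : A.crystal →* B.crystal := MonoidHom.mk' α fun γ γ' => by
    refine huniq _ _ z₀ ?_
    rw [← hα]
    change F ⟨γ.1 (γ'.1 z₀), _⟩ = (α γ).1 ((α γ').1 (F z₀))
    rw [← hα γ' z₀, ← hα γ ⟨γ'.1 z₀, hγN _ γ'.2 _ z₀.2⟩]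
  have hbij : Function.Bijective αh := by
    constructor
    · rw [injective_iff_map_eq_one]
      intro γ hγ
      refine Subtype.ext (hA.eq_one_of_apply_eq γ.2 (hNs z₀) ?_)
      obtain ⟨γ₀, hγ₀⟩ := hsec 1
      have h1 : F ⟨γ.1 z₀, hγN _ γ.2 z₀ z₀.2⟩ = F z₀ := by
        rw [hα]
        change (αh γ).1 _ = _
        rw [hγ]; rfl
      have h2 := hγ₀ ⟨γ.1 z₀, hγN _ γ.2 z₀ z₀.2⟩
      have h3 := hγ₀ z₀
      simp only [h1] at h2
      rw [h3] at h2
      exact (γ₀.1.injective h2).symm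
    · intro δ
      -- Here `F ∘ γ = F ∘ F' ∘ δ ∘ F = δ₁ ∘ δ ∘ F`. Comparison with the case `δ = 1` removes the
      -- factor `δ₁`, which gives surjectivity.
      have key : ∀ δ γ, (∀ z : ↥Nᶜ, F' ⟨δ.1 (F z), hγN' _ δ.2 _ (hFN z)⟩ = γ.1 z) →
          αh γ = ⟨δ₁, hδ₁⟩ * δ := by
        intro δ γ h
        refine huniq _ _ z₀ ?_
        change (α γ).1 (F z₀) = δ₁ (δ.1 (F z₀))
        rw [← hα, ← hδ₁F ⟨δ.1 (F z₀), hγN' _ δ.2 _ (hFN z₀)⟩]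
        simp only [h]
      obtain ⟨γ₀, hγ₀⟩ := hsec 1
      obtain ⟨γ₂, hγ₂⟩ := hsec δ
      refine ⟨γ₀⁻¹ * γ₂, ?_⟩
      rw [map_mul, map_inv, key 1 γ₀ hγ₀, key δ γ₂ hγ₂]
      simp
  obtain ⟨Fe, hFe⟩ : ∃ Fe : V → V, ∀ z : ↥Nᶜ, Fe z = F z :=
    ⟨fun z => if h : z ∈ Nᶜ then F ⟨z, h⟩ else 0, fun z => dif_pos z.2⟩
  refine ⟨N, Fe, MulEquiv.ofBijective αh hbij, hNc, hNcl,
    ?_, fun z hz => ?_, fun z hz => ?_, fun γ z hz => ⟨hγN _ γ.2 z hz, ?_⟩⟩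
  · rw [continuousOn_iff_continuous_domRestrict]
    exact F.continuous.congr fun z => (hFe z).symm
  · rw [hFe ⟨z, hz⟩]; exact hFs ⟨z, hz⟩
  · rw [hFe ⟨z, hz⟩]; exact hF ⟨z, hz⟩
  · rw [hFe ⟨z, hz⟩, hFe ⟨γ.1 z, hγN _ γ.2 z hz⟩]
    exact hα γ ⟨z, hz⟩

end IsAffineQuotient

end TorusQuotient
end

/-! ### Holomorphic lifts are affine -/

noncomputable section

namespace TorusQuotient

open Topology

section LocalCoordinates

variable {Y Z : Type} [TopologicalSpace Y] [TopologicalSpace Z]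

omit [TopologicalSpace Z] in
-- The local inverse of `q` on `W` supplies coordinates. They are holomorphic on the whole preimage
-- of `q '' W`, not only on `W`, since other points of a fibre are carried into `W` by affine maps
-- preserving `q`.
theorem exists_coordinates {q : V → Z}
    (hq : ∀ w w', q w = q w' → ∃ γ : V ≃ᵃ[ℂ] V, γ w = w' ∧ ∀ z, q (γ z) = q z) {W : Set V}
    (hW : IsOpen W) (hinj : Set.InjOn q W) :
    ∃ φ : Fin 3 → Z → ℂ, (∀ i, HolomorphicOn q (q '' W) (φ i)) ∧
      ∀ i, ∀ w ∈ W, φ i (q w) = w i := by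
  classical
  have hinv : ∃ s : Z → V, ∀ w ∈ W, s (q w) = w :=
    ⟨Function.invFunOn q W, fun w hw => hinj.leftInvOn_invFunOn hw⟩
  obtain ⟨s, hs⟩ := hinv
  refine ⟨fun i x => s x i, fun i w hw => ?_, fun i w hw => congrFun (hs w hw) i⟩
  obtain ⟨w', hw', h⟩ := hw
  obtain ⟨γ, hγw, hγ⟩ := hq w w' h.symm
  have hγc : Continuous γ := γ.continuous_of_finiteDimensional
  have hev : (fun v => s (q v) i) =ᶠ[𝓝 w] fun v => γ v i := by
    filter_upwards [hγc.continuousAt.preimage_mem_nhds (hW.mem_nhds (hγw ▸ hw'))] with v hv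
    rw [← hγ v, hs _ hv]
  have hd : Differentiable ℂ γ := by
    have : (γ : V → V) = fun z => γ.linear.toLinearMap.toContinuousLinearMap z + γ 0 := by
      funext z
      have := γ.toAffineMap.decomp
      simpa using congrFun this z
    rw [this]; fun_prop
  have hd' : DifferentiableAt ℂ (fun v => γ v i) w := by
    have := hd w
    fun_prop
  exact (hev.differentiableAt_iff.2 hd').differentiableWithinAt

/-- A morphism of ringed spaces is tested on functions: near `z₀` the components of `F` are the
pull-backs along `f` of the local coordinates on `q '' W`. -/
theorem differentiableAt_lift {p : V → Y} {q : V → Z} {f : Y → Z} (hp : Continuous p)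
    (hf : Continuous f) (hqo : IsOpenMap q)
    (hq : ∀ w w', q w = q w' → ∃ γ : V ≃ᵃ[ℂ] V, γ w = w' ∧ ∀ z, q (γ z) = q z)
    (hfh : ∀ (U : Set Z) (φ : Z → ℂ), IsOpen U → HolomorphicOn q U φ →
      HolomorphicOn p (f ⁻¹' U) (φ ∘ f)) {F : V → V} {z₀ : V} (hF : ContinuousAt F z₀)
    (hqF : ∀ᶠ z in 𝓝 z₀, q (F z) = f (p z)) {W : Set V} (hW : IsOpen W) (hinj : Set.InjOn q W)
    (hz₀ : F z₀ ∈ W) : DifferentiableAt ℂ F z₀ := by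
  obtain ⟨φ, hφ, hφW⟩ := exists_coordinates hq hW hinj
  have hU := hqo _ hW
  rw [differentiableAt_pi]
  intro i
  have h1 := hfh _ _ hU (hφ i)
  have hopen : IsOpen (p ⁻¹' (f ⁻¹' (q '' W))) := (hU.preimage hf).preimage hp
  have hmem : z₀ ∈ p ⁻¹' (f ⁻¹' (q '' W)) := by
    change f (p z₀) ∈ q '' W
    rw [← hqF.self_of_nhds]
    exact ⟨_, hz₀, rfl⟩
  have h2 : DifferentiableAt ℂ ((φ i ∘ f) ∘ p) z₀ := h1.differentiableAt (hopen.mem_nhds hmem)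
  refine Filter.EventuallyEq.differentiableAt_iff ?_ |>.1 h2
  filter_upwards [hqF, hF.preimage_mem_nhds (hW.mem_nhds hz₀)] with z hz hzW
  change φ i (f (p z)) = _
  rw [← hz, hφW i _ hzW]

end LocalCoordinates

/-- A holomorphic map of `ℂ³` whose difference functions are periodic with respect to a lattice is
affine. -/
theorem eq_linear_of_periodic {L : Submodule ℤ V} [DiscreteTopology L]
    (hL : Submodule.span ℝ (L : Set V) = ⊤) {F : V → V} (hF : Differentiable ℂ F)
    (h : ∀ l ∈ L, ∀ z, F (z + l) - F z = F l - F 0) :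
    ∃ M : V →ₗ[ℂ] V, ∀ z, F z = M z + F 0 := by
  have : IsZLattice ℝ L := ⟨hL⟩
  suffices key : ∀ w, F w = F 0 + fderiv ℂ F 0 w from
    ⟨(fderiv ℂ F 0).toLinearMap, fun z => by rw [key z, add_comm]; rfl⟩
  intro w
  let S := Metric.sphere (0 : ℂ) 1
  -- All differences `F (z + s • w) - F z` with `|s| = 1` are collected in one periodic map with
  -- values in a function space, so that compactness of a period bounds them by one constant `C`.
  let K : C(V, C(S, V)) := ContinuousMap.curry
    ⟨fun x : V × S => F (x.1 + (x.2 : ℂ) • w) - F x.1, by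
      have := hF.continuous
      fun_prop⟩
  have hK : ∀ z l, l ∈ L → K (z + l) = K z := by
    intro z l hl
    ext1 s
    change F (z + l + (s : ℂ) • w) - F (z + l) = F (z + (s : ℂ) • w) - F z
    have h1 := h l hl (z + (s : ℂ) • w)
    have h2 := h l hl z
    rw [sub_eq_iff_eq_add] at h1 h2
    rw [add_right_comm, h1, h2]
    abel
  obtain ⟨C, hC⟩ := (IsZLattice.isCompact_range_of_periodic L K K.continuous hK).isBounded.exists_norm_le
  have hCF : ∀ z, ∀ s ∈ S, ‖F (z + s • w) - F z‖ ≤ C := fun z s hs =>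
    ((K z).norm_coe_le_norm ⟨s, hs⟩).trans (hC _ ⟨z, rfl⟩)
  have hg : ∀ z s, HasDerivAt (fun s : ℂ => F (z + s • w)) (fderiv ℂ F (z + s • w) w) s := by
    intro z s
    have h1 : HasDerivAt (fun s : ℂ => z + s • w) w s := by
      simpa using ((hasDerivAt_id s).smul_const w).const_add z
    exact (hF _).hasFDerivAt.comp_hasDerivAt s h1
  -- Cauchy's estimate on the unit circle. The derivative along a line in direction `w` is then
  -- entire and bounded, hence constant by Liouville.
  have hbound : ∀ z, ‖fderiv ℂ F z w‖ ≤ C := by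
    intro z
    have h1 := Complex.norm_deriv_le_of_forall_mem_sphere_norm_le (c := 0) (R := 1) (C := C)
      (f := fun s : ℂ => F (z + s • w) - F z) one_pos
      (Differentiable.diffContOnCl fun s => ((hg z s).sub_const _).differentiableAt) (hCF z)
    have h2 := ((hg z 0).sub_const (F z)).deriv
    rw [h2] at h1
    simpa using h1
  have hdd : Differentiable ℂ (deriv fun s : ℂ => F (0 + s • w)) := by
    rw [← differentiableOn_univ]
    exact DifferentiableOn.deriv (fun s _ => (hg 0 s).differentiableAt.differentiableWithinAt)
      isOpen_univ
  have hconst : ∀ s, deriv (fun s : ℂ => F (0 + s • w)) s = fderiv ℂ F 0 w := by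
    intro s
    rw [hdd.apply_eq_apply_of_bounded ?_ s 0, (hg 0 0).deriv]
    · simp
    · refine isBounded_iff_forall_norm_le.2 ⟨C, ?_⟩
      rintro _ ⟨s, rfl⟩
      rw [(hg 0 s).deriv]
      exact hbound _
  have hz : ∀ s, HasDerivAt (fun s : ℂ => F (0 + s • w) - s • fderiv ℂ F 0 w) 0 s := by
    intro s
    have h1 := (hg 0 s).differentiableAt.hasDerivAt
    rw [hconst] at h1
    have h2 := h1.sub ((hasDerivAt_id s).smul_const (fderiv ℂ F 0 w))
    rw [one_smul, sub_self] at h2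
    exact h2
  have := is_const_of_deriv_eq_zero (fun s => (hz s).differentiableAt) (fun s => (hz s).deriv) 1 0
  simp only [one_smul, zero_add, zero_smul, sub_zero] at this
  rw [← this]
  abel

namespace TorusGroup

variable (A : TorusGroup) [DiscreteTopology A.Λ]

theorem exists_isOpen_injOn_torusProj (w : V) :
    ∃ W : Set V, IsOpen W ∧ w ∈ W ∧ Set.InjOn A.torusProj W := by
  obtain ⟨e, he, h⟩ := A.isCoveringMap_torusProj.isLocalHomeomorph w
  exact ⟨e.source, e.open_source, he, h ▸ e.injOn⟩

theorem exists_linear_lift (hL : Submodule.span ℝ (A.Λ : Set V) = ⊤) {σ : A.Torus → A.Torus}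
    (hσ : IsHolomorphicMap A.torusProj A.torusProj σ) :
    ∃ (M : V →ₗ[ℂ] V) (b : V), ∀ z, σ (A.torusProj z) = A.torusProj (M z + b) := by
  have hp := A.torusProj_continuous
  have hσc := hσ.1
  obtain ⟨e₀, he₀⟩ := A.torusProj_surjective (σ (A.torusProj 0))
  obtain ⟨F, ⟨-, hF⟩, -⟩ := A.isCoveringMap_torusProj.existsUnique_continuousMap_lifts
    (⟨fun z : V => σ (A.torusProj z), by fun_prop⟩ : C(V, A.Torus)) 0 e₀ he₀
  have hF' : ∀ z, A.torusProj (F z) = σ (A.torusProj z) := fun z => congrFun hF z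
  have hd : Differentiable ℂ F := fun z => by
    obtain ⟨W, hW, hz, hinj⟩ := A.exists_isOpen_injOn_torusProj (F z)
    refine differentiableAt_lift hp hσc A.isOpenQuotientMap_torusProj.isOpenMap ?_ hσ.2
      F.continuous.continuousAt (Filter.Eventually.of_forall hF') hW hinj hz
    intro w w' h
    refine ⟨AffineEquiv.constVAdd ℂ V (w' - w), by simp, fun z => ?_⟩
    rw [torusProj_eq_iff]
    simpa using A.torusProj_eq_iff.1 h.symm
  obtain ⟨M, hM⟩ := eq_linear_of_periodic hL hd fun l hl z => by
    have := A.const_of_mem (F := fun z => F (z + l) - F z) (by fun_prop) (fun z => by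
      rw [← torusProj_eq_iff, hF', hF']
      congr 1
      rw [torusProj_eq_iff]; simpa) z 0
    simpa using this
  exact ⟨M, F 0, fun z => by rw [← hM, hF']⟩

end TorusGroup

/-- A quotient in the class to be classified is the quotient by a group of affine maps. -/
theorem IsRigidZ3CubeQuotient.isAffineQuotient {A : TorusGroup} (hA : IsRigidZ3CubeQuotient A) :
    IsAffineQuotient A := by
  have := hA.discrete
  refine ⟨hA.discrete, hA.span_top, fun σ hσ => ?_, hA.group_iso, hA.translation_free,
    hA.isolated⟩
  obtain ⟨M, b, h⟩ := A.exists_linear_lift hA.span_top (hA.holomorphic σ hσ)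
  obtain ⟨M', b', h'⟩ := A.exists_linear_lift hA.span_top (hA.holomorphic σ⁻¹ (inv_mem hσ))
  have hinv : ∀ {M M' : V →ₗ[ℂ] V} {b b' : V} {σ τ : Equiv.Perm A.Torus},
      (∀ z, σ (A.torusProj z) = A.torusProj (M z + b)) →
      (∀ z, τ (A.torusProj z) = A.torusProj (M' z + b')) → σ * τ = 1 → M ∘ₗ M' = LinearMap.id := by
    intro M M' b b' σ τ h h' hστ
    refine LinearMap.ext fun z => ?_
    have hM := M.continuous_of_finiteDimensional
    have hM' := M'.continuous_of_finiteDimensional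
    have := A.const_of_mem (F := fun z => M (M' z + b') + b - z) (by fun_prop) (fun z => by
      rw [← TorusGroup.torusProj_eq_iff, ← h, ← h', ← Equiv.Perm.mul_apply, hστ]; rfl) z 0
    simp only [map_add, map_zero, zero_add, sub_zero] at this
    have h3 : M (M' z) = z := by
      rw [← sub_eq_zero]
      linear_combination (exp := 1) this
    exact h3
  let e : V ≃ₗ[ℂ] V := LinearEquiv.ofLinearMap M M' (hinv h h' (by simp)) (hinv h' h (by simp))
  refine ⟨e.toAffineEquiv.trans (AffineEquiv.constVAdd ℂ V b), fun z => ?_⟩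
  rw [h]
  simp [e, add_comm]

end TorusQuotient
end

/-! ### Transport of quotients along affine changes of coordinates -/

noncomputable section

namespace TorusQuotient

open Topology

namespace TorusGroup

variable (A : TorusGroup) {B : TorusGroup}

theorem isQuotientMap_proj : IsQuotientMap A.proj :=
  isQuotientMap_quotient_mk'.comp A.isOpenQuotientMap_torusProj.isQuotientMap

variable {A}

/-- A homeomorphism of `ℂ³` which respects the fibres of the projections induces a homeomorphism
of the quotients. -/
theorem exists_homeomorph (Φ : V ≃ₜ V)
    (h : ∀ z w, A.proj z = A.proj w ↔ B.proj (Φ z) = B.proj (Φ w)) :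
    ∃ f : A.Space ≃ₜ B.Space, ∀ z, f (A.proj z) = B.proj (Φ z) := by
  have hA := A.isQuotientMap_proj
  have hB := B.isQuotientMap_proj
  let s := Function.surjInv hA.surjective
  have hs : ∀ x, A.proj (s x) = x := Function.surjInv_eq hA.surjective
  let s' := Function.surjInv hB.surjective
  have hs' : ∀ x, B.proj (s' x) = x := Function.surjInv_eq hB.surjective
  have h1 : ∀ z, B.proj (Φ (s (A.proj z))) = B.proj (Φ z) := fun z => (h _ _).1 (hs _)
  have h2 : ∀ z, A.proj (Φ.symm (s' (B.proj z))) = A.proj (Φ.symm z) := fun z =>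
    (h _ _).2 (by simp [hs'])
  refine ⟨⟨⟨fun x => B.proj (Φ (s x)), fun x => A.proj (Φ.symm (s' x)), fun x => ?_, fun x => ?_⟩,
    ?_, ?_⟩, h1⟩
  · exact (h2 _).trans (by rw [Φ.symm_apply_apply, hs])
  · exact (h1 _).trans (by rw [Φ.apply_symm_apply, hs'])
  · exact hA.continuous_iff.2 ((hB.continuous.comp Φ.continuous).congr fun z => (h1 z).symm)
  · exact hB.continuous_iff.2 ((hA.continuous.comp Φ.symm.continuous).congr fun z => (h2 z).symm)

theorem isBiholomorphism_of_lift {f : A.Space ≃ₜ B.Space} {Φ : V ≃ₜ V} (hd : Differentiable ℂ Φ)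
    (hd' : Differentiable ℂ Φ.symm) (hf : ∀ z, f (A.proj z) = B.proj (Φ z)) :
    IsBiholomorphism A.proj B.proj f := by
  intro U φ _
  have hset : A.proj ⁻¹' (f ⁻¹' U) = Φ ⁻¹' (B.proj ⁻¹' U) := by
    ext z
    simp only [Set.mem_preimage, hf]
  have hfun : (φ ∘ f) ∘ A.proj = (φ ∘ B.proj) ∘ Φ := by
    funext z
    simp only [Function.comp_apply, hf]
  unfold HolomorphicOn
  rw [hset, hfun]
  refine ⟨fun h => h.comp hd.differentiableOn fun z hz => hz, fun h => ?_⟩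
  have := h.comp (s := B.proj ⁻¹' U) hd'.differentiableOn fun z hz => by
    simpa using hz
  refine this.congr fun z _ => by simp

theorem isDiffeomorphism_of_lift {f : A.Space ≃ₜ B.Space} {Φ : V ≃ₜ V}
    (hd : ContDiff ℝ (⊤ : ℕ∞) Φ) (hd' : ContDiff ℝ (⊤ : ℕ∞) Φ.symm)
    (hf : ∀ z, f (A.proj z) = B.proj (Φ z)) : IsDiffeomorphism A.proj B.proj f := by
  intro U φ _
  have hset : A.proj ⁻¹' (f ⁻¹' U) = Φ ⁻¹' (B.proj ⁻¹' U) := by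
    ext z
    simp only [Set.mem_preimage, hf]
  have hfun : (φ ∘ f) ∘ A.proj = (φ ∘ B.proj) ∘ Φ := by
    funext z
    simp only [Function.comp_apply, hf]
  unfold SmoothOn
  rw [hset, hfun]
  refine ⟨fun h => h.comp hd.contDiffOn fun z hz => hz, fun h => ?_⟩
  have := h.comp (s := B.proj ⁻¹' U) hd'.contDiffOn fun z hz => by
    simpa using hz
  refine this.congr fun z _ => by simp

variable (A)

/-- The image of a lattice under the linear part of an affine map. -/
def mapLattice (Φ : V ≃ᵃ[ℂ] V) : Submodule ℤ V :=
  A.Λ.map (Φ.linear.toLinearMap.restrictScalars ℤ)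

theorem mem_mapLattice {Φ : V ≃ᵃ[ℂ] V} {v : V} :
    v ∈ A.mapLattice Φ ↔ Φ.linear.symm v ∈ A.Λ := by
  constructor
  · rintro ⟨w, hw, rfl⟩
    simpa using hw
  · intro h
    exact ⟨_, h, by simp⟩

/-- The isomorphism of tori induced by an affine map. -/
def torusEquiv (Φ : V ≃ᵃ[ℂ] V) : (V ⧸ A.Λ) ≃ (V ⧸ A.mapLattice Φ) :=
  (Submodule.Quotient.equiv A.Λ (A.mapLattice Φ) (Φ.linear.restrictScalars ℤ) rfl).toEquiv.trans
    (Equiv.addRight (Submodule.Quotient.mk (Φ 0)))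

/-- The transport of a quotient by an affine change of coordinates. -/
def transport (Φ : V ≃ᵃ[ℂ] V) : TorusGroup where
  Λ := A.mapLattice Φ
  G := A.G.map (A.torusEquiv Φ).permCongrHom.toMonoidHom

variable {A}

theorem torusEquiv_torusProj (Φ : V ≃ᵃ[ℂ] V) (z : V) :
    A.torusEquiv Φ (A.torusProj z) = (A.transport Φ).torusProj (Φ z) := by
  have h : Φ z = Φ.linear z + Φ 0 := by
    simpa using congrFun Φ.toAffineMap.decomp z
  rw [h]
  rfl

theorem torusEquiv_symm_torusProj (Φ : V ≃ᵃ[ℂ] V) (z : V) :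
    (A.torusEquiv Φ).symm ((A.transport Φ).torusProj z) = A.torusProj (Φ.symm z) := by
  refine (Equiv.symm_apply_eq _).2 ?_
  rw [torusEquiv_torusProj, AffineEquiv.apply_symm_apply]

theorem transport_lifts {Φ : V ≃ᵃ[ℂ] V} {F : V → V} :
    (A.transport Φ).Lifts F ↔ A.Lifts fun z => Φ.symm (F (Φ z)) := by
  constructor
  · rintro ⟨_, ⟨σ, hσ, rfl⟩, h⟩
    refine ⟨σ, hσ, fun z => ?_⟩
    have := h (Φ z)
    rw [← torusEquiv_symm_torusProj, ← this]
    change _ = (A.torusEquiv Φ).symm (A.torusEquiv Φ (σ ((A.torusEquiv Φ).symm _)))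
    rw [Equiv.symm_apply_apply, ← torusEquiv_torusProj, Equiv.symm_apply_apply]
  · rintro ⟨σ, hσ, h⟩
    refine ⟨_, ⟨σ, hσ, rfl⟩, fun z => ?_⟩
    change A.torusEquiv Φ (σ ((A.torusEquiv Φ).symm _)) = _
    rw [torusEquiv_symm_torusProj, h, torusEquiv_torusProj]
    simp only [AffineEquiv.apply_symm_apply]
    rfl

theorem transport_proj_eq_iff (Φ : V ≃ᵃ[ℂ] V) (z w : V) :
    A.proj z = A.proj w ↔ (A.transport Φ).proj (Φ z) = (A.transport Φ).proj (Φ w) := by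
  rw [proj_eq_iff, proj_eq_iff]
  constructor
  · rintro ⟨σ, hσ, h⟩
    refine ⟨_, ⟨σ, hσ, rfl⟩, ?_⟩
    change A.torusEquiv Φ (σ ((A.torusEquiv Φ).symm _)) = _
    rw [← torusEquiv_torusProj, Equiv.symm_apply_apply, h, torusEquiv_torusProj]
  · rintro ⟨_, ⟨σ, hσ, rfl⟩, h⟩
    refine ⟨σ, hσ, ?_⟩
    change A.torusEquiv Φ (σ ((A.torusEquiv Φ).symm _)) = _ at h
    rw [← torusEquiv_torusProj, ← torusEquiv_torusProj, Equiv.symm_apply_apply] at h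
    exact (A.torusEquiv Φ).injective h

end TorusGroup

theorem _root_.AffineEquiv.differentiable_complex (Φ : V ≃ᵃ[ℂ] V) : Differentiable ℂ Φ := by
  have : (Φ : V → V) = fun z => Φ.linear.toLinearMap.toContinuousLinearMap z + Φ 0 := by
    funext z
    have := Φ.toAffineMap.decomp
    simpa using congrFun this z
  rw [this]; fun_prop

theorem biholomorphic_transport (A : TorusGroup) (Φ : V ≃ᵃ[ℂ] V) :
    Biholomorphic A (A.transport Φ) := by
  let Φh : V ≃ₜ V := ⟨Φ.toEquiv, Φ.continuous_of_finiteDimensional,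
    Φ.symm.continuous_of_finiteDimensional⟩
  obtain ⟨f, hf⟩ := TorusGroup.exists_homeomorph Φh (TorusGroup.transport_proj_eq_iff (A := A) Φ)
  exact ⟨f, TorusGroup.isBiholomorphism_of_lift (Φ := Φh) Φ.differentiable_complex
    Φ.symm.differentiable_complex hf⟩

theorem Biholomorphic.trans {A B C : TorusGroup} (h : Biholomorphic A B) (h' : Biholomorphic B C) :
    Biholomorphic A C := by
  obtain ⟨f, hf⟩ := h
  obtain ⟨g, hg⟩ := h'
  refine ⟨f.trans g, fun U φ hU => (hg U φ hU).trans ?_⟩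
  exact hf (g ⁻¹' U) (φ ∘ g) (hU.preimage g.continuous)

theorem IsAffineQuotient.transport {A : TorusGroup} (hA : IsAffineQuotient A) (Φ : V ≃ᵃ[ℂ] V) :
    IsAffineQuotient (A.transport Φ) := by
  have hd := hA.discrete
  have hlin : Continuous Φ.linear.symm.toLinearMap :=
    LinearMap.continuous_of_finiteDimensional _
  refine ⟨?_, ?_, ?_, ?_, ?_, ?_⟩
  · let g : A.mapLattice Φ → A.Λ := fun v => ⟨Φ.linear.symm v, A.mem_mapLattice.1 v.2⟩
    refine DiscreteTopology.of_continuous_injective (f := g) ?_ ?_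
    · exact (hlin.comp continuous_subtype_val).subtype_mk _
    · intro v w h
      exact Subtype.ext (Φ.linear.symm.injective (congrArg Subtype.val h))
  · have : ((A.mapLattice Φ : Submodule ℤ V) : Set V) =
        (Φ.linear.toLinearMap.restrictScalars ℝ) '' (A.Λ : Set V) := rfl
    change Submodule.span ℝ ((A.mapLattice Φ : Submodule ℤ V) : Set V) = ⊤
    rw [this, ← Submodule.map_span, hA.span_top, Submodule.map_top, LinearMap.range_eq_top]
    exact Φ.linear.surjective
  · rintro _ ⟨σ, hσ, rfl⟩
    obtain ⟨γ, hγ⟩ := hA.exists_affine σ hσ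
    refine ⟨(Φ.symm.trans γ).trans Φ, fun z => ?_⟩
    change A.torusEquiv Φ (σ ((A.torusEquiv Φ).symm _)) = _
    rw [TorusGroup.torusEquiv_symm_torusProj, hγ, TorusGroup.torusEquiv_torusProj]
    rfl
  · obtain ⟨e⟩ := hA.group_iso
    exact ⟨(A.G.equivMapOfInjective _ (A.torusEquiv Φ).permCongrHom.injective).symm.trans e⟩
  · rintro _ ⟨σ, hσ, rfl⟩ ⟨b, hb⟩
    obtain ⟨b, rfl⟩ := (A.transport Φ).torusProj_surjective b
    suffices h : σ = 1 by rw [h, map_one]; rfl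
    refine hA.translation_free σ hσ ⟨A.torusProj (Φ.linear.symm b), fun x => ?_⟩
    obtain ⟨z, rfl⟩ := A.torusProj_surjective x
    have := hb (A.torusEquiv Φ (A.torusProj z))
    change A.torusEquiv Φ (σ ((A.torusEquiv Φ).symm _)) = _ at this
    rw [Equiv.symm_apply_apply] at this
    replace this := ((Equiv.eq_symm_apply _).2 this).trans
      (congrArg (fun x : (A.transport Φ).Torus => (A.torusEquiv Φ).symm (x + (A.transport Φ).torusProj b))
        (TorusGroup.torusEquiv_torusProj Φ z))
    replace this := this.trans (TorusGroup.torusEquiv_symm_torusProj Φ (Φ z + b))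
    rw [this, ← TorusGroup.torusProj_add]
    congr 1
    apply Φ.injective
    rw [Φ.apply_symm_apply, add_comm z, ← vadd_eq_add (Φ.linear.symm b), Φ.map_vadd]
    simp [add_comm]
  · refine (hA.isolated.image (A.torusEquiv Φ)).subset ?_
    rintro x ⟨_, ⟨σ, hσ, rfl⟩, h1, hx⟩
    refine ⟨(A.torusEquiv Φ).symm x, ⟨σ, hσ, fun h => h1 (by rw [h, map_one]; rfl), ?_⟩, by simp⟩
    change A.torusEquiv Φ (σ ((A.torusEquiv Φ).symm _)) = _ at hx
    rw [← Equiv.eq_symm_apply] at hx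
    exact hx

end TorusQuotient
end

/-! ### Eisenstein integers and simultaneous diagonalisation -/

noncomputable section

namespace TorusQuotient

open Topology

theorem ζ_isPrimitiveRoot : IsPrimitiveRoot ζ 3 := by
  have := Complex.isPrimitiveRoot_exp 3 (by norm_num)
  simpa [ζ] using this

@[simp] theorem ζ_pow_three : ζ ^ 3 = 1 := ζ_isPrimitiveRoot.pow_eq_one

theorem ζ_sq : ζ ^ 2 = -1 - ζ := by
  have h := ζ_isPrimitiveRoot.geom_sum_eq_zero (by norm_num)
  simp only [Finset.sum_range_succ, Finset.range_zero, Finset.sum_empty, pow_zero, pow_one] at h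
  linear_combination h

theorem ζ_ne_zero : ζ ≠ 0 := Complex.exp_ne_zero _

theorem ζ_ne_one : ζ ≠ 1 := ζ_isPrimitiveRoot.ne_one (by norm_num)

theorem ζ_re : ζ.re = -1 / 2 := by
  have h := Complex.exp_re (2 * Real.pi * Complex.I / 3)
  have h1 : (2 * Real.pi * Complex.I / 3 : ℂ) = ((2 * Real.pi / 3 : ℝ) : ℂ) * Complex.I := by
    push_cast; ring
  have h2 : (2 * Real.pi / 3 : ℝ) = Real.pi - Real.pi / 3 := by ring
  rw [ζ, h1, Complex.exp_ofReal_mul_I_re, h2, Real.cos_pi_sub, Real.cos_pi_div_three]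
  norm_num

theorem ζ_im : ζ.im = √3 / 2 := by
  have h1 : (2 * Real.pi * Complex.I / 3 : ℂ) = ((2 * Real.pi / 3 : ℝ) : ℂ) * Complex.I := by
    push_cast; ring
  have h2 : (2 * Real.pi / 3 : ℝ) = Real.pi - Real.pi / 3 := by ring
  rw [ζ, h1, Complex.exp_ofReal_mul_I_im, h2, Real.sin_pi_sub, Real.sin_pi_div_three]

theorem conj_ζ : (starRingEnd ℂ) ζ = ζ ^ 2 := by
  rw [ζ_sq]
  apply Complex.ext
  · simp [ζ_re]; norm_num
  · simp

theorem ζ_norm : ‖ζ‖ = 1 := ζ_isPrimitiveRoot.norm'_eq_one (by norm_num)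

theorem add_mul_ζ_eq_zero {a b : ℝ} (h : (a + b * ζ : ℂ) = 0) : a = 0 ∧ b = 0 := by
  have him := congrArg Complex.im h
  have hre := congrArg Complex.re h
  simp [ζ_re, ζ_im] at him hre
  subst him
  simpa using hre

theorem add_mul_ζ_inj {a b c d : ℝ} (h : (a + b * ζ : ℂ) = c + d * ζ) : a = c ∧ b = d := by
  have := add_mul_ζ_eq_zero (a := a - c) (b := b - d) (by push_cast; linear_combination h)
  exact ⟨sub_eq_zero.1 this.1, sub_eq_zero.1 this.2⟩

theorem exists_add_mul_ζ (x : ℂ) : ∃ a b : ℝ, x = a + b * ζ := by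
  refine ⟨x.re + x.im / √3, 2 * x.im / √3, Complex.ext ?_ ?_⟩
  · simp [ζ_re]; ring
  · simp [ζ_im]; field_simp

theorem normSq_add_mul_ζ (a b : ℝ) : Complex.normSq (a + b * ζ) = a ^ 2 - a * b + b ^ 2 := by
  have h3 : √3 ^ 2 = 3 := Real.sq_sqrt (by norm_num)
  rw [Complex.normSq_apply]
  simp [ζ_re, ζ_im]
  linear_combination b ^ 2 / 4 * h3

/-- The ring of Eisenstein integers, as a lattice in `ℂ`. -/
abbrev eis : Submodule ℤ ℂ := Submodule.span ℤ {1, ζ}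

theorem mem_eis {x : ℂ} : x ∈ eis ↔ ∃ a b : ℤ, x = a + b * ζ := by
  rw [eis, Submodule.mem_span_pair]
  simp [eq_comm]

theorem mem_eis_int (a b : ℤ) : (a + b * ζ : ℂ) ∈ eis := mem_eis.2 ⟨a, b, rfl⟩

theorem one_mem_eis : (1 : ℂ) ∈ eis := mem_eis.2 ⟨1, 0, by simp⟩

theorem ζ_mem_eis : ζ ∈ eis := mem_eis.2 ⟨0, 1, by simp⟩

theorem mul_mem_eis {x y : ℂ} (hx : x ∈ eis) (hy : y ∈ eis) : x * y ∈ eis := by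
  obtain ⟨a, b, rfl⟩ := mem_eis.1 hx
  obtain ⟨c, d, rfl⟩ := mem_eis.1 hy
  exact mem_eis.2 ⟨a * c - b * d, a * d + b * c - b * d, by
    push_cast; linear_combination (b * d : ℂ) * ζ_sq⟩

theorem mem_Λ₁ {v : V} : v ∈ Λ₁ ↔ ∀ i, v i ∈ eis := by
  simp [Λ₁, Submodule.mem_pi]

theorem pow_mod_three (n : ℕ) : ζ ^ n = ζ ^ (n % 3) := by
  conv_lhs => rw [← Nat.div_add_mod n 3, pow_add, pow_mul, ζ_pow_three, one_pow, one_mul]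

/-- The diagonal matrix with entries `ζ ^ e i`, as a vector. -/
def dz (e : Fin 3 → ZMod 3) : V := fun i => ζ ^ (e i).val

theorem ζ_pow_val_add (a b : ZMod 3) : ζ ^ (a + b).val = ζ ^ a.val * ζ ^ b.val := by
  rw [ZMod.val_add, ← pow_mod_three, pow_add]

theorem dz_add (e e' : Fin 3 → ZMod 3) : dz (e + e') = dz e * dz e' := by
  funext i; exact ζ_pow_val_add _ _

theorem ζ_pow_val_injective : Function.Injective fun a : ZMod 3 => ζ ^ a.val := by
  intro a b h
  exact ZMod.val_injective 3 (ζ_isPrimitiveRoot.pow_inj (ZMod.val_lt a) (ZMod.val_lt b) h)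

theorem dz_injective : Function.Injective dz := fun _ _ h =>
  funext fun i => ζ_pow_val_injective (congrFun h i)

theorem exists_eq_ζ_pow {x : ℂ} (hx : x ^ 3 = 1) : ∃ a : ZMod 3, x = ζ ^ a.val := by
  obtain ⟨i, hi, h⟩ := ζ_isPrimitiveRoot.eq_pow_of_pow_eq_one hx
  exact ⟨i, by rw [ZMod.val_natCast, Nat.mod_eq_of_lt hi, h]⟩

/-- A finite commuting family of endomorphisms of `ℂ³` of order dividing three is diagonal in a
suitable basis. -/
theorem exists_basis_eigenvectors {ι : Type*} (f : ι → Module.End ℂ V)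
    (hc : ∀ i j, Commute (f i) (f j)) (h3 : ∀ i, f i ^ 3 = 1) :
    ∃ b : Module.Basis (Fin 3) ℂ V, ∀ i, ∃ d : Fin 3 → ℂ, ∀ j, f i (b j) = d j • b j := by
  -- `X ^ 3 - 1` is separable over `ℂ`, so generalised eigenspaces are eigenspaces and the common
  -- eigenvectors span.
  have hss : ∀ i, (f i).IsFinitelySemisimple := by
    intro i
    refine Module.End.IsSemisimple.isFinitelySemisimple ?_
    refine Module.End.isSemisimple_of_squarefree_aeval_eq_zero
      (p := (Polynomial.X ^ 3 - 1 : Polynomial ℂ)) ?_ (by simp [h3])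
    exact (Polynomial.separable_X_pow_sub_C (1 : ℂ) (by norm_num) one_ne_zero).squarefree
  have htop := Module.End.iSup_iInf_maxGenEigenspace_eq_top_of_iSup_maxGenEigenspace_eq_top_of_commute
    f (fun i j _ => hc i j) fun i => Module.End.iSup_maxGenEigenspace_eq_top (f i)
  have hspan : ⊤ ≤ Submodule.span ℂ {v : V | ∀ i, ∃ d : ℂ, f i v = d • v} := by
    rw [← htop]
    refine iSup_le fun χ v hv => Submodule.subset_span fun i => ⟨χ i, ?_⟩
    have := (Submodule.mem_iInf _).1 hv i
    rwa [(hss i).maxGenEigenspace_eq_eigenspace, Module.End.mem_eigenspace_iff] at this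
  let b₀ := Module.Basis.ofSpan hspan
  let e := b₀.indexEquiv (Pi.basisFun ℂ (Fin 3))
  have hb : ∀ j, ∀ i, ∃ d : ℂ, f i ((b₀.reindex e) j) = d • (b₀.reindex e) j := by
    intro j
    have h1 : (b₀.reindex e) j ∈ Set.range b₀ := ⟨e.symm j, by simp⟩
    exact Module.Basis.ofSpan_subset hspan h1
  refine ⟨b₀.reindex e, fun i => ?_⟩
  choose d hd using fun j => hb j i
  exact ⟨d, hd⟩

namespace IsAffineQuotient

variable {A : TorusGroup} (hA : IsAffineQuotient A)
include hA

/-- In suitable linear coordinates, the linear parts of the elements of the group are all diagonal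
matrices with third roots of unity as entries. -/
theorem exists_diagonal : ∃ Φ : V ≃ᵃ[ℂ] V, ∀ e : Fin 3 → ZMod 3, ∃ c : V,
    (A.transport Φ).Lifts (affine (dz e) c) := by
  have := hA.discrete
  have := hA.finite
  obtain ⟨ε⟩ := hA.group_iso
  choose γ hγ using fun σ : A.G => hA.exists_affine σ σ.2
  have hdec : ∀ σ z, γ σ z = (γ σ).linear z + γ σ 0 := fun σ z => by
    simpa using congrFun (γ σ).toAffineMap.decomp z
  let M : A.G → Module.End ℂ V := fun σ => (γ σ).linear.toLinearMap
  have hMd : ∀ σ z, γ σ z = M σ z + γ σ 0 := hdec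
  have hMc : ∀ σ, Continuous (M σ) := fun σ => LinearMap.continuous_of_finiteDimensional _
  have hmul : ∀ σ τ, M (σ * τ) = M σ * M τ := by
    intro σ τ
    refine LinearMap.ext fun z => ?_
    have := A.const_of_mem
      (F := fun z => M (σ * τ) z + γ (σ * τ) 0 - (M σ (M τ z + γ τ 0) + γ σ 0))
      (by have := hMc σ; have := hMc τ; have := hMc (σ * τ); fun_prop) (fun z => by
        rw [← hMd, ← hMd, ← hMd, ← TorusGroup.torusProj_eq_iff, ← hγ, ← hγ, ← hγ]; rfl) z 0
    simp only [map_add, map_zero, zero_add] at this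
    rw [← sub_eq_zero, Module.End.mul_apply]
    linear_combination (exp := 1) this
  -- An element with trivial linear part is a translation; the linear representation is therefore
  -- faithful.
  have hone : ∀ σ, M σ = 1 → σ = 1 := by
    intro σ h
    refine Subtype.ext (hA.translation_free σ σ.2 ⟨A.torusProj (γ σ 0), fun x => ?_⟩)
    obtain ⟨z, rfl⟩ := A.torusProj_surjective x
    rw [hγ, hMd, h]; rfl
  have hM1 : M 1 = 1 := by
    have h := hmul 1 1
    rw [mul_one] at h
    have hu : IsUnit (M 1) := by
      refine (Module.End.isUnit_iff _).2 (γ 1).linear.bijective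
    exact (hu.mul_eq_left.1 h.symm)
  have hinj : Function.Injective M := by
    intro σ τ h
    have h1 : M (σ * τ⁻¹) = 1 := by rw [hmul, h, ← hmul, mul_inv_cancel, hM1]
    exact mul_inv_eq_one.1 (hone _ h1)
  have hcomm : ∀ σ τ : A.G, σ * τ = τ * σ := fun σ τ =>
    ε.injective (by rw [map_mul, map_mul, mul_comm])
  have hcube : ∀ σ : A.G, σ ^ 3 = 1 := fun σ => ε.injective (by
    rw [map_pow, map_one]
    apply Multiplicative.toAdd.injective
    funext i
    simp only [toAdd_pow, toAdd_one, Pi.smul_apply, Pi.zero_apply]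
    exact ZModModule.char_nsmul_eq_zero 3 _)
  have hM3 : ∀ σ, M σ ^ 3 = 1 := fun σ => by
    rw [pow_succ, pow_two, ← hmul, ← hmul, ← pow_two, ← pow_succ, hcube, hM1]
  obtain ⟨b, hb⟩ := exists_basis_eigenvectors M
    (fun σ τ => by rw [Commute, SemiconjBy, ← hmul, hcomm, hmul]) hM3
  choose d hd using hb
  have hb0 : ∀ j, b j ≠ 0 := fun j => b.ne_zero j
  have hd3 : ∀ σ j, d σ j ^ 3 = 1 := by
    intro σ j
    have h1 : (M σ ^ 3) (b j) = d σ j ^ 3 • b j := by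
      rw [pow_succ, pow_two, Module.End.mul_apply, Module.End.mul_apply, hd, map_smul, map_smul,
        hd, map_smul, hd, smul_smul, smul_smul]
      ring_nf
    rw [hM3, Module.End.one_apply] at h1
    have h2 : (d σ j ^ 3 - 1) • b j = 0 := by rw [sub_smul, ← h1, one_smul, sub_self]
    rcases smul_eq_zero.1 h2 with h | h
    · exact sub_eq_zero.1 h
    · exact absurd h (hb0 j)
  choose e he using fun σ j => exists_eq_ζ_pow (hd3 σ j)
  have heinj : Function.Injective e := by
    intro σ τ h
    refine hinj (b.ext fun j => ?_)
    rw [hd, hd, he, he, h]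
  -- Both sides have 27 elements, so every diagonal matrix of third roots of unity is a linear part.
  have hesurj : Function.Surjective e := by
    have : Fintype A.G := Fintype.ofFinite _
    refine (Fintype.bijective_iff_injective_and_card e).2 ⟨heinj, ?_⟩ |>.2
    exact Fintype.card_congr (ε.toEquiv.trans Multiplicative.toAdd)
  refine ⟨b.equivFun.toAffineEquiv, fun e' => ?_⟩
  obtain ⟨σ, rfl⟩ := hesurj e'
  refine ⟨b.equivFun (γ σ 0), TorusGroup.transport_lifts.2 ⟨σ, σ.2, fun z => ?_⟩⟩
  rw [hγ, hMd]
  congr 1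
  change _ = b.equivFun.symm (dz (e σ) * b.equivFun z + b.equivFun (γ σ 0))
  rw [map_add, LinearEquiv.symm_apply_apply]
  congr 1
  conv_lhs => rw [← b.equivFun.symm_apply_apply z]
  generalize b.equivFun z = y
  rw [b.equivFun_symm_apply, b.equivFun_symm_apply, map_sum]
  refine Finset.sum_congr rfl fun j _ => ?_
  rw [map_smul, hd, he, smul_smul, mul_comm]
  rfl

/-- A non-identity affine map which induces an element of the group and has `1` as an eigenvalue
acts without fixed points on the torus. -/
theorem sub_notMem_of_diagonal {d c : V} (h : A.Lifts (affine d c)) (hd : d ≠ 1) {i : Fin 3}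
    (hi : d i = 1) (z : V) : affine d c z - z ∉ A.Λ := by
  have := hA.discrete
  intro hz
  obtain ⟨σ, hσ, hF⟩ := h
  have hσ1 : σ ≠ 1 := by
    rintro rfl
    refine hd (funext fun j => ?_)
    have := A.const_of_mem (F := fun z => affine d c z - z) (by unfold affine; fun_prop)
      (fun z => by rw [← TorusGroup.torusProj_eq_iff, ← hF]; rfl) (Pi.single j 1) 0
    have h2 := congrFun this j
    simp [affine] at h2
    rw [Pi.one_apply]
    linear_combination h2
  -- Moving along an axis with eigenvalue one does not change `affine d c z - z`, so a fixed point
  -- brings a complex line of them, against countability of `sing`.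
  have hmem : ∀ s : ℂ, z + Pi.single i s ∈ A.sing := fun s => by
    refine ⟨σ, hσ, hσ1, ?_⟩
    rw [hF, TorusGroup.torusProj_eq_iff]
    convert hz using 1
    funext j
    by_cases hj : j = i
    · subst hj; simp [affine, hi]
    · simp [affine, hj]
  have hcount : (Set.univ : Set ℂ).Countable := by
    refine Set.countable_of_injective_of_countable_image (f := fun s => z + Pi.single i s) ?_
      (hA.countable_sing.mono (by rintro _ ⟨s, -, rfl⟩; exact hmem s))
    intro s _ s' _ hs
    exact Pi.single_injective i (add_left_cancel hs)
  exact not_countable_complex hcount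

end IsAffineQuotient

end TorusQuotient
end

noncomputable section

namespace TorusQuotient

open Topology

/-! ### Changes of coordinates -/

/-- The affine map `z ↦ m * z + s`, where `m` has no zero entry. -/
def diagAff (m s : V) (hm : ∀ i, m i ≠ 0) : V ≃ᵃ[ℂ] V :=
  (LinearEquiv.piCongrRight fun i =>
    LinearEquiv.smulOfNeZero ℂ ℂ (m i) (hm i)).toAffineEquiv.trans (AffineEquiv.constVAdd ℂ V s)

theorem diagAff_apply {m s : V} (hm : ∀ i, m i ≠ 0) (z : V) : diagAff m s hm z = m * z + s := by
  funext i; simp [diagAff, add_comm]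

theorem diagAff_symm_apply {m s : V} (hm : ∀ i, m i ≠ 0) (z : V) :
    (diagAff m s hm).symm z = m⁻¹ * (z - s) := by
  rw [← AffineEquiv.coe_toEquiv, AffineEquiv.toEquiv_symm, Equiv.symm_apply_eq]
  change _ = diagAff m s hm _
  rw [diagAff_apply]
  funext i
  simp [mul_inv_cancel_left₀ (hm i)]

theorem diagAff_linear_symm_apply {m s : V} (hm : ∀ i, m i ≠ 0) (z : V) :
    (diagAff m s hm).linear.symm z = m⁻¹ * z := by
  rw [LinearEquiv.symm_apply_eq]
  funext i
  change z i = m i * ((m i)⁻¹ * z i)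
  rw [mul_inv_cancel_left₀ (hm i)]

/-- The permutation of the coordinates by `π`. -/
def permAff (π : Equiv.Perm (Fin 3)) : V ≃ᵃ[ℂ] V := (LinearEquiv.funCongrLeft ℂ ℂ π).toAffineEquiv

theorem permAff_apply (π : Equiv.Perm (Fin 3)) (z : V) : permAff π z = z ∘ π := rfl

theorem permAff_symm_apply (π : Equiv.Perm (Fin 3)) (z : V) : (permAff π).symm z = z ∘ π.symm := rfl

namespace TorusGroup

variable {A : TorusGroup}

theorem mem_transport_diagAff {m s : V} (hm : ∀ i, m i ≠ 0) {v : V} :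
    v ∈ (A.transport (diagAff m s hm)).Λ ↔ m⁻¹ * v ∈ A.Λ := by
  rw [← diagAff_linear_symm_apply hm (s := s)]
  exact A.mem_mapLattice

theorem mem_transport_permAff {π : Equiv.Perm (Fin 3)} {v : V} :
    v ∈ (A.transport (permAff π)).Λ ↔ v ∘ π.symm ∈ A.Λ :=
  A.mem_mapLattice

theorem Lifts.transport_diagAff {m s : V} (hm : ∀ i, m i ≠ 0) {d c : V}
    (h : A.Lifts (affine d c)) :
    (A.transport (diagAff m s hm)).Lifts (affine d (m * c + s - d * s)) := by
  rw [transport_lifts]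
  convert h using 1
  funext z
  rw [diagAff_symm_apply, diagAff_apply]
  funext i
  have := hm i
  simp only [affine, Pi.mul_apply, Pi.inv_apply, Pi.sub_apply, Pi.add_apply]
  field_simp
  ring

theorem Lifts.transport_permAff (π : Equiv.Perm (Fin 3)) {d c : V} (h : A.Lifts (affine d c)) :
    (A.transport (permAff π)).Lifts (affine (d ∘ π) (c ∘ π)) := by
  rw [transport_lifts]
  convert h using 1
  funext z i
  simp [permAff_symm_apply, permAff_apply, affine]

theorem Lifts.mul_mem {d c l : V} (h : A.Lifts (affine d c)) (hl : l ∈ A.Λ) : d * l ∈ A.Λ := by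
  obtain ⟨σ, hσ, h⟩ := h
  have h1 : A.torusProj l = A.torusProj 0 := A.torusProj_eq_iff.2 (by simpa)
  have h2 := congrArg σ h1
  rw [h, h, torusProj_eq_iff] at h2
  simpa [affine] using h2

theorem Lifts.affine_comp {d c d' c' : V} (h : A.Lifts (affine d c)) (h' : A.Lifts (affine d' c')) :
    A.Lifts (affine (d * d') (d * c' + c)) := by
  convert h.comp h' using 1
  funext z
  simp only [affine, Function.comp_apply]
  ring

theorem Lifts.affine_congr {d c c' : V} (h : A.Lifts (affine d c)) (hc : c' - c ∈ A.Λ) :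
    A.Lifts (affine d c') := by
  refine h.congr fun z => ?_
  simpa [affine] using hc

end TorusGroup

namespace IsAffineQuotient

variable {A : TorusGroup} (hA : IsAffineQuotient A)
include hA

theorem affine_comm {d c d' c' : V} (h : A.Lifts (affine d c)) (h' : A.Lifts (affine d' c')) :
    d * c' + c - (d' * c + c') ∈ A.Λ := by
  obtain ⟨σ, hσ, h⟩ := h
  obtain ⟨τ, hτ, h'⟩ := h'
  obtain ⟨ε⟩ := hA.group_iso
  have hcomm : σ * τ = τ * σ := by
    have : (⟨σ, hσ⟩ : A.G) * ⟨τ, hτ⟩ = ⟨τ, hτ⟩ * ⟨σ, hσ⟩ :=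
      ε.injective (by rw [map_mul, map_mul, mul_comm])
    exact congrArg Subtype.val this
  have h1 : σ (τ (A.torusProj 0)) = τ (σ (A.torusProj 0)) :=
    congrArg (fun ρ : Equiv.Perm A.Torus => ρ (A.torusProj 0)) hcomm
  rw [h, h', h, h', TorusGroup.torusProj_eq_iff] at h1
  simpa [affine] using h1

theorem affine_unique {d c c' : V} (h : A.Lifts (affine d c)) (h' : A.Lifts (affine d c')) :
    c - c' ∈ A.Λ := by
  obtain ⟨σ, hσ, h⟩ := h
  obtain ⟨τ, hτ, h'⟩ := h'
  have h1 : σ * τ⁻¹ = 1 := by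
    refine hA.translation_free _ (mul_mem hσ (inv_mem hτ)) ⟨A.torusProj (c - c'), fun x => ?_⟩
    obtain ⟨y, rfl⟩ := τ.surjective x
    obtain ⟨z, rfl⟩ := A.torusProj_surjective y
    rw [Equiv.Perm.mul_apply, show τ⁻¹ (τ _) = _ from τ.symm_apply_apply _, h, h', ← TorusGroup.torusProj_add]
    congr 1
    simp [affine]
  have h2 : σ = τ := mul_inv_eq_one.1 h1
  have h3 := h 0
  rw [h2, h', TorusGroup.torusProj_eq_iff] at h3
  have := A.Λ.neg_mem h3
  simpa [affine] using this

/-- Freeness of the elements with eigenvalue one, in terms of the translation part. -/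
theorem not_exists_mem {d c : V} (h : A.Lifts (affine d c)) (hd : d ≠ 1) {i : Fin 3}
    (hi : d i = 1) {l : V} (hl : l ∈ A.Λ) (hlc : ∀ j, d j = 1 → l j = c j) : False := by
  -- The candidate fixed point solves `(d j - 1) * z j = l j - c j` where `d j ≠ 1`; the other
  -- coordinates impose `l j = c j`.
  refine hA.sub_notMem_of_diagonal h hd hi (fun j => (d j - 1)⁻¹ * (l j - c j)) ?_
  convert hl using 1
  funext j
  by_cases hj : d j = 1
  · simp [affine, hj, hlc j hj]
  · have : d j - 1 ≠ 0 := sub_ne_zero.2 hj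
    simp only [affine, Pi.add_apply, Pi.mul_apply, Pi.sub_apply]
    field_simp
    ring

end IsAffineQuotient

/-! ### Normalisation of the lattice -/

/-- A discrete subgroup of `ℂ` which is stable under `ζ` is a multiple of the Eisenstein integers. -/
theorem exists_mem_iff_eis {L : Submodule ℤ ℂ} (hfin : ∀ R : ℝ, {x : ℂ | x ∈ L ∧ ‖x‖ ≤ R}.Finite)
    (hζ : ∀ x ∈ L, ζ * x ∈ L) (hne : ∃ x ∈ L, x ≠ 0) :
    ∃ τ : ℂ, τ ≠ 0 ∧ ∀ x, τ * x ∈ L ↔ x ∈ eis := by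
  obtain ⟨x₀, hx₀, hx₀0⟩ := hne
  have hf : {x : ℂ | (x ∈ L ∧ ‖x‖ ≤ ‖x₀‖) ∧ x ≠ 0}.Finite := (hfin ‖x₀‖).subset fun x hx => hx.1
  obtain ⟨τ, ⟨⟨hτ, hτx⟩, hτ0⟩, hmin⟩ := Set.exists_min_image _ (fun x => ‖x‖) hf
    ⟨x₀, ⟨hx₀, le_rfl⟩, hx₀0⟩
  have heis : ∀ x ∈ eis, τ * x ∈ L := by
    intro x hx
    obtain ⟨a, b, rfl⟩ := mem_eis.1 hx
    have h1 := L.add_mem (L.smul_mem a hτ) (L.smul_mem b (hζ τ hτ))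
    convert h1 using 1
    simp only [zsmul_eq_mul]
    ring
  refine ⟨τ, hτ0, fun x => ⟨fun hx => ?_, heis x⟩⟩
  obtain ⟨a, b, rfl⟩ := exists_add_mul_ζ x
  set q : ℂ := (round a : ℤ) + (round b : ℤ) * ζ with hq
  set u : ℝ := a - round a with hu
  set v : ℝ := b - round b with hv
  have hr : (a + b * ζ : ℂ) - q = u + v * ζ := by rw [hq, hu, hv]; push_cast; ring
  have hrL : τ * (u + v * ζ) ∈ L := by
    rw [← hr, mul_sub]
    exact L.sub_mem hx (heis _ (mem_eis_int _ _))
  have hu2 : |u| ≤ 1 / 2 := abs_sub_round a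
  have hv2 : |v| ≤ 1 / 2 := abs_sub_round b
  -- Euclidean division: after rounding, `u ^ 2 - u * v + v ^ 2 ≤ 3 / 4`, so a nonzero remainder
  -- would be shorter than the shortest vector `τ`.
  have hn : ‖(u + v * ζ : ℂ)‖ < 1 := by
    have h1 : ‖(u + v * ζ : ℂ)‖ ^ 2 < 1 := by
      rw [← Complex.normSq_eq_norm_sq, normSq_add_mul_ζ]
      rw [abs_le] at hu2 hv2
      nlinarith
    nlinarith [norm_nonneg (u + v * ζ : ℂ)]
  by_cases h0 : (u + v * ζ : ℂ) = 0
  · rw [h0, sub_eq_zero] at hr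
    rw [hr]
    exact mem_eis_int _ _
  · exfalso
    have hlt : ‖τ * (u + v * ζ)‖ < ‖τ‖ := by
      rw [norm_mul]
      exact mul_lt_of_lt_one_right (norm_pos_iff.2 hτ0) hn
    exact absurd (hmin _ ⟨⟨hrL, hlt.le.trans hτx⟩, mul_ne_zero hτ0 h0⟩) (not_le.2 hlt)

/-- A quotient by a group of affine maps whose linear parts are diagonal, whose lattice meets the
coordinate axes in the Eisenstein integers, and which contains multiplication by `ζ`. -/
structure IsNormal (A : TorusGroup) : Prop where
  isAffineQuotient : IsAffineQuotient A
  exists_lift : ∀ e : Fin 3 → ZMod 3, ∃ c : V, A.Lifts (affine (dz e) c)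
  single_mem : ∀ i x, Pi.single i x ∈ A.Λ ↔ x ∈ eis
  scalar : A.Lifts (affine (dz 1) 0)

theorem dz_single (i j : Fin 3) : dz (Pi.single i 1) j = if j = i then ζ else 1 := by
  unfold dz
  split_ifs with h
  · subst h
    rw [Pi.single_eq_same, ZMod.val_one, pow_one]
  · rw [Pi.single_eq_of_ne h, ZMod.val_zero, pow_zero]

theorem dz_one : dz 1 = fun _ => ζ := by
  funext i
  change ζ ^ (1 : ZMod 3).val = ζ
  rw [ZMod.val_one, pow_one]

/-- The reflections `dz (single i 1)` map the lattice to the coordinate axes. -/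
theorem single_mem_of_stable {A : TorusGroup}
    (h : ∀ e : Fin 3 → ZMod 3, ∃ c : V, A.Lifts (affine (dz e) c)) {l : V} (hl : l ∈ A.Λ)
    (i : Fin 3) : Pi.single i ((1 - ζ) * l i) ∈ A.Λ := by
  obtain ⟨c, hc⟩ := h (Pi.single i 1)
  convert A.Λ.sub_mem hl (hc.mul_mem hl) using 1
  funext j
  rw [Pi.sub_apply, Pi.mul_apply, dz_single]
  by_cases hj : j = i
  · subst hj; simp; ring
  · simp [hj]

theorem IsAffineQuotient.exists_isNormal {A : TorusGroup} (hA : IsAffineQuotient A) :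
    ∃ B, Biholomorphic A B ∧ IsNormal B := by
  obtain ⟨Φ, hΦ⟩ := hA.exists_diagonal
  have hB := hA.transport Φ
  have hAB := biholomorphic_transport A Φ
  generalize A.transport Φ = B at hΦ hB hAB
  have hd := hB.discrete
  have hone : (1 - ζ : ℂ) ≠ 0 := sub_ne_zero.2 ζ_ne_one.symm
  have hτ : ∀ i : Fin 3, ∃ τ : ℂ, τ ≠ 0 ∧ ∀ x, Pi.single i (τ * x) ∈ B.Λ ↔ x ∈ eis := by
    intro i
    refine exists_mem_iff_eis (L := B.Λ.comap (LinearMap.single ℤ (fun _ : Fin 3 => ℂ) i))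
      (fun R => ?_) (fun x hx => ?_) ?_
    · have hfin : ((B.Λ : Set V) ∩ Metric.closedBall 0 R).Finite := by
        have hc : IsClosed (B.Λ : Set V) :=
          AddSubgroup.isClosed_of_discrete (H := B.Λ.toAddSubgroup)
        rw [Set.inter_comm]
        exact Metric.finite_isBounded_inter_isClosed ⟨hd⟩ Metric.isBounded_closedBall hc
      refine Set.Finite.subset (hfin.preimage (f := fun x : ℂ => (Pi.single i x : V))
        (fun x _ y _ h => Pi.single_injective (M := fun _ => ℂ) i h)) ?_
      rintro x ⟨hx, hxR⟩
      exact ⟨hx, by simpa [Pi.norm_single] using hxR⟩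
    · obtain ⟨c, hc⟩ := hΦ 1
      have := hc.mul_mem (l := Pi.single i x) hx
      rw [dz_one] at this
      change Pi.single i (ζ * x) ∈ B.Λ
      convert this using 1
      funext j
      by_cases hj : j = i
      · subst hj; simp
      · simp [hj]
    -- If the lattice met this axis only in zero, the reflections would force the `i`-th coordinate
    -- of every lattice vector to vanish, and the lattice would not span.
    · by_contra! hcon
      have hzero : ∀ l ∈ B.Λ, l i = 0 := fun l hl => by
        have := hcon _ (single_mem_of_stable hΦ hl i)
        exact (mul_eq_zero.1 this).resolve_left hone
      have htop : Submodule.span ℝ (B.Λ : Set V) ≤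
          LinearMap.ker (LinearMap.proj i : (Fin 3 → ℂ) →ₗ[ℝ] ℂ) :=
        Submodule.span_le.2 fun l hl => hzero l hl
      rw [hB.span_top] at htop
      have := htop (Submodule.mem_top (x := Pi.single i (1 : ℂ)))
      simp at this
  choose τ hτ0 hτ using hτ
  obtain ⟨c, hc⟩ := hΦ 1
  have hm : ∀ i, (τ⁻¹ : V) i ≠ 0 := fun i => inv_ne_zero (hτ0 i)
  -- The shift solves `τ⁻¹ * c + s - ζ * s = 0`: it moves the fixed point of the scalar element to
  -- the origin.
  let s : V := fun i => (ζ - 1)⁻¹ * ((τ i)⁻¹ * c i)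
  refine ⟨B.transport (diagAff τ⁻¹ s hm), hAB.trans (biholomorphic_transport _ _),
    hB.transport _, fun e => ?_, fun i x => ?_, ?_⟩
  · obtain ⟨c, hc⟩ := hΦ e
    exact ⟨_, hc.transport_diagAff hm⟩
  · rw [TorusGroup.mem_transport_diagAff, inv_inv, ← hτ i]
    have : τ * Pi.single i x = Pi.single i (τ i * x) := by
      funext j
      by_cases hj : j = i
      · subst hj; simp
      · simp [hj]
    rw [this]
  · have := hc.transport_diagAff hm (s := s)
    convert this using 2
    funext i
    have : ζ - 1 ≠ 0 := sub_ne_zero.2 ζ_ne_one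
    simp only [s, dz_one, Pi.zero_apply, Pi.add_apply, Pi.sub_apply, Pi.mul_apply, Pi.inv_apply]
    field_simp
    ring

end TorusQuotient
end

/-! ### The 3-torsion of the Fermat curve over `ℤ/3` -/

noncomputable section

namespace TorusQuotient

open Topology

theorem add_mul_ζ_div_three_mem_eis {a b : ℤ} :
    ((a : ℂ) / 3 + (b : ℂ) / 3 * ζ) ∈ eis ↔ 3 ∣ a ∧ 3 ∣ b := by
  rw [mem_eis]
  constructor
  · rintro ⟨c, d, h⟩
    have := add_mul_ζ_inj (a := a / 3) (b := b / 3) (c := c) (d := d) (by push_cast; exact h)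
    refine ⟨⟨c, ?_⟩, ⟨d, ?_⟩⟩
    · have h1 := this.1
      field_simp at h1
      exact_mod_cast h1
    · have h1 := this.2
      field_simp at h1
      exact_mod_cast h1
  · rintro ⟨⟨c, rfl⟩, ⟨d, rfl⟩⟩
    exact ⟨c, d, by push_cast; ring⟩

/-- The right side is an Eisenstein unit, so `t` generates the kernel of `1 - ζ` on the Fermat
curve. -/
theorem one_sub_ζ_mul_t : (1 - ζ) * t = -ζ ^ 2 := by
  rw [t]; linear_combination (1 / 3 : ℂ) * ζ_sq

/-- The vector of the torsion points `n i / 3 + m i * t` of the Fermat curve. -/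
def tors (n m : Fin 3 → ZMod 3) : V := fun i => (n i).val / 3 + (m i).val * t

theorem zmod_cases {P : ZMod 3 → Prop} (x : ZMod 3) (h0 : P 0) (h1 : P 1) (h2 : P 2) : P x := by
  fin_cases x <;> assumption

theorem val_two : (2 : ZMod 3).val = 2 := rfl

theorem intCast_sub_val (n : ℤ) : ∃ k : ℤ, (n : ℂ) = ((n : ZMod 3).val : ℂ) + 3 * k := by
  refine ⟨n / 3, ?_⟩
  have h : ((n : ZMod 3).val : ℤ) = n % 3 := ZMod.val_intCast n
  have h2 := Int.emod_add_mul_ediv n 3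
  rw [← h] at h2
  exact_mod_cast h2.symm

theorem tors_intCast_sub_mem (n m : Fin 3 → ℤ) :
    (fun i => (n i : ℂ) / 3 + m i * t) - tors (fun i => n i) (fun i => m i) ∈ Λ₁ := by
  rw [mem_Λ₁]
  intro i
  obtain ⟨k, hk⟩ := intCast_sub_val (n i)
  obtain ⟨l, hl⟩ := intCast_sub_val (m i)
  simp only [Pi.sub_apply, tors]
  rw [hk, hl]
  refine mem_eis.2 ⟨k + l, 2 * l, ?_⟩
  push_cast [t]
  ring

theorem exists_intCast (n : Fin 3 → ZMod 3) : ∃ k : Fin 3 → ℤ, n = fun i => (k i : ZMod 3) :=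
  ⟨fun i => (n i).val, funext fun i => by simp⟩

theorem tors_apply_mem_eis {n m : Fin 3 → ZMod 3} {i : Fin 3} :
    tors n m i ∈ eis ↔ n i = 0 ∧ m i = 0 := by
  have h : tors n m i = (((n i).val + (m i).val : ℤ) : ℂ) / 3 + ((2 * (m i).val : ℤ) : ℂ) / 3 * ζ := by
    simp only [tors, t]; push_cast; ring
  rw [h, add_mul_ζ_div_three_mem_eis]
  generalize n i = x
  generalize m i = y
  revert x y
  decide

theorem tors_mem_Λ₁ {n m : Fin 3 → ZMod 3} : tors n m ∈ Λ₁ ↔ n = 0 ∧ m = 0 := by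
  rw [mem_Λ₁]
  simp only [tors_apply_mem_eis, forall_and, funext_iff, Pi.zero_apply]

theorem tors_add_sub_mem (n m n' m' : Fin 3 → ZMod 3) :
    tors n m + tors n' m' - tors (n + n') (m + m') ∈ Λ₁ := by
  obtain ⟨a, rfl⟩ := exists_intCast n
  obtain ⟨b, rfl⟩ := exists_intCast m
  obtain ⟨c, rfl⟩ := exists_intCast n'
  obtain ⟨d, rfl⟩ := exists_intCast m'
  have h1 := tors_intCast_sub_mem a b
  have h2 := tors_intCast_sub_mem c d
  have h3 := tors_intCast_sub_mem (a + c) (b + d)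
  have e : ∀ x y : Fin 3 → ℤ, (fun i => ((x + y) i : ZMod 3)) = (fun i => (x i : ZMod 3)) + fun i => (y i : ZMod 3) := by
    intro x y; funext i; simp
  rw [e, e] at h3
  convert Λ₁.sub_mem h3 (Λ₁.add_mem h1 h2) using 1
  funext i
  simp only [Pi.add_apply, Pi.sub_apply]
  push_cast
  ring

theorem dz_mul_mem_Λ₁ (e : Fin 3 → ZMod 3) {v : V} (hv : v ∈ Λ₁) : dz e * v ∈ Λ₁ := by
  rw [mem_Λ₁] at hv ⊢
  intro i
  refine mul_mem_eis ?_ (hv i)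
  rw [dz]
  generalize (e i).val = k
  induction k with
  | zero => simpa using one_mem_eis
  | succ k ih => rw [pow_succ]; exact mul_mem_eis ih ζ_mem_eis

/-- On the 3-torsion of the curve, with basis `1/3`, `t`, multiplication by `ζ` is unipotent: it
sends `1/3` to `1/3 - t` and fixes `t`. -/
theorem dz_mul_tors_sub_mem (e n m : Fin 3 → ZMod 3) :
    dz e * tors n m - tors n (m - e * n) ∈ Λ₁ := by
  obtain ⟨a, rfl⟩ := exists_intCast n
  obtain ⟨b, rfl⟩ := exists_intCast m
  have h1 := dz_mul_mem_Λ₁ e (tors_intCast_sub_mem a b)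
  have h2 := tors_intCast_sub_mem a (b - (fun i => ((e i).val : ℤ)) * a)
  have h3 : (fun i => (((b - (fun i => ((e i).val : ℤ)) * a) i : ℤ) : ZMod 3)) =
      (fun i => (b i : ZMod 3)) - e * fun i => (a i : ZMod 3) := by
    funext i; simp
  rw [h3] at h2
  have h4 : dz e * (fun i => (a i : ℂ) / 3 + b i * t) -
      (fun i => (a i : ℂ) / 3 + ((b - (fun i => ((e i).val : ℤ)) * a) i : ℤ) * t) ∈ Λ₁ := by
    rw [mem_Λ₁]
    intro i
    simp only [Pi.sub_apply, Pi.mul_apply, dz]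
    generalize e i = x
    refine mem_eis.2 ?_
    induction x using zmod_cases with
    | h0 => exact ⟨0, 0, by simp⟩
    | h1 =>
      refine ⟨-(b i), a i - b i, ?_⟩
      rw [ZMod.val_one]; push_cast [t]; linear_combination (2 * (b i : ℂ) / 3) * ζ_sq
    | h2 =>
      refine ⟨0, a i - b i, ?_⟩
      rw [val_two]; push_cast [t]; linear_combination ((a i + b i) / 3 + 2 * ζ * (b i : ℂ) / 3 - 2 * b i / 3) * ζ_sq
  convert Λ₁.add_mem (Λ₁.sub_mem h4 h1) h2 using 1
  ring

end TorusQuotient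

end

/-! ### Normal quotients as data over `ℤ/3` -/

noncomputable section

namespace TorusQuotient

open Topology

section Lattice

variable {Λ : Submodule ℤ V} (h₁ : Λ₁ ≤ Λ)
include h₁

theorem tors_add_mem_iff (n m n' m' : Fin 3 → ZMod 3) :
    tors n m + tors n' m' ∈ Λ ↔ tors (n + n') (m + m') ∈ Λ :=
  Submodule.sub_mem_iff_left _ (h₁ (tors_add_sub_mem n m n' m')) |>.symm.trans (by simp)

theorem tors_zero_add_mem {m m' : Fin 3 → ZMod 3} (h : tors 0 m ∈ Λ) (h' : tors 0 m' ∈ Λ) :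
    tors 0 (m + m') ∈ Λ := by
  simpa using (tors_add_mem_iff h₁ 0 m 0 m').1 (Λ.add_mem h h')

theorem tors_sub_mem_iff (n m n' m' : Fin 3 → ZMod 3) :
    tors n m - tors n' m' ∈ Λ ↔ tors (n - n') (m - m') ∈ Λ := by
  have h := h₁ (tors_add_sub_mem (n - n') (m - m') n' m')
  simp only [sub_add_cancel] at h
  rw [← Submodule.add_mem_iff_right Λ h]
  constructor <;> intro h' <;> convert h' using 1 <;> ring

theorem tors_zero_neg_mem {m : Fin 3 → ZMod 3} (h : tors 0 m ∈ Λ) : tors 0 (-m) ∈ Λ := by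
  have h0 : tors 0 0 ∈ Λ := h₁ (tors_mem_Λ₁.2 ⟨rfl, rfl⟩)
  simpa using (tors_sub_mem_iff h₁ 0 0 0 m).1 (Λ.sub_mem h0 h)

end Lattice

/-- If `(1 - ζ) Λ` lies in the lattice of the cube of the Fermat curve, then so does every element of
`Λ` up to multiples of `t`. -/
theorem exists_tors_of_mem {l : V} (hl : ∀ i, (1 - ζ) * l i ∈ eis) :
    ∃ m, l - tors 0 m ∈ Λ₁ := by
  have h : ∀ i, ∃ m : ℤ, l i - m * t ∈ eis := by
    intro i
    obtain ⟨a, b, h⟩ := mem_eis.1 (hl i)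
    have h2 : l i = (2 * a - b) / 3 + (a + b) / 3 * ζ := by
      have h0 : (1 - ζ : ℂ) ≠ 0 := sub_ne_zero.2 ζ_ne_one.symm
      apply mul_left_cancel₀ h0
      rw [h]
      linear_combination ((a + b) / 3 : ℂ) * ζ_sq
    refine ⟨-(a + b), mem_eis.2 ⟨a, a + b, ?_⟩⟩
    rw [h2, t]; push_cast; ring
  choose m hm using h
  refine ⟨fun i => m i, ?_⟩
  have h1 := tors_intCast_sub_mem 0 m
  have h2 : (fun i => l i - m i * t) ∈ Λ₁ := mem_Λ₁.2 hm
  have : (fun i => (((0 : Fin 3 → ℤ) i : ℤ) : ZMod 3)) = 0 := by funext; simp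
  rw [this] at h1
  convert Λ₁.add_mem h1 h2 using 1
  funext i
  simp only [Pi.add_apply, Pi.sub_apply, Pi.zero_apply, Int.cast_zero, zero_div, zero_add]
  ring

theorem one_sub_ζ_mul_tors (n m : Fin 3 → ZMod 3) :
    (fun _ => 1 - ζ) * tors n m - tors 0 n ∈ Λ₁ := by
  have h := dz_mul_tors_sub_mem 1 n m
  have h' := tors_sub_mem_iff le_rfl n m n (m - n) (Λ := Λ₁)
  rw [one_mul, dz_one] at h
  have h2 := tors_add_sub_mem n (m - n) 0 n
  rw [add_zero, sub_add_cancel] at h2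
  convert Λ₁.sub_mem (Λ₁.neg_mem h) h2 using 1
  funext i; simp only [Pi.sub_apply, Pi.mul_apply, Pi.add_apply, Pi.neg_apply]; ring

/-- Multiplication by `1 - ζ` takes `tors κ 0` to `tors 0 κ`, so `c - tors κ 0` is killed by it and
consists of multiples of `t`. -/
theorem exists_tors_of_smul_mem {c : V} {κ : Fin 3 → ZMod 3}
    (h : (fun _ => 1 - ζ) * c - tors 0 κ ∈ Λ₁) : ∃ m, c - tors κ m ∈ Λ₁ := by
  obtain ⟨m, hm⟩ := exists_tors_of_mem (l := c - tors κ 0) (by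
    have h2 := Λ₁.sub_mem h (one_sub_ζ_mul_tors κ 0)
    rw [mem_Λ₁] at h2
    intro i
    convert h2 i using 1
    simp only [Pi.sub_apply, Pi.mul_apply]; ring)
  refine ⟨m, ?_⟩
  have h2 := tors_add_sub_mem κ 0 0 m
  rw [add_zero, zero_add] at h2
  convert Λ₁.add_mem hm h2 using 1
  ring

namespace TorusGroup

variable {A : TorusGroup}

/-- The map with linear part `dz e` and translation part `tors n m` induces an element of `G`. -/
def LiftsTors (A : TorusGroup) (e n m : Fin 3 → ZMod 3) : Prop := A.Lifts (affine (dz e) (tors n m))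

end TorusGroup

namespace IsNormal

open TorusGroup

variable {A : TorusGroup} (hA : IsNormal A)
include hA

theorem le : Λ₁ ≤ A.Λ := by
  intro l hl
  rw [mem_Λ₁] at hl
  rw [← Finset.univ_sum_single l]
  exact A.Λ.sum_mem fun i _ => (hA.single_mem i _).2 (hl i)

theorem one_sub_ζ_mul_mem {l : V} (hl : l ∈ A.Λ) (i : Fin 3) : (1 - ζ) * l i ∈ eis :=
  (hA.single_mem i _).1 (single_mem_of_stable hA.exists_lift hl i)

theorem exists_tors {l : V} (hl : l ∈ A.Λ) : ∃ m, tors 0 m ∈ A.Λ ∧ l - tors 0 m ∈ Λ₁ := by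
  obtain ⟨m, hm⟩ := exists_tors_of_mem (hA.one_sub_ζ_mul_mem hl)
  exact ⟨m, by simpa using A.Λ.sub_mem hl (hA.le hm), hm⟩

/-- Since `(1 - ζ) Λ` lies in `Λ₁`, a lattice point has no component along `1/3`. -/
theorem tors_mem {n m : Fin 3 → ZMod 3} : tors n m ∈ A.Λ ↔ n = 0 ∧ tors 0 m ∈ A.Λ := by
  constructor
  · intro h
    have h2 : n = 0 := by
      have h1 := mem_Λ₁.2 (hA.one_sub_ζ_mul_mem h)
      have h3 := Λ₁.sub_mem h1 (one_sub_ζ_mul_tors n m)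
      have h4 : tors 0 n ∈ Λ₁ := by
        convert h3 using 1
        funext i; simp
      exact (tors_mem_Λ₁.1 h4).2
    subst h2
    exact ⟨rfl, h⟩
  · rintro ⟨rfl, h⟩
    exact h

/-- The normalisation of the axes says that the code contains no vector of weight one. -/
theorem eq_zero_of_single_mem {i : Fin 3} {x : ZMod 3} (h : tors 0 (Pi.single i x) ∈ A.Λ) : x = 0 := by
  have h1 : tors 0 (Pi.single i x) = Pi.single i (x.val * t) := by
    funext j
    simp only [tors, Pi.zero_apply, ZMod.val_zero, Nat.cast_zero, zero_div, zero_add]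
    by_cases hj : j = i
    · subst hj; simp
    · simp [hj]
  have h2 : tors 0 (Pi.single i x) ∈ Λ₁ := by
    rw [h1, hA.single_mem] at h
    rw [h1, mem_Λ₁]
    intro j
    by_cases hj : j = i
    · subst hj; simpa using h
    · simp [hj]
  simpa using (tors_mem_Λ₁.1 h2).2

/-- Commuting with the scalar `ζ` means `(1 - ζ) c ∈ Λ`. Hence `c` is a 3-torsion point whose
`1/3`-components form a vector of the code. -/
theorem exists_liftsTors (e : Fin 3 → ZMod 3) :
    ∃ n m, tors 0 n ∈ A.Λ ∧ A.LiftsTors e n m := by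
  obtain ⟨c, hc⟩ := hA.exists_lift e
  have h := hA.isAffineQuotient.affine_comm hc hA.scalar
  have h2 : (fun _ => 1 - ζ) * c ∈ A.Λ := by
    convert h using 1
    rw [dz_one]; funext i; simp; ring
  obtain ⟨κ, hκ, hκ2⟩ := hA.exists_tors h2
  obtain ⟨m, hm⟩ := exists_tors_of_smul_mem hκ2
  refine ⟨κ, m, hκ, hc.affine_congr ?_⟩
  have := A.Λ.neg_mem (hA.le hm)
  simpa using this

theorem liftsTors_one : A.LiftsTors 1 0 0 := by
  have h : tors 0 0 = 0 := by funext i; simp [tors]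
  rw [LiftsTors, h]
  exact hA.scalar

theorem liftsTors_unique {e n m n' m' : Fin 3 → ZMod 3} (h : A.LiftsTors e n m)
    (h' : A.LiftsTors e n' m') : n = n' ∧ tors 0 (m - m') ∈ A.Λ := by
  have h1 := hA.isAffineQuotient.affine_unique h h'
  rw [tors_sub_mem_iff hA.le, hA.tors_mem, sub_eq_zero] at h1
  exact h1

omit hA in
-- The twist `- e * n'` is the unipotent action of `dz e` on the inner translation part.
theorem _root_.TorusQuotient.TorusGroup.LiftsTors.add (h₁ : Λ₁ ≤ A.Λ) {e n m e' n' m' : Fin 3 → ZMod 3}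
    (h : A.LiftsTors e n m) (h' : A.LiftsTors e' n' m') :
    A.LiftsTors (e + e') (n + n') (m + m' - e * n') := by
  have h2 := Lifts.affine_comp h h'
  rw [← dz_add] at h2
  refine h2.affine_congr ?_
  have h3 := h₁ (dz_mul_tors_sub_mem e n' m')
  have h4 := h₁ (tors_add_sub_mem n m n' (m' - e * n'))
  rw [← add_sub_assoc] at h4
  convert A.Λ.neg_mem (A.Λ.add_mem h3 h4) using 1
  ring

omit hA in
theorem _root_.TorusQuotient.TorusGroup.LiftsTors.congr (h₁ : Λ₁ ≤ A.Λ) {e n m m' : Fin 3 → ZMod 3}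
    (h : A.LiftsTors e n m) (h' : tors 0 (m' - m) ∈ A.Λ) : A.LiftsTors e n m' := by
  refine Lifts.affine_congr h ?_
  rw [tors_sub_mem_iff h₁, sub_self]
  exact h'

/-- The conditions on `n`, `m` and `κ` say that the translation part agrees with a lattice vector in
all coordinates with eigenvalue one, which would produce a fixed point. -/
theorem liftsTors_free {e n m : Fin 3 → ZMod 3} (h : A.LiftsTors e n m) (he : e ≠ 0) {i : Fin 3}
    (hi : e i = 0) {κ : Fin 3 → ZMod 3} (hκ : tors 0 κ ∈ A.Λ)
    (hn : ∀ j, e j = 0 → n j = 0 ∧ κ j = m j) : False := by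
  refine hA.isAffineQuotient.not_exists_mem h ?_ (i := i) ?_ hκ ?_
  · intro h0
    apply he
    apply dz_injective
    rw [h0]; funext j; simp [dz]
  · simp [dz, hi]
  · intro j hj
    have : e j = 0 := by
      apply ζ_pow_val_injective
      simpa [dz] using hj
    simp [tors, hn j this]

/-- The two orders of composition have the same exponent, so uniqueness compares their twists. -/
theorem liftsTors_comm {e n m e' n' m' : Fin 3 → ZMod 3} (h : A.LiftsTors e n m)
    (h' : A.LiftsTors e' n' m') : tors 0 (e' * n - e * n') ∈ A.Λ := by
  have h1 := h.add hA.le h'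
  have h2 := h'.add hA.le h
  rw [add_comm e'] at h2
  have := (hA.liftsTors_unique h1 h2).2
  convert this using 2
  ring

end IsNormal

end TorusQuotient

end

/-! ### Coordinate changes preserving normality -/

noncomputable section

namespace TorusQuotient

open Topology

theorem Biholomorphic.refl (A : TorusGroup) : Biholomorphic A A := ⟨Homeomorph.refl _, fun _ _ _ => Iff.rfl⟩

/-- The sign `1` or `-1` of a unit of `ℤ/3`. -/
def sign (δ : Fin 3 → ZMod 3) : V := fun i => if δ i = 1 then 1 else -1

theorem sign_ne_zero (δ : Fin 3 → ZMod 3) (i : Fin 3) : sign δ i ≠ 0 := by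
  unfold sign; split_ifs <;> simp

theorem sign_inv (δ : Fin 3 → ZMod 3) : (sign δ)⁻¹ = sign δ := by
  funext i; simp only [Pi.inv_apply, sign]; split_ifs <;> norm_num

theorem sign_mul_mem {δ : Fin 3 → ZMod 3} {i : Fin 3} {x : ℂ} : sign δ i * x ∈ eis ↔ x ∈ eis := by
  unfold sign; split_ifs <;> simp

theorem sign_mul_tors_sub_mem {δ : Fin 3 → ZMod 3} (hδ : ∀ i, δ i ≠ 0) (n m : Fin 3 → ZMod 3) :
    sign δ * tors n m - tors (δ * n) (δ * m) ∈ Λ₁ := by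
  have h := mem_Λ₁.1 (tors_add_sub_mem n m (-n) (-m))
  rw [mem_Λ₁]
  intro i
  have h0 : δ i = 1 ∨ δ i = -1 := by
    have := hδ i; revert this; generalize δ i = x; revert x; decide
  rcases h0 with h0 | h0
  · simp [sign, h0, tors]
  · convert neg_mem (h i) using 1
    have h3 : ((-1 : ZMod 3) = 1) ↔ False := by decide
    simp [sign, h0, tors, h3]
    ring

namespace IsNormal

open TorusGroup

variable {A : TorusGroup} (hA : IsNormal A)
include hA

theorem transport_permAff (π : Equiv.Perm (Fin 3)) : IsNormal (A.transport (permAff π)) where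
  isAffineQuotient := hA.isAffineQuotient.transport _
  exists_lift e := by
    obtain ⟨c, hc⟩ := hA.exists_lift (e ∘ π.symm)
    refine ⟨c ∘ π, ?_⟩
    convert hc.transport_permAff π using 2
    funext i; simp [dz]
  single_mem i x := by
    rw [mem_transport_permAff, ← hA.single_mem (π i)]
    convert Iff.rfl using 2
    funext j
    rw [Function.comp_apply]
    by_cases h : j = π i
    · subst h; simp
    · have h' : π.symm j ≠ i := fun h' => h (by simp [← h'])
      simp [h, h']
  scalar := hA.scalar.transport_permAff π

omit hA in
theorem _root_.TorusQuotient.TorusGroup.LiftsTors.transport_permAff (π : Equiv.Perm (Fin 3))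
    {e n m : Fin 3 → ZMod 3} (h : A.LiftsTors e n m) :
    (A.transport (permAff π)).LiftsTors (e ∘ π) (n ∘ π) (m ∘ π) :=
  Lifts.transport_permAff π h

omit hA in
theorem tors_mem_transport_permAff (π : Equiv.Perm (Fin 3)) {m : Fin 3 → ZMod 3} :
    tors 0 m ∈ (A.transport (permAff π)).Λ ↔ tors 0 (m ∘ π.symm) ∈ A.Λ :=
  mem_transport_permAff

/-- Changes of sign of the coordinates commute with all linear parts and preserve `ℤ[ζ]` on each
axis. -/
theorem exists_sign {δ : Fin 3 → ZMod 3} (hδ : ∀ i, δ i ≠ 0) :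
    ∃ B, Biholomorphic A B ∧ IsNormal B ∧
      (∀ e n m, A.LiftsTors e n m → B.LiftsTors e (δ * n) (δ * m)) ∧
      ∀ m, tors 0 m ∈ B.Λ ↔ tors 0 (δ * m) ∈ A.Λ := by
  have hl : ∀ {d c}, A.Lifts (affine d c) →
      (A.transport (diagAff (sign δ) 0 (sign_ne_zero δ))).Lifts (affine d (sign δ * c)) := by
    intro d c hc
    simpa using hc.transport_diagAff (s := 0) (sign_ne_zero δ)
  have hle : Λ₁ ≤ (A.transport (diagAff (sign δ) 0 (sign_ne_zero δ))).Λ := by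
    intro v hv
    rw [mem_transport_diagAff, sign_inv]
    rw [mem_Λ₁] at hv
    exact hA.le (mem_Λ₁.2 fun i => sign_mul_mem.2 (hv i))
  refine ⟨A.transport (diagAff (sign δ) 0 (sign_ne_zero δ)), biholomorphic_transport A _, ?_, ?_, ?_⟩
  · refine ⟨hA.isAffineQuotient.transport _, fun e => ?_, fun i x => ?_, ?_⟩
    · obtain ⟨c, hc⟩ := hA.exists_lift e
      exact ⟨_, hl hc⟩
    · rw [mem_transport_diagAff, sign_inv, ← sign_mul_mem (δ := δ) (i := i), ← hA.single_mem i]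
      convert Iff.rfl using 2
      funext j
      by_cases h : j = i
      · subst h; simp
      · simp [h]
    · simpa using hl hA.scalar
  · intro e n m h
    refine (hl h).affine_congr ?_
    simpa using Submodule.neg_mem _ (hle (sign_mul_tors_sub_mem hδ n m))
  · intro m
    rw [mem_transport_diagAff, sign_inv]
    have := hA.le (sign_mul_tors_sub_mem hδ 0 m)
    rw [mul_zero] at this
    exact (Submodule.sub_mem_iff_left _ this).symm.trans (by simp)

/-- Conjugation by the translation `tors κ 0` adds `(1 - dz e) * tors κ 0`, that is, `tors 0 (e *
κ)`. For `e = 1` this is `tors 0 κ`; it must lie in the lattice for the scalar element to keep the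
origin fixed, whence the hypothesis on `κ`. -/
theorem exists_shift {κ : Fin 3 → ZMod 3} (hκ : tors 0 κ ∈ A.Λ) :
    ∃ B, Biholomorphic A B ∧ IsNormal B ∧
      (∀ e n m, A.LiftsTors e n m → B.LiftsTors e n (m + e * κ)) ∧ B.Λ = A.Λ := by
  have h1 : (1 : V)⁻¹ = 1 := inv_one
  have h0 : ∀ i, (1 : V) i ≠ 0 := fun i => one_ne_zero
  have hl : ∀ {d c}, A.Lifts (affine d c) →
      (A.transport (diagAff 1 (tors κ 0) h0)).Lifts (affine d (c + tors κ 0 - d * tors κ 0)) := by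
    intro d c hc
    simpa using hc.transport_diagAff (s := tors κ 0) h0
  have hΛ : (A.transport (diagAff 1 (tors κ 0) h0)).Λ = A.Λ := by
    ext v
    rw [mem_transport_diagAff, h1, one_mul]
  have hlt : ∀ e n m, A.LiftsTors e n m →
      (A.transport (diagAff 1 (tors κ 0) h0)).LiftsTors e n (m + e * κ) := by
    intro e n m h
    refine (hl h).affine_congr ?_
    rw [hΛ]
    have h2 := hA.le (tors_add_sub_mem n m 0 (e * κ))
    have h3 := hA.le (dz_mul_tors_sub_mem e κ 0)
    have h4 := hA.le (tors_add_sub_mem κ (0 - e * κ) 0 (e * κ))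
    rw [add_zero] at h2 h4
    rw [sub_add_cancel] at h4
    convert A.Λ.add_mem (A.Λ.sub_mem h3 h2) h4 using 1
    ring
  refine ⟨A.transport (diagAff 1 (tors κ 0) h0), biholomorphic_transport A _, ?_, hlt, hΛ⟩
  refine ⟨hA.isAffineQuotient.transport _, fun e => ?_, fun i x => ?_, ?_⟩
  · obtain ⟨c, hc⟩ := hA.exists_lift e
    exact ⟨_, hl hc⟩
  · rw [hΛ, hA.single_mem]
  · have h5 := hlt _ _ _ hA.liftsTors_one
    have h6 := h5.congr (by rw [hΛ]; exact hA.le) (m' := 0) (by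
      rw [hΛ]; simpa using tors_zero_neg_mem hA.le hκ)
    have h : tors 0 0 = 0 := by funext i; simp [tors]
    rw [LiftsTors, h] at h6
    exact h6

end IsNormal

end TorusQuotient

end

/-! ### The possible lattices -/

noncomputable section

namespace TorusQuotient

open Topology

theorem exists_perm {i j k : Fin 3} (hij : i ≠ j) (hik : i ≠ k) (hjk : j ≠ k) :
    ∃ π : Equiv.Perm (Fin 3), π 0 = i ∧ π 1 = j ∧ π 2 = k := by
  revert i j k; decide

namespace IsNormal

open TorusGroup

variable {A : TorusGroup} (hA : IsNormal A)
include hA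

theorem not_mem_of_pair {e n m : Fin 3 → ZMod 3} (h : A.LiftsTors e n m) {i j k : Fin 3}
    (hij : i ≠ j) (hik : i ≠ k) (hjk : j ≠ k) (hi : e i = 0) (hj : e j ≠ 0) (hk : e k ≠ 0)
    {κ : Fin 3 → ZMod 3} (hκ : tors 0 κ ∈ A.Λ) (hκi : κ i = m i) : n i ≠ 0 := by
  intro hn
  refine hA.liftsTors_free h (fun h0 => hj (by simp [h0])) hi hκ fun l hl => ?_
  have hlt : ∀ i j k l : Fin 3, i ≠ j → i ≠ k → j ≠ k → l = i ∨ l = j ∨ l = k := by decide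
  have := hlt i j k l hij hik hjk
  rcases this with rfl | rfl | rfl
  · exact ⟨hn, hκi⟩
  · exact absurd hl hj
  · exact absurd hl hk

/-- With `s j` the reflection of exponent `Pi.single j 1`, both `s j * s k` and `s j * s k ^ 2` have
eigenvalue one exactly on the `i`-th axis, so freeness is a condition on that coordinate alone. -/
theorem pair_ne {n m : Fin 3 → Fin 3 → ZMod 3}
    (h : ∀ j, A.LiftsTors (Pi.single j 1) (n j) (m j)) {i j k : Fin 3}
    (hij : i ≠ j) (hik : i ≠ k) (hjk : j ≠ k) :
    (∀ κ, tors 0 κ ∈ A.Λ → κ i = m j i + m k i → n j i + n k i ≠ 0) ∧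
    ∀ κ, tors 0 κ ∈ A.Λ → κ i = m j i + m k i + m k i → n j i + n k i + n k i ≠ 0 := by
  have h1 := (h j).add hA.le (h k)
  have h2 := h1.add hA.le (h k)
  constructor
  · intro κ hκ hi
    refine hA.not_mem_of_pair h1 hij hik hjk ?_ ?_ ?_ hκ ?_
    · simp [hij, hik]
    · simp [hjk]
    · simp [hjk.symm]
    · simp [hi, hij]
  · intro κ hκ hi
    refine hA.not_mem_of_pair h2 hij hik hjk ?_ ?_ ?_ hκ ?_
    · simp [hij, hik]
    · simp [hjk]
    · simp [hjk.symm]; decide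
    · simp [hi, hij, hik]

theorem smul_mem {κ : Fin 3 → ZMod 3} (hκ : tors 0 κ ∈ A.Λ) (x : ZMod 3) :
    tors 0 ((fun _ => x) * κ) ∈ A.Λ := by
  induction x using zmod_cases with
  | h0 =>
    convert A.Λ.zero_mem using 1
    funext i; simp [tors]
  | h1 => convert hκ using 2; funext i; simp
  | h2 => convert tors_zero_add_mem hA.le hκ hκ using 2; funext i; simp [two_mul]

/-- If the lattice is not the standard one, then it projects trivially to exactly one axis. -/
theorem exists_pair (hK : ∃ κ, κ ≠ 0 ∧ tors 0 κ ∈ A.Λ) :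
    ∃ i j k : Fin 3, i ≠ j ∧ i ≠ k ∧ j ≠ k ∧ (∃ κ, tors 0 κ ∈ A.Λ ∧ κ i ≠ 0 ∧ κ j ≠ 0) ∧
      ∀ κ, tors 0 κ ∈ A.Λ → κ k = 0 := by
  choose n m hn h using fun j => hA.exists_liftsTors (Pi.single j 1)
  -- A coordinate seen by the code takes all values on it, so `pair_ne` applies whatever `m` is. It
  -- gives `n j i ± n k i ≠ 0` in `ℤ/3`, which means that exactly one of the two vanishes.
  have hone : ∀ i j k : Fin 3, i ≠ j → i ≠ k → j ≠ k → ∀ κ, tors 0 κ ∈ A.Λ → κ i ≠ 0 →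
      (n j i = 0 ↔ n k i ≠ 0) := by
    intro i j k hij hik hjk κ hκ hκi
    have h1 := hA.pair_ne h hij hik hjk
    have h2 : ∀ y, ∃ κ', tors 0 κ' ∈ A.Λ ∧ κ' i = y := by
      intro y
      refine ⟨_, hA.smul_mem hκ (y * (κ i)⁻¹), ?_⟩
      simp [hκi]
    obtain ⟨κ₁, h3, h4⟩ := h2 (m j i + m k i)
    obtain ⟨κ₂, h5, h6⟩ := h2 (m j i + m k i + m k i)
    have h7 := h1.1 _ h3 h4
    have h8 := h1.2 _ h5 h6
    revert h7 h8
    generalize n j i = x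
    generalize n k i = y
    revert x y
    decide
  -- The commutator of two reflections gives a code vector supported on `{j, k}`. As the code has no
  -- vector of weight one, `n j k` and `n k j` vanish together, and if nonzero they yield a vector
  -- of weight two.
  have hcomm : ∀ j k : Fin 3, tors 0 (Pi.single k (n j k) - Pi.single j (n k j)) ∈ A.Λ := by
    intro j k
    convert hA.liftsTors_comm (h j) (h k) using 2
    congr 1 <;> · funext l; simp only [Pi.single_apply, Pi.mul_apply]; split_ifs with hl <;> simp [hl]
  have hsymm : ∀ j k : Fin 3, j ≠ k → n j k = 0 → n k j = 0 := by
    intro j k hjk h0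
    have := hcomm j k
    rw [h0, Pi.single_zero, zero_sub, ← Pi.single_neg] at this
    simpa using hA.eq_zero_of_single_mem this
  obtain ⟨κ, hκ0, hκ⟩ := hK
  obtain ⟨i, hi⟩ := Function.ne_iff.1 hκ0
  have hex : ∀ i : Fin 3, ∃ j k : Fin 3, i ≠ j ∧ i ≠ k ∧ j ≠ k := by decide
  obtain ⟨j₀, k₀, h1, h2, h3⟩ := hex i
  have : ∃ j k : Fin 3, i ≠ j ∧ i ≠ k ∧ j ≠ k ∧ n j i ≠ 0 := by
    by_cases h4 : n j₀ i = 0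
    · exact ⟨k₀, j₀, h2, h1, h3.symm, (hone i j₀ k₀ h1 h2 h3 κ hκ hi).1 h4⟩
    · exact ⟨j₀, k₀, h1, h2, h3, h4⟩
  obtain ⟨j, k, hij, hik, hjk, hji⟩ := this
  have hij' : n i j ≠ 0 := fun h => hji (hsymm _ _ hij h)
  have hκ₁ := hcomm j i
  have hki : n k i = 0 := by
    by_contra h0
    exact hji ((hone i j k hij hik hjk κ hκ hi).2 h0)
  have hik0 : n i k = 0 := hsymm _ _ hik.symm hki
  have hkj : n k j = 0 := by
    by_contra h0
    refine hij' ((hone j i k hij.symm hjk hik _ hκ₁ ?_).2 h0)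
    simp [hij.symm, hij']
  have hjk0 : n j k = 0 := hsymm _ _ hjk.symm hkj
  refine ⟨i, j, k, hij, hik, hjk, ⟨_, hκ₁, ?_, ?_⟩, fun κ' hκ' => ?_⟩
  · simp [hij, hji]
  · simp [hij.symm, hij']
  · by_contra h0
    exact (hone k i j hik.symm hjk.symm hij κ' hκ' h0).1 hik0 hjk0

/-- A permutation and signs turn the code vector of weight two into `(1,1,0)`. Another code vector,
corrected by a multiple of it, has weight at most one and hence is zero. -/
theorem exists_standard_lattice (hK : ∃ κ, κ ≠ 0 ∧ tors 0 κ ∈ A.Λ) :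
    ∃ B, Biholomorphic A B ∧ IsNormal B ∧ ∀ κ, tors 0 κ ∈ B.Λ ↔ κ 0 = κ 1 ∧ κ 2 = 0 := by
  obtain ⟨i, j, k, hij, hik, hjk, ⟨κ, hκ, hκi, hκj⟩, hk⟩ := hA.exists_pair hK
  obtain ⟨π, rfl, rfl, rfl⟩ := exists_perm hij hik hjk
  have hB := hA.transport_permAff π
  obtain ⟨C, hBC, hC, -, hmem⟩ := hB.exists_sign (δ := ![κ (π 0), κ (π 1), 1]) (by
    simp [Fin.forall_fin_succ, hκi, hκj])
  simp only [tors_mem_transport_permAff] at hmem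
  have h110 : tors 0 ![1, 1, 0] ∈ C.Λ := by
    rw [hmem]
    convert hκ using 1
    refine congrArg (tors 0) (funext fun l => ?_)
    obtain ⟨l, rfl⟩ := π.surjective l
    rw [Function.comp_apply, Equiv.symm_apply_apply]
    fin_cases l
    · simp
    · simp
    · simp [hk κ hκ]
  refine ⟨C, (biholomorphic_transport A _).trans hBC, hC, fun κ' => ⟨fun h => ?_, fun ⟨h, h'⟩ => ?_⟩⟩
  · have h2 : κ' 2 = 0 := by
      simpa using hk _ ((hmem κ').1 h)
    refine ⟨?_, h2⟩
    have h3 := tors_zero_add_mem hC.le h (hC.smul_mem h110 (-κ' 0))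
    have h4 : κ' + (fun _ => -κ' 0) * ![1, 1, 0] = Pi.single 1 (κ' 1 - κ' 0) := by
      funext l
      fin_cases l
      · simp
      · simp; ring
      · simp [h2]
    rw [h4] at h3
    exact (sub_eq_zero.1 (hC.eq_zero_of_single_mem h3)).symm
  · convert hC.smul_mem h110 (κ' 0) using 2
    funext l
    fin_cases l
    · simp
    · simp [h]
    · simp [h']

end IsNormal

end TorusQuotient

end

/-! ### Translation parts of the three reflections -/

noncomputable section

namespace TorusQuotient

open Topology

theorem swap_single (j : Fin 3) : (Pi.single j 1 : Fin 3 → ZMod 3) ∘ Equiv.swap 0 1 =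
    Pi.single (Equiv.swap 0 1 j) 1 := by
  revert j; decide

theorem single_add_single_add_single :
    (Pi.single 0 1 + (Pi.single 1 1 + Pi.single 2 1) : Fin 3 → ZMod 3) = 1 := by decide

namespace IsNormal

open TorusGroup

variable {A : TorusGroup} (hA : IsNormal A)
include hA

theorem eq_Λ₁ (hK : ∀ κ, tors 0 κ ∈ A.Λ → κ = 0) : A.Λ = Λ₁ := by
  refine le_antisymm (fun l hl => ?_) hA.le
  obtain ⟨m, hm, h⟩ := hA.exists_tors hl
  rw [hK m hm] at h
  have h0 : tors 0 0 ∈ Λ₁ := tors_mem_Λ₁.2 ⟨rfl, rfl⟩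
  simpa using Λ₁.add_mem h h0

theorem eq_Λ₂ (hK : ∀ κ, tors 0 κ ∈ A.Λ ↔ κ 0 = κ 1 ∧ κ 2 = 0) : A.Λ = Λ₂ := by
  have hv : tors 0 ![1, 1, 0] = ![t, t, 0] := by
    funext i; fin_cases i <;> simp [tors, ZMod.val_one]
  have hv2 : ![t, t, 0] ∈ Λ₂ := Submodule.mem_sup_right (Submodule.mem_span_singleton_self _)
  refine le_antisymm (fun l hl => ?_) (sup_le hA.le ?_)
  · obtain ⟨m, hm, h⟩ := hA.exists_tors hl
    obtain ⟨h1, h2⟩ := (hK m).1 hm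
    have h3 : tors 0 m = (m 0).val • ![t, t, 0] := by
      funext i; fin_cases i <;> simp [tors, h1, h2]
    rw [← sub_add_cancel l (tors 0 m)]
    refine Λ₂.add_mem (Submodule.mem_sup_left h) ?_
    rw [h3]
    exact Λ₂.nsmul_mem hv2 _
  · rw [Submodule.span_singleton_le_iff_mem, ← hv, hK]
    simp

omit hA in
theorem liftsTors_swap {n m n' m' : Fin 3 → Fin 3 → ZMod 3}
    (h : ∀ j, A.LiftsTors (Pi.single j 1) (n j) (m j))
    (hn : ∀ j i, n' j i = n (Equiv.swap 0 1 j) (Equiv.swap 0 1 i))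
    (hm : ∀ j i, m' j i = m (Equiv.swap 0 1 j) (Equiv.swap 0 1 i)) (j : Fin 3) :
    (A.transport (permAff (Equiv.swap 0 1))).LiftsTors (Pi.single j 1) (n' j) (m' j) := by
  have h1 := (h (Equiv.swap 0 1 j)).transport_permAff (Equiv.swap 0 1)
  rw [swap_single, Equiv.swap_apply_self] at h1
  have h2 : n (Equiv.swap 0 1 j) ∘ Equiv.swap 0 1 = n' j := funext fun i => (hn j i).symm
  have h3 : m (Equiv.swap 0 1 j) ∘ Equiv.swap 0 1 = m' j := funext fun i => (hm j i).symm
  rwa [h2, h3] at h1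

/-- The product of the reflections is the scalar element, so each column of `m` sums to zero and,
having one zero off the diagonal, is determined by its other off-diagonal entry. Three signs
normalise the three entries left. -/
theorem exists_std_of_zeros {m : Fin 3 → Fin 3 → ZMod 3}
    (h : ∀ j, A.LiftsTors (Pi.single j 1) 0 (m j)) (hK : ∀ κ, tors 0 κ ∈ A.Λ → κ = 0)
    (h01 : m 0 1 = 0) (h12 : m 1 2 = 0) (h20 : m 2 0 = 0)
    (h10 : m 1 0 ≠ 0) (h21 : m 2 1 ≠ 0) (h02 : m 0 2 ≠ 0) (hs : m 0 + m 1 + m 2 = 0) :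
    ∃ B, Biholomorphic A B ∧ IsNormal B ∧ (∀ κ, tors 0 κ ∈ B.Λ → κ = 0) ∧
      B.LiftsTors (Pi.single 0 1) 0 ![-1, 0, -1] ∧ B.LiftsTors (Pi.single 1 1) 0 ![1, -1, 0] ∧
      B.LiftsTors (Pi.single 2 1) 0 ![0, 1, 1] := by
  have hδ : ∀ i, ![m 1 0, m 2 1, -m 0 2] i ≠ 0 := by
    simp [Fin.forall_fin_succ, h10, h21, h02]
  obtain ⟨B, hAB, hB, hl, hmem⟩ := hA.exists_sign hδ
  have hs0 := congrFun hs 0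
  have hs1 := congrFun hs 1
  have hs2 := congrFun hs 2
  simp only [Pi.add_apply, Pi.zero_apply, h01, h12, h20, zero_add, add_zero] at hs0 hs1 hs2
  have hsq : ∀ x : ZMod 3, x ≠ 0 → x * x = 1 := by decide
  have h00 : m 0 0 = -m 1 0 := eq_neg_of_add_eq_zero_left hs0
  have h11 : m 1 1 = -m 2 1 := eq_neg_of_add_eq_zero_left hs1
  have h22 : m 2 2 = -m 0 2 := eq_neg_of_add_eq_zero_right hs2
  refine ⟨B, hAB, hB, fun κ hκ => ?_, ?_, ?_, ?_⟩
  · have := hK _ ((hmem κ).1 hκ)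
    funext i
    exact (mul_eq_zero.1 (congrFun this i)).resolve_left (hδ i)
  · convert hl _ _ _ (h 0) using 1
    · simp
    · funext i; fin_cases i <;> simp [h00, h01, hsq _ h10, hsq _ h02]
  · convert hl _ _ _ (h 1) using 1
    · simp
    · funext i; fin_cases i <;> simp [h11, h12, hsq _ h10, hsq _ h21]
  · convert hl _ _ _ (h 2) using 1
    · simp
    · funext i; fin_cases i <;> simp [h22, h20, hsq _ h02, hsq _ h21]

/-- With trivial code all `n` vanish, and freeness only concerns the zeros of `m`: each column has
exactly one off the diagonal, by the products of two reflections, and no row has two, by the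
reflections themselves. -/
theorem exists_std_of_forall (hK : ∀ κ, tors 0 κ ∈ A.Λ → κ = 0) :
    ∃ B, Biholomorphic A B ∧ IsNormal B ∧ B.Λ = Λ₁ ∧
      B.LiftsTors (Pi.single 0 1) 0 ![-1, 0, -1] ∧ B.LiftsTors (Pi.single 1 1) 0 ![1, -1, 0] ∧
      B.LiftsTors (Pi.single 2 1) 0 ![0, 1, 1] := by
  choose n m hn h using fun j => hA.exists_liftsTors (Pi.single j 1)
  obtain rfl : n = 0 := funext fun j => hK _ (hn j)
  have h0 : tors 0 0 ∈ A.Λ := hA.le (tors_mem_Λ₁.2 ⟨rfl, rfl⟩)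
  have hpair : ∀ i j k : Fin 3, i ≠ j → i ≠ k → j ≠ k → (m j i = 0 ↔ m k i ≠ 0) := by
    intro i j k hij hik hjk
    have h1 := hA.pair_ne h hij hik hjk
    have h7 := h1.1 _ h0
    have h8 := h1.2 _ h0
    simp only [Pi.zero_apply, add_zero, ne_eq, not_true_eq_false, imp_false] at h7 h8
    revert h7 h8
    generalize m j i = x
    generalize m k i = y
    revert x y
    decide
  have hrow : ∀ i j k : Fin 3, i ≠ j → i ≠ k → j ≠ k → m i j = 0 → m i k ≠ 0 := by
    intro i j k hij hik hjk h1 h2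
    refine hA.liftsTors_free (h i) (by simp) (i := j) (by simp [hij.symm]) h0 fun l hl => ?_
    have hlt : ∀ i j k l : Fin 3, i ≠ j → i ≠ k → j ≠ k → l = i ∨ l = j ∨ l = k := by decide
    rcases hlt i j k l hij hik hjk with rfl | rfl | rfl
    · simp at hl
    · simp [h1]
    · simp [h2]
  have hs : m 0 + m 1 + m 2 = 0 := by
    have h3 := (h 0).add hA.le ((h 1).add hA.le (h 2))
    rw [single_add_single_add_single] at h3
    have h4 := hK _ (hA.liftsTors_unique h3 hA.liftsTors_one).2
    simpa [add_assoc] using h4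
  -- The off-diagonal zeros follow one of the two cyclic orders of the coordinates; the swap of the
  -- first two exchanges these orders.
  by_cases h01 : m 0 1 = 0
  · have h21 : m 2 1 ≠ 0 := (hpair 1 0 2 (by decide) (by decide) (by decide)).1 h01
    have h02 := hrow 0 1 2 (by decide) (by decide) (by decide) h01
    have h12 : m 1 2 = 0 := (hpair 2 1 0 (by decide) (by decide) (by decide)).2 h02
    have h10 := hrow 1 2 0 (by decide) (by decide) (by decide) h12
    have h20 : m 2 0 = 0 := (hpair 0 2 1 (by decide) (by decide) (by decide)).2 h10
    obtain ⟨B, hAB, hB, hKB, hl⟩ := hA.exists_std_of_zeros h hK h01 h12 h20 h10 h21 h02 hs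
    exact ⟨B, hAB, hB, hB.eq_Λ₁ hKB, hl⟩
  · have h21 : m 2 1 = 0 := (hpair 1 2 0 (by decide) (by decide) (by decide)).2 h01
    have h20 := hrow 2 1 0 (by decide) (by decide) (by decide) h21
    have h10 : m 1 0 = 0 := (hpair 0 1 2 (by decide) (by decide) (by decide)).2 h20
    have h12 := hrow 1 0 2 (by decide) (by decide) (by decide) h10
    have h02 : m 0 2 = 0 := (hpair 2 0 1 (by decide) (by decide) (by decide)).2 h12
    have e0 : Equiv.swap (0 : Fin 3) 1 0 = 1 := rfl
    have e1 : Equiv.swap (0 : Fin 3) 1 1 = 0 := rfl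
    have e2 : Equiv.swap (0 : Fin 3) 1 2 = 2 := rfl
    obtain ⟨m', hm', hsw⟩ : ∃ m' : Fin 3 → Fin 3 → ZMod 3,
        (∀ {j i j' i'}, Equiv.swap (0 : Fin 3) 1 j = j' → Equiv.swap (0 : Fin 3) 1 i = i' →
          m' j i = m j' i') ∧
        ∀ j, (A.transport (permAff (Equiv.swap 0 1))).LiftsTors (Pi.single j 1) 0 (m' j) :=
      ⟨fun j i => m (Equiv.swap 0 1 j) (Equiv.swap 0 1 i), by rintro j i _ _ rfl rfl; rfl,
        liftsTors_swap (n' := 0) h (fun _ _ => rfl) fun _ _ => rfl⟩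
    have hs' : m' 0 + m' 1 + m' 2 = 0 := by
      funext i
      have := congrFun hs (Equiv.swap 0 1 i)
      simp only [Pi.add_apply, Pi.zero_apply] at this ⊢
      rw [hm' e0 rfl, hm' e1 rfl, hm' e2 rfl, ← this]; ring
    have hK' : ∀ κ, tors 0 κ ∈ (A.transport (permAff (Equiv.swap 0 1))).Λ → κ = 0 := by
      intro κ hκ
      have := hK _ ((tors_mem_transport_permAff _).1 hκ)
      funext i
      have h4 := congrFun this (Equiv.swap 0 1 i)
      rwa [Function.comp_apply, Equiv.symm_apply_apply] at h4
    rw [← hm' e0 e1] at h10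
    rw [← hm' e1 e2] at h02
    rw [← hm' e2 e0] at h21
    rw [← hm' e1 e0] at h01
    rw [← hm' e2 e1] at h20
    rw [← hm' e0 e2] at h12
    obtain ⟨B, hAB, hB, hKB, hl⟩ := (hA.transport_permAff (Equiv.swap 0 1)).exists_std_of_zeros
      hsw hK' h10 h02 h21 h01 h20 h12 hs'
    exact ⟨B, (biholomorphic_transport A _).trans hAB, hB, hB.eq_Λ₁ hKB, hl⟩

/-- The translation parts of the three generators, for the second lattice. -/
theorem exists_parameters (hK : ∀ κ, tors 0 κ ∈ A.Λ ↔ κ 0 = κ 1 ∧ κ 2 = 0) :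
    ∃ (a : ZMod 3) (b g : Fin 3 → ZMod 3), a ≠ 0 ∧ b 0 + b 1 + b 2 = -a ∧ b 2 ≠ 0 ∧
      (g 0 = 0 ↔ g 1 ≠ 0) ∧ g 0 + g 1 + g 2 = 0 ∧
      A.LiftsTors (Pi.single 0 1) ![-a, -a, 0] ![0, b 0, g 0] ∧
      A.LiftsTors (Pi.single 1 1) ![a, a, 0] ![0, b 1, g 1] ∧
      A.LiftsTors (Pi.single 2 1) 0 ![0, b 2, g 2] := by
  have : ∀ j, ∃ a b g, A.LiftsTors (Pi.single j 1) ![a, a, 0] ![0, b, g] := by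
    intro j
    obtain ⟨n, m, hn, h⟩ := hA.exists_liftsTors (Pi.single j 1)
    obtain ⟨h1, h2⟩ := (hK _).1 hn
    refine ⟨n 0, m 1 - m 0, m 2, ?_⟩
    have h3 : n = ![n 0, n 0, 0] := by
      funext i; fin_cases i <;> simp [h1, h2]
    rw [← h3]
    refine h.congr hA.le ((hK _).2 ?_)
    simp
  choose a b g h using this
  -- Membership in the code is equality of the first two entries, and here these are `-a 1`, `a 0`,
  -- respectively `-a 2`, `0`.
  have h01 := hA.liftsTors_comm (h 0) (h 1)
  have h02 := hA.liftsTors_comm (h 0) (h 2)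
  rw [hK] at h01 h02
  have ha0 : a 0 = -a 1 := by
    have := h01.1
    simp at this
    exact this.symm
  have ha2 : a 2 = 0 := by
    have := h02.1
    simp at this
    exact this
  have h012 := (h 0).add hA.le ((h 1).add hA.le (h 2))
  rw [single_add_single_add_single] at h012
  have h4 := (hK _).1 (hA.liftsTors_unique h012 hA.liftsTors_one).2
  have hp0 := hA.pair_ne h (i := 0) (j := 1) (k := 2) (by decide) (by decide) (by decide)
  have hp2 := hA.pair_ne h (i := 2) (j := 0) (k := 1) (by decide) (by decide) (by decide)
  -- Freeness of the product of the last two reflections, whose eigenvalue one is in the first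
  -- coordinate.
  have ha1 : a 1 ≠ 0 := by
    have := hp0.1 0 ((hK _).2 ⟨rfl, rfl⟩) (by simp)
    simpa [ha2] using this
  have hb2 : b 2 ≠ 0 := by
    intro hb
    refine hA.liftsTors_free (h 2) (by simp) (i := 0) (by simp) ((hK 0).2 ⟨rfl, rfl⟩) ?_
    intro j hj
    fin_cases j <;> simp_all
  have hg1 := hp2.1 0 ((hK _).2 ⟨rfl, rfl⟩)
  have hg2 := hp2.2 0 ((hK _).2 ⟨rfl, rfl⟩)
  refine ⟨a 1, b, g, ha1, ?_, hb2, ?_, ?_, ?_, h 1, ?_⟩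
  · have := h4.1
    simp only [Pi.add_apply, Pi.sub_apply, Pi.mul_apply] at this
    simp [ha2] at this
    rw [add_assoc]; exact this.symm
  · simp at hg1 hg2
    revert hg1 hg2
    generalize g 0 = x
    generalize g 1 = y
    revert x y
    decide
  · have := h4.2
    simp only [Pi.add_apply, Pi.sub_apply, Pi.mul_apply] at this
    simp at this
    rw [add_assoc]; exact this
  · rw [← ha0]; exact h 0
  · convert h 2 using 1
    funext i; fin_cases i <;> simp [ha2]

end IsNormal

end TorusQuotient

end

/-! ### Normal form for the second lattice -/

noncomputable section

namespace TorusQuotient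

open Topology

namespace IsNormal

open TorusGroup

variable {A : TorusGroup} (hA : IsNormal A)
include hA

/-- Exactly one of `g 0`, `g 1` vanishes, and the swap of the first two coordinates, which preserves
the code, decides which. It turns `(0, b, g)` into `(b, 0, g)`, which is `(0, -b, g)` modulo the
code. -/
theorem exists_parameters_of_swap (hK : ∀ κ, tors 0 κ ∈ A.Λ ↔ κ 0 = κ 1 ∧ κ 2 = 0) :
    ∃ B, Biholomorphic A B ∧ IsNormal B ∧ (∀ κ, tors 0 κ ∈ B.Λ ↔ κ 0 = κ 1 ∧ κ 2 = 0) ∧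
      ∃ a b₀ b₁ b₂ g : ZMod 3, a ≠ 0 ∧ b₀ + b₁ + b₂ = -a ∧ b₂ ≠ 0 ∧ g ≠ 0 ∧
      B.LiftsTors (Pi.single 0 1) ![-a, -a, 0] ![0, b₀, 0] ∧
      B.LiftsTors (Pi.single 1 1) ![a, a, 0] ![0, b₁, g] ∧
      B.LiftsTors (Pi.single 2 1) 0 ![0, b₂, -g] := by
  obtain ⟨a, b, g, ha, hb, hb2, hg, hgs, h0, h1, h2⟩ := hA.exists_parameters hK
  by_cases hg0 : g 0 = 0
  · refine ⟨A, .refl A, hA, hK, a, b 0, b 1, b 2, g 1, ha, hb, hb2, hg.1 hg0, ?_, h1, ?_⟩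
    · rwa [hg0] at h0
    · rw [hg0, zero_add] at hgs
      rwa [eq_neg_of_add_eq_zero_right hgs] at h2
  · have hg1 : g 1 = 0 := by by_contra h; exact hg0 (hg.2 h)
    have h110 : ∀ x : ZMod 3, ∀ m m' : Fin 3 → ZMod 3, m' = m + ![x, x, 0] →
        tors 0 (m' - m) ∈ (A.transport (permAff (Equiv.swap 0 1))).Λ := by
      rintro x m _ rfl
      rw [tors_mem_transport_permAff, hK, add_sub_cancel_left]
      exact ⟨rfl, rfl⟩
    have hB := hA.transport_permAff (Equiv.swap 0 1)
    have hl : ∀ {j n m}, A.LiftsTors (Pi.single j 1) n m → ∀ {j' n' m'},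
        Pi.single j 1 ∘ Equiv.swap 0 1 = (Pi.single j' 1 : Fin 3 → ZMod 3) →
        n ∘ Equiv.swap 0 1 = n' → (∃ x, m' = m ∘ Equiv.swap 0 1 + ![x, x, 0]) →
        (A.transport (permAff (Equiv.swap 0 1))).LiftsTors (Pi.single j' 1) n' m' := by
      intro j n m h j' n' m' hj hn ⟨x, hx⟩
      have := h.transport_permAff (Equiv.swap 0 1)
      rw [hj, hn] at this
      exact this.congr hB.le (h110 x _ _ hx)
    have hsw : ∀ x y z : ZMod 3, ![x, y, z] ∘ Equiv.swap (0 : Fin 3) 1 = ![y, x, z] := by decide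
    have hsw0 : (0 : Fin 3 → ZMod 3) ∘ Equiv.swap (0 : Fin 3) 1 = 0 := by decide
    refine ⟨A.transport (permAff (Equiv.swap 0 1)), biholomorphic_transport A _, hB, fun κ => ?_,
      -a, -b 1, -b 0, -b 2, g 0, neg_ne_zero.2 ha, ?_, neg_ne_zero.2 hb2, hg0,
      hl h1 (by decide) ?_ ⟨-b 1, ?_⟩, hl h0 (by decide) ?_ ⟨-b 0, ?_⟩,
      hl h2 (by decide) ?_ ⟨-b 2, ?_⟩⟩
    · rw [tors_mem_transport_permAff, hK]
      change κ 1 = κ 0 ∧ κ 2 = 0 ↔ _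
      rw [eq_comm]
    · rw [← hb]; ring
    · rw [hsw, neg_neg]
    · rw [hsw, hg1]; funext i; fin_cases i <;> simp
    · rw [hsw]
    · rw [hsw]; funext i; fin_cases i <;> simp
    · rw [hsw0]
    · rw [hsw]
      rw [hg1, add_zero] at hgs
      rw [eq_neg_of_add_eq_zero_right hgs]; funext i; fin_cases i <;> simp

/-- Signs make `b₂` and `g` equal to one and replace `a` by `a * b₂`; a shift then fixes `b₀`, and
the sum relation fixes `b₁`. The sign `a * b₂` survives and accounts for the two cases. -/
theorem exists_std_of_lattice (hK : ∀ κ, tors 0 κ ∈ A.Λ ↔ κ 0 = κ 1 ∧ κ 2 = 0) :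
    ∃ B, Biholomorphic A B ∧ IsNormal B ∧ B.Λ = Λ₂ ∧
      (B.LiftsTors (Pi.single 0 1) ![-1, -1, 0] ![0, -1, 0] ∧
        B.LiftsTors (Pi.single 1 1) ![1, 1, 0] ![0, -1, 1] ∧
        B.LiftsTors (Pi.single 2 1) 0 ![0, 1, -1] ∨
      B.LiftsTors (Pi.single 0 1) ![1, 1, 0] 0 ∧
        B.LiftsTors (Pi.single 1 1) ![-1, -1, 0] ![0, 0, 1] ∧
        B.LiftsTors (Pi.single 2 1) 0 ![0, 1, -1]) := by
  obtain ⟨B, hAB, hB, hKB, a, b₀, b₁, b₂, g, ha, hb, hb2, hg, h0, h1, h2⟩ :=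
    hA.exists_parameters_of_swap hK
  have hsq : ∀ x : ZMod 3, x ≠ 0 → x * x = 1 := by decide
  obtain ⟨C, hBC, hC, hl, hmem⟩ := hB.exists_sign (δ := ![b₂, b₂, g]) (by
    simp [Fin.forall_fin_succ, hb2, hg])
  have hKC : ∀ κ, tors 0 κ ∈ C.Λ ↔ κ 0 = κ 1 ∧ κ 2 = 0 := by
    intro κ
    rw [hmem, hKB]
    simp [hb2, hg]
  -- The shift by `(x, x, 0)` adds `(x, 0, 0)` to the first translation part, which is `(0, -x, 0)`
  -- modulo the code; `x` is chosen to bring `b₂ * b₀` to `a * b₂ + 1`.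
  obtain ⟨D, hCD, hD, hl', hDΛ⟩ := hC.exists_shift (κ := fun i => (b₂ * b₀ - (a * b₂ + 1)) * ![1, 1, 0] i) (by
    rw [hKC]; simp)
  have hKD : ∀ κ, tors 0 κ ∈ D.Λ ↔ κ 0 = κ 1 ∧ κ 2 = 0 := by rwa [hDΛ]
  have k0 := hl' _ _ _ (hl _ _ _ h0)
  have k1 := hl' _ _ _ (hl _ _ _ h1)
  have k2 := hl' _ _ _ (hl _ _ _ h2)
  refine ⟨D, hAB.trans (hBC.trans hCD), hD, hD.eq_Λ₂ hKD, ?_⟩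
  have hfin : ∀ {e n m n' m'}, D.LiftsTors e n m → n' = n → m' 0 - m 0 = m' 1 - m 1 → m' 2 = m 2 →
      D.LiftsTors e n' m' := by
    rintro e n m _ m' h rfl h3 h4
    exact h.congr hD.le ((hKD _).2 ⟨h3, sub_eq_zero.2 h4⟩)
  have h3 : (3 : ZMod 3) = 0 := rfl
  have l0 : D.LiftsTors (Pi.single 0 1) ![-(a * b₂), -(a * b₂), 0] ![0, a * b₂ + 1, 0] := by
    refine hfin k0 ?_ ?_ ?_
    · funext i; fin_cases i <;> simp [mul_comm]
    · simp only [Pi.add_apply, Pi.mul_apply]; simp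
    · simp only [Pi.add_apply, Pi.mul_apply]; simp
  have l1 : D.LiftsTors (Pi.single 1 1) ![a * b₂, a * b₂, 0] ![0, a * b₂ + 1, 1] := by
    refine hfin k1 ?_ ?_ ?_
    · funext i; fin_cases i <;> simp [mul_comm]
    · simp only [Pi.add_apply, Pi.mul_apply]; simp
      linear_combination b₂ * hb - hsq _ hb2 - (a * b₂ + 1) * h3
    · simp only [Pi.add_apply, Pi.mul_apply]; simp [hsq _ hg]
  have l2 : D.LiftsTors (Pi.single 2 1) 0 ![0, 1, -1] := by
    refine hfin k2 ?_ ?_ ?_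
    · simp
    · simp only [Pi.add_apply, Pi.mul_apply]; simp [hsq _ hb2]
    · simp only [Pi.add_apply, Pi.mul_apply]; simp [hsq _ hg]
  have hα : ∀ x y : ZMod 3, x ≠ 0 → y ≠ 0 → x * y = 1 ∨ x * y = -1 := by decide
  rcases hα a b₂ ha hb2 with h | h
  · rw [h] at l0 l1
    exact .inl ⟨l0, l1, l2⟩
  · rw [h] at l0 l1
    refine .inr ⟨?_, l1, l2⟩
    convert l0 using 1
    · decide
    · decide

end IsNormal

end TorusQuotient

end

/-! ### Groups generated by `h`, `g`, `k` and construction of diagonal actions -/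

noncomputable section

namespace TorusQuotient

open Topology

theorem dz_ne_zero (e : Fin 3 → ZMod 3) (i : Fin 3) : dz e i ≠ 0 := pow_ne_zero _ ζ_ne_zero

/-- The exponents of `h`, `g`, `k` form a basis of `(ℤ/3)³`; the coefficients invert the base
change. -/
theorem generator_exponents (e : Fin 3 → ZMod 3) :
    e = (e 1 - e 2).val • ![0, 2, 1] + ((e 0 + e 1 + e 2).val • ![1, 0, 0] +
      (2 * e 2 - e 1).val • 1) := by
  funext i
  simp only [Pi.add_apply, Pi.smul_apply]
  simp only [nsmul_eq_mul, ZMod.natCast_zmod_val]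
  have h3 : (3 : ZMod 3) = 0 := rfl
  fin_cases i
  · simp; linear_combination (-e 2) * h3
  · simp; ring
  · simp; ring

namespace TorusGroup

variable {A : TorusGroup}

theorem Lifts.exists_nsmul {e : Fin 3 → ZMod 3} (h : ∃ c, A.Lifts (affine (dz e) c)) (n : ℕ) :
    ∃ c, A.Lifts (affine (dz (n • e)) c) := by
  induction n with
  | zero =>
    refine ⟨0, ?_⟩
    convert A.lifts_id using 1
    funext z
    have : dz (0 • e) = 1 := by rw [zero_smul]; funext i; simp [dz]
    rw [this]
    simp [affine]
  | succ n ih =>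
    obtain ⟨c, hc⟩ := h
    obtain ⟨c', hc'⟩ := ih
    have := hc'.affine_comp hc
    rw [← dz_add, ← succ_nsmul] at this
    exact ⟨_, this⟩

theorem dz_generator : dz ![0, 2, 1] = ![1, ζ ^ 2, ζ] ∧ dz ![1, 0, 0] = ![ζ, 1, 1] ∧
    dz 1 = ![ζ, ζ, ζ] := by
  refine ⟨?_, ?_, ?_⟩ <;> funext i <;> fin_cases i <;> simp [dz, ZMod.val_one, val_two]

theorem exists_lifts_of_generators {a b : V} (h : A.Lifts (affine ![1, ζ ^ 2, ζ] a))
    (g : A.Lifts (affine ![ζ, 1, 1] b)) (k : A.Lifts (affine ![ζ, ζ, ζ] 0)) (e : Fin 3 → ZMod 3) :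
    ∃ c, A.Lifts (affine (dz e) c) := by
  rw [← dz_generator.1] at h
  rw [← dz_generator.2.1] at g
  rw [← dz_generator.2.2] at k
  obtain ⟨c₁, h₁⟩ := Lifts.exists_nsmul ⟨_, h⟩ (e 1 - e 2).val
  obtain ⟨c₂, h₂⟩ := Lifts.exists_nsmul ⟨_, g⟩ (e 0 + e 1 + e 2).val
  obtain ⟨c₃, h₃⟩ := Lifts.exists_nsmul ⟨_, k⟩ (2 * e 2 - e 1).val
  have h₄ := h₁.affine_comp (h₂.affine_comp h₃)
  rw [← dz_add, ← dz_add, ← generator_exponents] at h₄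
  exact ⟨_, h₄⟩

theorem dz_unique [DiscreteTopology A.Λ] {e e' : Fin 3 → ZMod 3} {c c' : V}
    (h : ∀ z, A.torusProj (affine (dz e) c z) = A.torusProj (affine (dz e') c' z)) : e = e' := by
  apply dz_injective
  have h1 : ∀ z, affine (dz e) c z - affine (dz e') c' z ∈ A.Λ := fun z => A.torusProj_eq_iff.1 (h z)
  have h2 := A.const_of_mem (by unfold affine; fun_prop) h1 1 0
  simp only [affine, mul_one, mul_zero, zero_add] at h2
  rw [← sub_eq_zero]
  linear_combination h2

end TorusGroup

open TorusGroup

/-- The chosen lifts already give 27 distinct elements of a group of order 27. -/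
theorem IsAffineQuotient.exists_exponent {A : TorusGroup} (hA : IsAffineQuotient A)
    {c : (Fin 3 → ZMod 3) → V} (hc : ∀ e, A.Lifts (affine (dz e) (c e)))
    {τ : Equiv.Perm (V ⧸ A.Λ)} (hτ : τ ∈ A.G) :
    ∃ e, ∀ z, τ (A.torusProj z) = A.torusProj (affine (dz e) (c e) z) := by
  have := hA.discrete
  choose σ hσ hσ' using hc
  let f : (Fin 3 → ZMod 3) → A.G := fun e => ⟨σ e, hσ e⟩
  have hf : Function.Injective f := by
    intro e e' hee
    refine dz_unique (A := A) (c := c e) (c' := c e') fun z => ?_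
    have h1 : σ e = σ e' := congrArg Subtype.val hee
    rw [← hσ', h1, hσ']
  obtain ⟨ε⟩ := hA.group_iso
  have h1 : Function.Injective fun e => ε (f e) := ε.injective.comp hf
  have h2 : Function.Surjective fun e => Multiplicative.toAdd (ε (f e)) :=
    Finite.surjective_of_injective (f := fun e => Multiplicative.toAdd (ε (f e))) h1
  obtain ⟨e, he⟩ := h2 (Multiplicative.toAdd (ε ⟨τ, hτ⟩))
  have h3 : σ e = τ := congrArg Subtype.val (ε.injective he)
  exact ⟨e, fun z => by rw [← hσ', h3]⟩

/-- Recognition of the examples: `h`, `g`, `k` generate elements of all 27 exponents, hence all of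
`G`. This yields an equality, not just a biholomorphism. -/
theorem IsAffineQuotient.generated_eq {A : TorusGroup} (hA : IsAffineQuotient A) {a b : V}
    (h : A.Lifts (affine ![1, ζ ^ 2, ζ] a)) (g : A.Lifts (affine ![ζ, 1, 1] b))
    (k : A.Lifts (affine ![ζ, ζ, ζ] 0)) : A = ⟨A.Λ, generated A.Λ (generators a b)⟩ := by
  have hF : ∀ F ∈ generators a b, A.Lifts F := by
    rintro F (rfl | rfl | rfl)
    exacts [h, g, k]
  have hlift : ∀ F ∈ generators a b, (⟨A.Λ, generated A.Λ (generators a b)⟩ : TorusGroup).Lifts F := by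
    intro F hmem
    obtain ⟨σ, hσ, hσ'⟩ := hF F hmem
    exact ⟨σ, Subgroup.subset_closure ⟨F, hmem, hσ'⟩, hσ'⟩
  choose c hc using exists_lifts_of_generators (A := ⟨A.Λ, generated A.Λ (generators a b)⟩)
    (hlift _ (.inl rfl)) (hlift _ (.inr (.inl rfl))) (hlift _ (.inr (.inr rfl)))
  have heq : ∀ {σ τ : Equiv.Perm (V ⧸ A.Λ)} {F : V → V}, (∀ z, σ (A.torusProj z) = A.torusProj (F z)) →
      (∀ z, τ (A.torusProj z) = A.torusProj (F z)) → σ = τ := by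
    intro σ τ F hσ hτ
    ext x
    obtain ⟨z, rfl⟩ := A.torusProj_surjective x
    rw [hσ, hτ]
  have hle : generated A.Λ (generators a b) ≤ A.G := by
    rw [generated, Subgroup.closure_le]
    rintro σ ⟨F, hmem, hσ⟩
    obtain ⟨τ, hτ, hτ'⟩ := hF F hmem
    rwa [heq hσ hτ']
  have hG : A.G = generated A.Λ (generators a b) := by
    refine le_antisymm (fun τ hτ => ?_) hle
    obtain ⟨e, he⟩ := hA.exists_exponent (c := c) (fun e => by
      obtain ⟨σ, hσ, hσ'⟩ := hc e
      exact ⟨σ, hle hσ, hσ'⟩) hτ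
    obtain ⟨σ, hσ, hσ'⟩ := hc e
    rwa [heq he hσ']
  rw [← hG]

theorem span_Λ₁ : Submodule.span ℝ (Λ₁ : Set V) = ⊤ := by
  rw [eq_top_iff]
  intro v _
  rw [← Finset.univ_sum_single v]
  refine Submodule.sum_mem _ fun i _ => ?_
  obtain ⟨a, b, h⟩ := exists_add_mul_ζ (v i)
  have hs : ∀ x ∈ eis, (Pi.single i x : V) ∈ Submodule.span ℝ (Λ₁ : Set V) := by
    intro x hx
    refine Submodule.subset_span (mem_Λ₁.2 fun j => ?_)
    by_cases hj : j = i
    · subst hj; simpa using hx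
    · simp [hj]
  have : Pi.single i (v i) = a • (Pi.single i 1 : V) + b • (Pi.single i ζ : V) := by
    funext j
    by_cases hj : j = i
    · subst hj; simp [h]
    · simp [hj]
  rw [this]
  exact Submodule.add_mem _ (Submodule.smul_mem _ _ (hs _ one_mem_eis))
    (Submodule.smul_mem _ _ (hs _ ζ_mem_eis))

theorem exists_sub_mem_Λ₁ (z : V) : ∃ w, ‖w‖ ≤ 2 ∧ z - w ∈ Λ₁ := by
  choose a b h using fun i => exists_add_mul_ζ (z i)
  refine ⟨fun i => Int.fract (a i) + Int.fract (b i) * ζ, ?_, mem_Λ₁.2 fun i =>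
    mem_eis.2 ⟨⌊a i⌋, ⌊b i⌋, ?_⟩⟩
  · rw [pi_norm_le_iff_of_nonneg (by norm_num)]
    intro i
    refine (norm_add_le _ _).trans ?_
    rw [norm_mul, ζ_norm, Complex.norm_real, Complex.norm_real, Real.norm_of_nonneg (Int.fract_nonneg _),
      Real.norm_of_nonneg (Int.fract_nonneg _)]
    linarith [Int.fract_lt_one (a i), Int.fract_lt_one (b i)]
  · rw [Pi.sub_apply, h i, Int.fract, Int.fract]
    push_cast; ring

/-- A diagonal action of `(ℤ/3)³` on a torus, without fixed points for the elements which have an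
eigenvalue one. -/
theorem exists_isAffineQuotient {Λ : Submodule ℤ V} [DiscreteTopology Λ] (h₁ : Λ₁ ≤ Λ)
    (hdz : ∀ e, ∀ l ∈ Λ, dz e * l ∈ Λ) {c : (Fin 3 → ZMod 3) → V}
    (hc : ∀ e e', dz e * c e' + c e - c (e + e') ∈ Λ)
    (hfree : ∀ e, e ≠ 0 → (∃ i, e i = 0) → ∀ z, affine (dz e) (c e) z - z ∉ Λ) :
    ∃ G, IsAffineQuotient ⟨Λ, G⟩ ∧ ∀ e, (⟨Λ, G⟩ : TorusGroup).Lifts (affine (dz e) (c e)) := by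
  let T : TorusGroup := ⟨Λ, ⊥⟩
  have hT : ∀ {z w}, T.torusProj z = T.torusProj w ↔ z - w ∈ Λ := T.torusProj_eq_iff
  have hdisc : DiscreteTopology T.Λ := ‹_›
  obtain ⟨act, hact⟩ : ∃ act : (Fin 3 → ZMod 3) → V ⧸ Λ → V ⧸ Λ,
      ∀ e z, act e (T.torusProj z) = T.torusProj (affine (dz e) (c e) z) := by
    refine ⟨fun e x => T.torusProj (affine (dz e) (c e) (Quotient.out x)), fun e z => ?_⟩
    have h1 : T.torusProj (Quotient.out (T.torusProj z)) = T.torusProj z := Quotient.out_eq _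
    refine hT.2 ?_
    convert hdz e _ (hT.1 h1) using 1
    simp only [affine]; ring
  have hadd : ∀ e e' x, act (e + e') x = act e (act e' x) := by
    intro e e' x
    obtain ⟨z, rfl⟩ := T.torusProj_surjective x
    rw [hact, hact, hact, hT, ← neg_mem_iff]
    convert hc e e' using 1
    simp only [affine, dz_add]; ring
  have hzero : ∀ x, act 0 x = x := by
    intro x
    obtain ⟨z, rfl⟩ := T.torusProj_surjective x
    have h0 : dz 0 = 1 := by funext i; simp [dz]
    rw [hact, hT]
    have := hc 0 0
    simp only [h0, affine, add_zero, one_mul, add_sub_cancel_left] at this ⊢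
    exact this
  let ρ : Multiplicative (Fin 3 → ZMod 3) →* Equiv.Perm (V ⧸ Λ) :=
    { toFun := fun e => ⟨act e.toAdd, act (-e.toAdd), fun x => by rw [← hadd, neg_add_cancel, hzero],
        fun x => by rw [← hadd, add_neg_cancel, hzero]⟩
      map_one' := Equiv.ext hzero
      map_mul' := fun e e' => Equiv.ext (hadd e.toAdd e'.toAdd) }
  have hρ : ∀ e z, ρ e (T.torusProj z) = T.torusProj (affine (dz e.toAdd) (c e.toAdd) z) :=
    fun e z => hact _ _
  have htrans : ∀ e, (∃ b, ∀ x, ρ e x = x + b) → e = 1 := by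
    rintro e ⟨b, hb⟩
    obtain ⟨b, rfl⟩ := T.torusProj_surjective b
    have h0 : dz 0 = 1 := by funext i; simp [dz]
    refine Multiplicative.toAdd.injective
      (dz_unique (A := T) (e' := 0) (c := c e.toAdd) (c' := b) fun z => ?_)
    rw [← hρ, hb, h0, ← torusProj_add, affine, one_mul]
  have hinj : Function.Injective ρ := by
    rw [injective_iff_map_eq_one]
    intro e he
    exact htrans e ⟨0, fun x => by rw [he, add_zero]; rfl⟩
  refine ⟨ρ.range, ⟨‹_›, ?_, ?_, ⟨(MonoidHom.ofInjective hinj).symm⟩, ?_, ?_⟩, fun e =>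
    ⟨ρ (Multiplicative.ofAdd e), ⟨_, rfl⟩, fun z => hρ _ z⟩⟩
  · exact eq_top_mono (Submodule.span_mono h₁) span_Λ₁
  · rintro _ ⟨e, rfl⟩
    refine ⟨diagAff (dz e.toAdd) (c e.toAdd) (dz_ne_zero _), fun z => ?_⟩
    rw [diagAff_apply]
    exact hρ e z
  · rintro _ ⟨e, rfl⟩ h
    rw [htrans e h, map_one]
  -- Without eigenvalue one, `z ↦ affine (dz e) (c e) z - z` is injective, and it maps a bounded set
  -- of representatives onto a bounded set, which contains finitely many lattice points.
  · have hfin : ∀ e : Fin 3 → ZMod 3, (∀ i, e i ≠ 0) →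
        {z | ‖z‖ ≤ 2 ∧ affine (dz e) (c e) z - z ∈ Λ}.Finite := by
      intro e he
      have hcl : IsClosed (Λ : Set V) := by
        have : IsClosed (Λ.toAddSubgroup : Set V) := AddSubgroup.isClosed_of_discrete
        exact this
      have hcont : Continuous fun z => affine (dz e) (c e) z - z := by unfold affine; fun_prop
      have hb : Bornology.IsBounded ((fun z => affine (dz e) (c e) z - z) '' Metric.closedBall 0 2) :=
        ((isCompact_closedBall _ _).image hcont).isBounded
      have h1 := Metric.finite_isBounded_inter_isClosed ⟨‹_›⟩ hb hcl
      refine (h1.preimage (f := fun z => affine (dz e) (c e) z - z) ?_).subset ?_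
      · intro z _ w _ h
        funext i
        have h2 := congrFun h i
        simp only [affine, Pi.sub_apply, Pi.add_apply, Pi.mul_apply] at h2
        have h3 : dz e i - 1 ≠ 0 := by
          rw [sub_ne_zero]
          intro h4
          exact he i (ζ_pow_val_injective (by simpa [dz] using h4))
        apply mul_left_cancel₀ h3
        linear_combination h2
      · rintro z ⟨hz, hz'⟩
        exact ⟨⟨z, by simpa using hz, rfl⟩, hz'⟩
    have hfin2 := Set.finite_iUnion fun e : {e : Fin 3 → ZMod 3 // ∀ i, e i ≠ 0} =>
      (hfin e.1 e.2).image T.torusProj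
    refine hfin2.subset ?_
    rintro x ⟨_, ⟨e, rfl⟩, he, hx⟩
    obtain ⟨z, rfl⟩ := T.torusProj_surjective x
    obtain ⟨w, hw, hzw⟩ := exists_sub_mem_Λ₁ z
    have h2 : T.torusProj z = T.torusProj w := hT.2 (h₁ hzw)
    rw [h2] at hx ⊢
    have h3 := (hρ e w).symm.trans hx
    rw [hT] at h3
    have h4 : ∀ i, e.toAdd i ≠ 0 := by
      intro i hi
      refine hfree e.toAdd ?_ ⟨i, hi⟩ w h3
      intro h5
      exact he (by rw [show e = 1 from h5, map_one])
    exact Set.mem_iUnion.2 ⟨⟨e.toAdd, h4⟩, w, ⟨hw, h3⟩, rfl⟩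

end TorusQuotient

end

noncomputable section

namespace TorusQuotient

open Topology TorusGroup

/-! ### The three groups -/

theorem tors_mem_Λ₂ {n m : Fin 3 → ZMod 3} : tors n m ∈ Λ₂ ↔ n = 0 ∧ m 0 = m 1 ∧ m 2 = 0 := by
  have hv : ∀ x : ZMod 3, tors 0 ![x, x, 0] = x.val • ![t, t, 0] := by
    intro x; funext i; fin_cases i <;> simp [tors]
  have hv2 : ![t, t, 0] ∈ Λ₂ := Submodule.mem_sup_right (Submodule.mem_span_singleton_self _)
  constructor
  · intro h
    obtain ⟨l, hl, v, hv', h⟩ := Submodule.mem_sup.1 h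
    obtain ⟨k, rfl⟩ := Submodule.mem_span_singleton.1 hv'
    have h1 := tors_intCast_sub_mem 0 ![k, k, 0]
    have h2 : (fun i => ((0 : Fin 3 → ℤ) i : ℂ) / 3 + (![k, k, 0] i : ℤ) * t) = k • ![t, t, 0] := by
      funext i; fin_cases i <;> simp
    have h3 : (fun i => ((![k, k, 0] i : ℤ) : ZMod 3)) = ![(k : ZMod 3), k, 0] := by
      funext i; fin_cases i <;> simp
    have h4 : (fun i => (((0 : Fin 3 → ℤ) i : ℤ) : ZMod 3)) = 0 := by funext; simp
    rw [h2, h3, h4] at h1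
    have h5 := Λ₁.add_mem hl h1
    rw [← add_sub_assoc, h, tors_sub_mem_iff le_rfl, tors_mem_Λ₁, sub_zero, sub_eq_zero] at h5
    obtain ⟨h6, rfl⟩ := h5
    exact ⟨h6, rfl, rfl⟩
  · rintro ⟨rfl, h1, h2⟩
    have : m = ![m 0, m 0, 0] := by funext i; fin_cases i <;> simp [h1, h2]
    rw [this, hv]
    exact Λ₂.nsmul_mem hv2 _

theorem Λ₁_le_Λ₂ : Λ₁ ≤ Λ₂ := le_sup_left

theorem one_sub_ζ_mul_mem_of_mem_Λ₂ {l : V} (hl : l ∈ Λ₂) (i : Fin 3) : (1 - ζ) * l i ∈ eis := by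
  obtain ⟨l, hl₁, v, hv', rfl⟩ := Submodule.mem_sup.1 hl
  obtain ⟨k, rfl⟩ := Submodule.mem_span_singleton.1 hv'
  have h1 : (1 - ζ) * l i ∈ eis := mul_mem_eis (sub_mem one_mem_eis ζ_mem_eis) (mem_Λ₁.1 hl₁ i)
  have h2 : (1 - ζ) * (k • ![t, t, 0]) i ∈ eis := by
    rw [Pi.smul_apply, mul_smul_comm]
    refine eis.smul_mem _ ?_
    have h3 : (1 - ζ) * t ∈ eis := by
      rw [one_sub_ζ_mul_t, pow_two]; exact neg_mem (mul_mem_eis ζ_mem_eis ζ_mem_eis)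
    fin_cases i
    · exact h3
    · exact h3
    · simp
  rw [Pi.add_apply, mul_add]
  exact add_mem h1 h2

theorem dz_mul_mem_Λ₂ (e : Fin 3 → ZMod 3) {l : V} (hl : l ∈ Λ₂) : dz e * l ∈ Λ₂ := by
  obtain ⟨m, h⟩ := exists_tors_of_mem (one_sub_ζ_mul_mem_of_mem_Λ₂ hl)
  have h1 : tors 0 m ∈ Λ₂ := by simpa using Λ₂.sub_mem hl (Λ₁_le_Λ₂ h)
  have h2 := dz_mul_tors_sub_mem e 0 m
  rw [mul_zero, sub_zero] at h2
  have h3 := Λ₂.add_mem (Λ₁_le_Λ₂ (dz_mul_mem_Λ₁ e h)) (Λ₂.add_mem (Λ₁_le_Λ₂ h2) h1)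
  convert h3 using 1
  ring

theorem norm_mul_sqrt_three {x : ℂ} (hx : x ∈ eis) (h : ‖x‖ < 1) : x = 0 := by
  obtain ⟨a, b, rfl⟩ := mem_eis.1 hx
  have h1 := normSq_add_mul_ζ a b
  have h2 : Complex.normSq ((a : ℝ) + (b : ℝ) * ζ : ℂ) < 1 := by
    rw [Complex.normSq_eq_norm_sq]
    push_cast
    nlinarith [norm_nonneg (a + b * ζ : ℂ)]
  rw [h1] at h2
  have h3 : a ^ 2 - a * b + b ^ 2 < 1 := by exact_mod_cast h2
  have h4 : b = 0 := by nlinarith [sq_nonneg (2 * a - b), sq_nonneg b, Int.emod_emod_of_dvd a (dvd_refl 2), sq_nonneg (b - 1), sq_nonneg (b + 1)]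
  have h5 : a = 0 := by subst h4; nlinarith
  simp [h4, h5]

/-- A vector of norm below `1 / 2` is carried by `1 - ζ` to Eisenstein integers of norm below one,
that is, to zero. -/
theorem discrete_of_one_sub_ζ_mul_mem {Λ : Submodule ℤ V}
    (h : ∀ l ∈ Λ, ∀ i, (1 - ζ) * l i ∈ eis) : DiscreteTopology Λ := by
  have h2 : ‖(1 - ζ : ℂ)‖ ≤ 2 := (norm_sub_le _ _).trans (by rw [ζ_norm]; norm_num)
  have h0 : (1 - ζ : ℂ) ≠ 0 := sub_ne_zero.2 ζ_ne_one.symm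
  refine DiscreteTopology.of_forall_le_norm (r := 1 / 2) (by norm_num) fun x hx => ?_
  by_contra! hlt
  refine hx (Subtype.ext (funext fun i => ?_))
  have := norm_mul_sqrt_three (h x x.2 i) (by
    rw [norm_mul]
    have h3 : ‖(x : V) i‖ ≤ ‖(x : V)‖ := norm_le_pi_norm _ i
    have h4 : ‖(x : V)‖ < 1 / 2 := hlt
    nlinarith [norm_nonneg ((x : V) i)])
  exact (mul_eq_zero.1 this).resolve_left h0

instance : DiscreteTopology Λ₂ :=
  discrete_of_one_sub_ζ_mul_mem fun _ hl => one_sub_ζ_mul_mem_of_mem_Λ₂ hl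

instance : DiscreteTopology Λ₁ :=
  discrete_of_one_sub_ζ_mul_mem fun _ hl => one_sub_ζ_mul_mem_of_mem_Λ₂ (Λ₁_le_Λ₂ hl)

/-- A diagonal action of `(ℤ/3)³` with torsion translation parts. -/
theorem exists_isAffineQuotient_tors {Λ : Submodule ℤ V} [DiscreteTopology Λ] (h₁ : Λ₁ ≤ Λ)
    (hθ : ∀ l ∈ Λ, ∀ i, (1 - ζ) * l i ∈ eis)
    (hdz : ∀ e, ∀ l ∈ Λ, dz e * l ∈ Λ) {n m : (Fin 3 → ZMod 3) → Fin 3 → ZMod 3}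
    (hc : ∀ e e', tors (n e' + n e - n (e + e')) (m e' - e * n e' + m e - m (e + e')) ∈ Λ)
    (hfree : ∀ e, e ≠ 0 → (∃ i, e i = 0) → ∀ κ, tors 0 κ ∈ Λ →
      ∃ i, e i = 0 ∧ ¬(n e i = 0 ∧ κ i = m e i)) :
    ∃ G, IsAffineQuotient ⟨Λ, G⟩ ∧ ∀ e, (⟨Λ, G⟩ : TorusGroup).LiftsTors e (n e) (m e) := by
  refine exists_isAffineQuotient h₁ hdz (c := fun e => tors (n e) (m e)) ?_ ?_
  · intro e e'
    have h2 := h₁ (dz_mul_tors_sub_mem e (n e') (m e'))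
    have h3 := h₁ (tors_add_sub_mem (n e') (m e' - e * n e') (n e) (m e))
    have h4 := (tors_sub_mem_iff h₁ _ _ _ _).2 (hc e e')
    convert Λ.add_mem h2 (Λ.add_mem h3 h4) using 1
    ring
  · intro e he hi z hz
    obtain ⟨κ, hκ⟩ := exists_tors_of_mem (hθ _ hz)
    have hκ' : tors 0 κ ∈ Λ := by simpa using Λ.sub_mem hz (h₁ hκ)
    obtain ⟨i, hi, hne⟩ := hfree e he hi κ hκ'
    refine hne ?_
    have h5 := mem_Λ₁.1 (tors_add_sub_mem (n e) (m e) 0 (-κ)) i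
    have h6 := mem_Λ₁.1 (tors_add_sub_mem 0 κ 0 (-κ)) i
    have h7 := mem_Λ₁.1 hκ i
    have h8 : tors (n e + 0) (m e + -κ) i ∈ eis := by
      have h9 : tors (0 + 0) (κ + -κ) = 0 := by funext i; simp [tors]
      rw [h9] at h6
      have h10 : dz e i = 1 := by simp [dz, hi]
      convert sub_mem (add_mem h7 h6) h5 using 1
      simp only [Pi.sub_apply, Pi.add_apply, affine, Pi.mul_apply, h10, Pi.zero_apply]
      ring
    rw [tors_apply_mem_eis] at h8
    simpa [← sub_eq_add_neg, sub_eq_zero, eq_comm] using h8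

theorem lifts_generators_of_liftsTors {A : TorusGroup} {n₁ m₁ n₂ m₂ : Fin 3 → ZMod 3} {a b : V}
    (h : A.LiftsTors ![0, 2, 1] n₁ m₁) (ha : a - tors n₁ m₁ ∈ A.Λ)
    (g : A.LiftsTors ![1, 0, 0] n₂ m₂) (hb : b - tors n₂ m₂ ∈ A.Λ) :
    A.Lifts (affine ![1, ζ ^ 2, ζ] a) ∧ A.Lifts (affine ![ζ, 1, 1] b) := by
  rw [← dz_generator.1, ← dz_generator.2.1]
  exact ⟨h.affine_congr ha, g.affine_congr hb⟩

theorem liftsTors_one_iff {A : TorusGroup} :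
    A.LiftsTors 1 0 0 ↔ A.Lifts (affine ![ζ, ζ, ζ] 0) := by
  have h : tors 0 0 = 0 := by funext i; simp [tors]
  rw [LiftsTors, h, dz_generator.2.2]

theorem forall_vec {P : (Fin 3 → ZMod 3) → Prop} : (∀ e, P e) ↔ ∀ x y z, P ![x, y, z] := by
  refine ⟨fun h x y z => h _, fun h e => ?_⟩
  convert h (e 0) (e 1) (e 2)
  funext i; fin_cases i <;> rfl

theorem translations_Y9 :
    ![-t, -t, t] - tors 0 ![-1, -1, 1] ∈ Λ₁ ∧ ![-t, 0, -t] - tors 0 ![-1, 0, -1] ∈ Λ₁ := by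
  have h1 := tors_intCast_sub_mem 0 ![-1, -1, 1]
  have h2 := tors_intCast_sub_mem 0 ![-1, 0, -1]
  constructor
  · convert h1 using 2
    · funext i; fin_cases i <;> simp
    · congr 1
      funext i; fin_cases i <;> simp
  · convert h2 using 2
    · funext i; fin_cases i <;> simp
    · congr 1
      funext i; fin_cases i <;> simp

theorem translations_Y10 :
    ![-ζ ^ 2 / 3, 2 / 3, t] - tors ![2, 2, 0] ![-1, 0, 1] ∈ Λ₁ ∧
      ![-ζ ^ 2 / 3, 2 * ζ / 3, 0] - tors ![2, 2, 0] ![-1, 1, 0] ∈ Λ₁ := by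
  have h1 := tors_intCast_sub_mem ![2, 2, 0] ![-1, 0, 1]
  have h2 := tors_intCast_sub_mem ![2, 2, 0] ![-1, 1, 0]
  have e1 : (fun i => ((![2, 2, 0] i : ℤ) : ZMod 3)) = ![2, 2, 0] := by decide
  have e2 : (fun i => ((![-1, 0, 1] i : ℤ) : ZMod 3)) = ![-1, 0, 1] := by decide
  have e3 : (fun i => ((![-1, 1, 0] i : ℤ) : ZMod 3)) = ![-1, 1, 0] := by decide
  rw [e1, e2] at h1
  rw [e1, e3] at h2
  have k1 : ![-ζ ^ 2 / 3, 2 / 3, t] - (fun i => ((![2, 2, 0] i : ℤ) : ℂ) / 3 + (![-1, 0, 1] i : ℤ) * t) ∈ Λ₁ := by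
    rw [mem_Λ₁]
    intro i
    fin_cases i
    · refine mem_eis.2 ⟨0, 1, ?_⟩
      simp [t]; linear_combination -ζ_sq / 3
    · simp
    · simp
  have k2 : ![-ζ ^ 2 / 3, 2 * ζ / 3, 0] - (fun i => ((![2, 2, 0] i : ℤ) : ℂ) / 3 + (![-1, 1, 0] i : ℤ) * t) ∈ Λ₁ := by
    rw [mem_Λ₁]
    intro i
    fin_cases i
    · refine mem_eis.2 ⟨0, 1, ?_⟩
      simp [t]; linear_combination -ζ_sq / 3
    · refine mem_eis.2 ⟨-1, 0, ?_⟩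
      simp [t]; ring
    · simp
  constructor
  · convert Λ₁.add_mem k1 h1 using 1; ring
  · convert Λ₁.add_mem k2 h2 using 1; ring

theorem translations_Y10' :
    ![ζ / 3, ζ ^ 2 / 3, t] - tors ![1, 1, 0] ![-1, 1, 1] ∈ Λ₁ ∧
      ![ζ ^ 2 / 3, ζ ^ 2 / 3, 0] - tors ![1, 1, 0] ![1, 1, 0] ∈ Λ₁ := by
  have h1 := tors_intCast_sub_mem ![1, 1, 0] ![-1, 1, 1]
  have h2 := tors_intCast_sub_mem ![1, 1, 0] ![1, 1, 0]
  have e1 : (fun i => ((![1, 1, 0] i : ℤ) : ZMod 3)) = ![1, 1, 0] := by decide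
  have e2 : (fun i => ((![-1, 1, 1] i : ℤ) : ZMod 3)) = ![-1, 1, 1] := by decide
  rw [e1, e2] at h1
  rw [e1] at h2
  have k1 : ![ζ / 3, ζ ^ 2 / 3, t] - (fun i => ((![1, 1, 0] i : ℤ) : ℂ) / 3 + (![-1, 1, 1] i : ℤ) * t) ∈ Λ₁ := by
    rw [mem_Λ₁]
    intro i
    fin_cases i
    · refine mem_eis.2 ⟨0, 1, ?_⟩
      simp [t]; ring
    · refine mem_eis.2 ⟨-1, -1, ?_⟩
      simp [t]; linear_combination ζ_sq / 3
    · simp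
  have k2 : ![ζ ^ 2 / 3, ζ ^ 2 / 3, 0] - (fun i => ((![1, 1, 0] i : ℤ) : ℂ) / 3 + (![1, 1, 0] i : ℤ) * t) ∈ Λ₁ := by
    rw [mem_Λ₁]
    intro i
    fin_cases i
    · refine mem_eis.2 ⟨-1, -1, ?_⟩
      simp [t]; linear_combination ζ_sq / 3
    · refine mem_eis.2 ⟨-1, -1, ?_⟩
      simp [t]; linear_combination ζ_sq / 3
    · simp
  constructor
  · convert Λ₁.add_mem k1 h1 using 1; ring
  · convert Λ₁.add_mem k2 h2 using 1; ring

/-- The translation part is extended linearly in `e` from the given values on `h`, `g`, `k`. With `n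
= 0` there is no twist, so linearity is the cocycle condition. -/
theorem isAffineQuotient_Y9 : IsAffineQuotient Y9 ∧
    ∀ e, Y9.LiftsTors e 0 ![e 1 - e 0, e 2 - e 1, e 2 - e 0] := by
  obtain ⟨G, hG, hl⟩ := exists_isAffineQuotient_tors (Λ := Λ₁) le_rfl
    (fun _ hl => one_sub_ζ_mul_mem_of_mem_Λ₂ (Λ₁_le_Λ₂ hl)) (fun e _ => dz_mul_mem_Λ₁ e)
    (n := 0) (m := fun e => ![e 1 - e 0, e 2 - e 1, e 2 - e 0]) (by
      intro e e'
      rw [tors_mem_Λ₁]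
      refine ⟨by simp, ?_⟩
      funext i
      fin_cases i <;> simp <;> ring) (by
      intro e he hi κ hκ
      obtain rfl := (tors_mem_Λ₁.1 hκ).2
      revert e
      rw [forall_vec]
      decide)
  have hl1 : (⟨Λ₁, G⟩ : TorusGroup).LiftsTors 1 0 0 := by
    convert hl 1 using 1 <;> · funext i; fin_cases i <;> simp
  have hlift := lifts_generators_of_liftsTors (hl ![0, 2, 1]) translations_Y9.1 (hl ![1, 0, 0]) translations_Y9.2
  have h1 : (⟨Λ₁, G⟩ : TorusGroup) = Y9 := hG.generated_eq hlift.1 hlift.2 (liftsTors_one_iff.1 hl1)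
  rw [h1] at hG
  refine ⟨hG, fun e => ?_⟩
  have := hl e
  rwa [h1] at this

/-- The translation part cannot be linear in `e`, because `n` produces the twist `- e * n e'`.
Modulo `(1,1,0)` this twist is a bilinear form in `e 0 - e 1`, and the polarisation of the quadratic
term cancels it. The sign `s` is `1` for `Y10` and `-1` for `Y10'`. -/
theorem exists_isAffineQuotient_Λ₂ (s : ZMod 3) (hs : s ≠ 0) : ∃ G, IsAffineQuotient ⟨Λ₂, G⟩ ∧
    ∀ e, (⟨Λ₂, G⟩ : TorusGroup).LiftsTors e ![s * (e 1 - e 0), s * (e 1 - e 0), 0]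
      ![0, s * (e 0 - e 1) ^ 2 + e 0 + e 1 + e 2, e 1 - e 2] :=
  exists_isAffineQuotient_tors Λ₁_le_Λ₂ (fun _ => one_sub_ζ_mul_mem_of_mem_Λ₂)
    (fun e _ => dz_mul_mem_Λ₂ e) (n := fun e => ![s * (e 1 - e 0), s * (e 1 - e 0), 0])
    (m := fun e => ![0, s * (e 0 - e 1) ^ 2 + e 0 + e 1 + e 2, e 1 - e 2]) (by
      intro e e'
      rw [tors_mem_Λ₂]
      have h3 : (3 : ZMod 3) = 0 := rfl
      refine ⟨?_, ?_, ?_⟩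
      · funext i
        fin_cases i <;> simp <;> ring
      · simp only [Pi.add_apply, Pi.sub_apply, Pi.mul_apply]
        simp
        linear_combination (s * (e 0 - e 1) * (e' 0 - e' 1)) * h3
      · simp only [Pi.add_apply, Pi.sub_apply, Pi.mul_apply]
        simp
        ring) (by
      intro e he hi κ hκ
      obtain ⟨-, h1, h2⟩ := tors_mem_Λ₂.1 hκ
      have : κ = ![κ 0, κ 0, 0] := by funext i; fin_cases i <;> simp [h1, h2]
      rw [this]
      generalize κ 0 = x
      revert e
      rw [forall_vec]
      revert s x
      decide)

theorem isAffineQuotient_Y10 : IsAffineQuotient Y10 ∧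
    ∀ e, Y10.LiftsTors e ![e 1 - e 0, e 1 - e 0, 0]
      ![0, (e 0 - e 1) ^ 2 + e 0 + e 1 + e 2, e 1 - e 2] := by
  obtain ⟨G, hG, hl⟩ := exists_isAffineQuotient_Λ₂ 1 one_ne_zero
  simp only [one_mul] at hl
  have hh : (⟨Λ₂, G⟩ : TorusGroup).LiftsTors ![0, 2, 1] ![2, 2, 0] ![-1, 0, 1] :=
    (hl ![0, 2, 1]).congr Λ₁_le_Λ₂ (tors_mem_Λ₂.2 (by decide))
  have hg : (⟨Λ₂, G⟩ : TorusGroup).LiftsTors ![1, 0, 0] ![2, 2, 0] ![-1, 1, 0] :=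
    (hl ![1, 0, 0]).congr Λ₁_le_Λ₂ (tors_mem_Λ₂.2 (by decide))
  have hlift := lifts_generators_of_liftsTors hh (Λ₁_le_Λ₂ translations_Y10.1) hg
    (Λ₁_le_Λ₂ translations_Y10.2)
  have hl1 : (⟨Λ₂, G⟩ : TorusGroup).LiftsTors 1 0 0 := by
    convert hl 1 using 1 <;> decide
  have h1 : (⟨Λ₂, G⟩ : TorusGroup) = Y10 :=
    hG.generated_eq hlift.1 hlift.2 (liftsTors_one_iff.1 hl1)
  rw [h1] at hG
  refine ⟨hG, fun e => ?_⟩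
  have := hl e
  rwa [h1] at this

theorem isAffineQuotient_Y10' : IsAffineQuotient Y10' ∧
    ∀ e, Y10'.LiftsTors e ![e 0 - e 1, e 0 - e 1, 0]
      ![0, -(e 0 - e 1) ^ 2 + e 0 + e 1 + e 2, e 1 - e 2] := by
  obtain ⟨G, hG, hl⟩ := exists_isAffineQuotient_Λ₂ (-1) (by decide)
  simp only [neg_mul, one_mul, neg_sub] at hl
  have hh : (⟨Λ₂, G⟩ : TorusGroup).LiftsTors ![0, 2, 1] ![1, 1, 0] ![-1, 1, 1] :=
    (hl ![0, 2, 1]).congr Λ₁_le_Λ₂ (tors_mem_Λ₂.2 (by decide))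
  have hg : (⟨Λ₂, G⟩ : TorusGroup).LiftsTors ![1, 0, 0] ![1, 1, 0] ![1, 1, 0] :=
    (hl ![1, 0, 0]).congr Λ₁_le_Λ₂ (tors_mem_Λ₂.2 (by decide))
  have hlift := lifts_generators_of_liftsTors hh (Λ₁_le_Λ₂ translations_Y10'.1) hg
    (Λ₁_le_Λ₂ translations_Y10'.2)
  have hl1 : (⟨Λ₂, G⟩ : TorusGroup).LiftsTors 1 0 0 := by
    convert hl 1 using 1 <;> decide
  have h1 : (⟨Λ₂, G⟩ : TorusGroup) = Y10' :=
    hG.generated_eq hlift.1 hlift.2 (liftsTors_one_iff.1 hl1)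
  rw [h1] at hG
  refine ⟨hG, fun e => ?_⟩
  have := hl e
  rwa [h1] at this

/-- Every affine quotient is biholomorphic to one of the three examples. -/
theorem IsAffineQuotient.classification {A : TorusGroup} (hA : IsAffineQuotient A) :
    Biholomorphic A Y9 ∨ Biholomorphic A Y10 ∨ Biholomorphic A Y10' := by
  obtain ⟨B, hAB, hB⟩ := hA.exists_isNormal
  -- The generator `h` arises as the second reflection applied twice, composed with the third.
  have hgen : (Pi.single 1 1 + (Pi.single 1 1 + Pi.single 2 1) : Fin 3 → ZMod 3) = ![0, 2, 1] := by
    decide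
  have hgen0 : (Pi.single 0 1 : Fin 3 → ZMod 3) = ![1, 0, 0] := by decide
  by_cases hK : ∃ κ, κ ≠ 0 ∧ tors 0 κ ∈ B.Λ
  · obtain ⟨C, hBC, hC, hKC⟩ := hB.exists_standard_lattice hK
    obtain ⟨⟨L, G⟩, hCD, hD, hΛ, h⟩ := hC.exists_std_of_lattice hKC
    obtain rfl : L = Λ₂ := hΛ
    refine .inr ?_
    rcases h with ⟨h0, h1, h2⟩ | ⟨h0, h1, h2⟩
    · refine .inl (hAB.trans (hBC.trans ?_))
      have hh := h1.add hD.le (h1.add hD.le h2)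
      rw [hgen, show (![1, 1, 0] + (![1, 1, 0] + 0) : Fin 3 → ZMod 3) = ![2, 2, 0] by decide] at hh
      rw [hgen0] at h0
      have hh : (⟨Λ₂, G⟩ : TorusGroup).LiftsTors ![0, 2, 1] ![2, 2, 0] ![-1, 0, 1] :=
        hh.congr Λ₁_le_Λ₂ (tors_mem_Λ₂.2 (by decide))
      have hg : (⟨Λ₂, G⟩ : TorusGroup).LiftsTors ![1, 0, 0] ![2, 2, 0] ![-1, 1, 0] :=
        h0.congr Λ₁_le_Λ₂ (tors_mem_Λ₂.2 (by decide))
      have hlift := lifts_generators_of_liftsTors hh (Λ₁_le_Λ₂ translations_Y10.1) hg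
        (Λ₁_le_Λ₂ translations_Y10.2)
      have hY : (⟨Λ₂, G⟩ : TorusGroup) = Y10 := hD.isAffineQuotient.generated_eq hlift.1 hlift.2
        (liftsTors_one_iff.1 hD.liftsTors_one)
      rwa [hY] at hCD
    · refine .inr (hAB.trans (hBC.trans ?_))
      have hh := h1.add hD.le (h1.add hD.le h2)
      rw [hgen, show (![-1, -1, 0] + (![-1, -1, 0] + 0) : Fin 3 → ZMod 3) = ![1, 1, 0] by decide] at hh
      rw [hgen0] at h0
      have hh : (⟨Λ₂, G⟩ : TorusGroup).LiftsTors ![0, 2, 1] ![1, 1, 0] ![-1, 1, 1] :=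
        hh.congr Λ₁_le_Λ₂ (tors_mem_Λ₂.2 (by decide))
      have hg : (⟨Λ₂, G⟩ : TorusGroup).LiftsTors ![1, 0, 0] ![1, 1, 0] ![1, 1, 0] :=
        h0.congr Λ₁_le_Λ₂ (tors_mem_Λ₂.2 (by decide))
      have hlift := lifts_generators_of_liftsTors hh (Λ₁_le_Λ₂ translations_Y10'.1) hg
        (Λ₁_le_Λ₂ translations_Y10'.2)
      have hY : (⟨Λ₂, G⟩ : TorusGroup) = Y10' := hD.isAffineQuotient.generated_eq hlift.1 hlift.2
        (liftsTors_one_iff.1 hD.liftsTors_one)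
      rwa [hY] at hCD
  · have hK' : ∀ κ, tors 0 κ ∈ B.Λ → κ = 0 := by
      intro κ hκ
      by_contra h0
      exact hK ⟨κ, h0, hκ⟩
    obtain ⟨⟨L, G⟩, hBC, hC, hΛ, h0, h1, h2⟩ := hB.exists_std_of_forall hK'
    obtain rfl : L = Λ₁ := hΛ
    refine .inl (hAB.trans ?_)
    have hh := h1.add hC.le (h1.add hC.le h2)
    rw [hgen] at hh
    rw [hgen0] at h0
    have hh : (⟨Λ₁, G⟩ : TorusGroup).LiftsTors ![0, 2, 1] 0 ![-1, -1, 1] :=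
      hh.congr le_rfl (tors_mem_Λ₁.2 (by decide))
    have hlift := lifts_generators_of_liftsTors hh translations_Y9.1 h0 translations_Y9.2
    have hY : (⟨Λ₁, G⟩ : TorusGroup) = Y9 := hC.isAffineQuotient.generated_eq hlift.1 hlift.2
      (liftsTors_one_iff.1 hC.liftsTors_one)
    rwa [hY] at hBC

end TorusQuotient

end

/-! ### Fourier series of smooth functions on a real torus -/

noncomputable section

namespace TorusFourier

open MeasureTheory UnitAddTorus Set
open scoped Real Topology

variable {d : Type} [Fintype d]

/-- The linear form `2π ∑ n i x i`. -/
def lin (n : d → ℤ) : (d → ℝ) →L[ℝ] ℝ := ∑ i, (2 * π * n i) • ContinuousLinearMap.proj i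

theorem lin_apply (n : d → ℤ) (x : d → ℝ) : lin n x = ∑ i, 2 * π * n i * x i := by
  simp [lin]

/-- The characters of the torus `ℝ^d / ℤ^d`. -/
def chi (n : d → ℤ) (x : d → ℝ) : ℂ := Complex.exp (lin n x * Complex.I)

theorem mFourier_eq_chi (n : d → ℤ) (x : d → ℝ) :
    mFourier n (fun i => (x i : UnitAddCircle)) = chi n x := by
  simp only [mFourier, ContinuousMap.coe_mk, fourier_coe_apply, chi, lin_apply, ← Complex.exp_sum]
  congr 1
  push_cast
  rw [Finset.sum_mul]
  exact Finset.sum_congr rfl fun i _ => by simp only [div_one]; ring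

theorem norm_chi (n : d → ℤ) (x : d → ℝ) : ‖chi n x‖ = 1 := Complex.norm_exp_ofReal_mul_I _

theorem chi_add (n : d → ℤ) (x y : d → ℝ) : chi n (x + y) = chi n x * chi n y := by
  rw [chi, chi, chi, map_add, ← Complex.exp_add]; push_cast; ring_nf

theorem chi_neg (n : d → ℤ) (x : d → ℝ) : chi (-n) x = (chi n x)⁻¹ := by
  rw [chi, chi, ← Complex.exp_neg, lin_apply, lin_apply]
  congr 1; push_cast; rw [← neg_mul, ← Finset.sum_neg_distrib]
  congr 1; refine Finset.sum_congr rfl fun i _ => ?_; simp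

theorem chi_ne_zero (n : d → ℤ) (x : d → ℝ) : chi n x ≠ 0 := Complex.exp_ne_zero _

theorem chi_int (n m : d → ℤ) : chi n (fun i => m i) = 1 := by
  rw [chi, Complex.exp_eq_one_iff]
  refine ⟨∑ i, n i * m i, ?_⟩
  rw [lin_apply]; push_cast
  rw [Finset.sum_mul, Finset.sum_mul]
  exact Finset.sum_congr rfl fun i _ => by ring

theorem hasFDerivAt_chi (n : d → ℤ) (x : d → ℝ) :
    HasFDerivAt (chi n) ((Complex.I * chi n x) • (Complex.ofRealCLM.comp (lin n))) x := by
  have h := ((Complex.ofRealCLM.comp (lin n)).hasFDerivAt (x := x)).mul_const Complex.I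
  refine h.cexp.congr_fderiv (ContinuousLinearMap.ext fun w => ?_)
  simp only [_root_.smul_apply, ContinuousLinearMap.comp_apply, smul_eq_mul, chi,
    Complex.ofRealCLM_apply]
  ring

theorem continuous_chi (n : d → ℤ) : Continuous (chi n) := by
  unfold chi; fun_prop

/-- The unit box with corner `a`. -/
def box (a : d → ℝ) : Set (d → ℝ) := {x | ∀ i, x i ∈ Ioc (a i) (a i + 1)}

/-- The Fourier coefficients of a periodic function. -/
def coeff (f : (d → ℝ) → ℂ) (n : d → ℤ) : ℂ := ∫ x in box 0, chi (-n) x * f x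

/-- Invariance under `ℤ^d`. -/
def IsPeriodic (f : (d → ℝ) → ℂ) : Prop := ∀ (m : d → ℤ) x, f (x + fun i => (m i : ℝ)) = f x

section

variable {f : (d → ℝ) → ℂ} (hp : IsPeriodic f)
include hp

omit [Fintype d] in
theorem IsPeriodic.exists_descent (hf : Continuous f) :
    ∃ F : C(UnitAddTorus d, ℂ), ∀ x : d → ℝ, F (fun i => (x i : UnitAddCircle)) = f x := by
  have hq : IsOpenQuotientMap (fun (x : d → ℝ) i => (x i : UnitAddCircle)) :=
    IsOpenQuotientMap.piMap fun _ => QuotientAddGroup.isOpenQuotientMap_mk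
  have hfac : ∀ x y : d → ℝ, (fun i => (x i : UnitAddCircle)) = (fun i => (y i : UnitAddCircle)) →
      f x = f y := by
    intro x y h
    have h1 : ∀ i, ∃ m : ℤ, x i = y i + m := by
      intro i
      have h2 : ((x i : ℝ) : UnitAddCircle) = y i := congrFun h i
      rw [QuotientAddGroup.eq, AddSubgroup.mem_zmultiples_iff] at h2
      obtain ⟨k, hk⟩ := h2
      refine ⟨-k, ?_⟩
      push_cast
      simp at hk
      linarith
    choose m hm using h1
    rw [show x = y + fun i => (m i : ℝ) from funext hm, hp]
  let q : C(d → ℝ, UnitAddTorus d) := ⟨_, hq.continuous⟩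
  have hq' : Topology.IsQuotientMap q := hq.isQuotientMap
  refine ⟨hq'.lift ⟨f, hf⟩ fun x y h => hfac x y h, fun x => ?_⟩
  exact congrArg (fun g : C(d → ℝ, ℂ) => g x) (hq'.lift_comp ⟨f, hf⟩ fun x y h => hfac x y h)

omit [Fintype d] in
theorem IsPeriodic.exists_bound (hf : Continuous f) : ∃ C, ∀ x, ‖f x‖ ≤ C := by
  obtain ⟨F, hF⟩ := hp.exists_descent hf
  exact ⟨‖F‖, fun x => hF x ▸ F.norm_coe_le_norm _⟩

omit hp in
theorem mFourierCoeff_eq {F : C(UnitAddTorus d, ℂ)}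
    (hF : ∀ x : d → ℝ, F (fun i => (x i : UnitAddCircle)) = f x) (n : d → ℤ) (a : d → ℝ) :
    mFourierCoeff F n = ∫ x in box a, chi (-n) x * f x := by
  rw [mFourierCoeff_eq_integral F n a]
  simp only [hF, mFourier_eq_chi, smul_eq_mul, box]

theorem IsPeriodic.coeff_eq (hf : Continuous f) (n : d → ℤ) (a : d → ℝ) :
    coeff f n = ∫ x in box a, chi (-n) x * f x := by
  obtain ⟨F, hF⟩ := hp.exists_descent hf
  rw [coeff, ← mFourierCoeff_eq hF, ← mFourierCoeff_eq hF]

theorem IsPeriodic.coeff_translate (hf : Continuous f) (n : d → ℤ) (w : d → ℝ) :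
    coeff (fun x => f (x + w)) n = chi n w * coeff f n := by
  rw [hp.coeff_eq hf n w, coeff, ← integral_const_mul]
  have h := (measurePreserving_add_right (volume : Measure (d → ℝ)) w).setIntegral_preimage_emb
    (MeasurableEquiv.addRight w).measurableEmbedding (fun x => chi n w * (chi (-n) x * f x)) (box w)
  rw [← h]
  have hbox : (fun x => x + w) ⁻¹' box w = box (0 : d → ℝ) := by
    ext x
    simp only [box, mem_preimage, mem_ofPred_eq, Pi.add_apply, mem_Ioc, Pi.zero_apply]
    refine forall_congr' fun i => ?_
    constructor <;> rintro ⟨h1, h2⟩ <;> constructor <;> linarith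
  rw [hbox]
  congr 1
  funext x
  rw [chi_add (-n), chi_neg n w]
  field_simp [chi_ne_zero]

end

theorem volume_box (a : d → ℝ) : volume (box a) = 1 := by
  have : box a = Set.pi univ fun i => Ioc (a i) (a i + 1) := by
    ext; simp [box]
  rw [this, Real.volume_pi_Ioc]
  simp

instance (a : d → ℝ) : IsProbabilityMeasure (volume.restrict (box a)) :=
  ⟨by rw [Measure.restrict_apply_univ, volume_box]⟩

theorem norm_coeff_le {f : (d → ℝ) → ℂ} {C : ℝ} (hC : ∀ x, ‖f x‖ ≤ C) (n : d → ℤ) :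
    ‖coeff f n‖ ≤ C := by
  refine (norm_integral_le_of_norm_le_const (μ := volume.restrict (box 0)) (C := C)
    (.of_forall fun x => ?_)).trans ?_
  · rw [norm_mul, norm_chi, one_mul]; exact hC x
  · simp

theorem IsPeriodic.fderiv {f : (d → ℝ) → ℂ} (hp : IsPeriodic f) (w : d → ℝ) :
    IsPeriodic fun x => fderiv ℝ f x w := by
  intro m x
  have h : (fun y => f (y + fun i => (m i : ℝ))) = f := funext (hp m)
  have h2 := fderiv_comp_add_right (𝕜 := ℝ) (f := f) (x := x) (fun i => (m i : ℝ))
  rw [h] at h2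
  exact congrArg (fun L => L w) h2.symm

/-- Instead of integrating by parts, one differentiates at `s = 0` the identity `coeff_translate`
for the translation by `s • w`. -/
theorem coeff_fderiv {f : (d → ℝ) → ℂ} (hp : IsPeriodic f) (hf : ContDiff ℝ 1 f) (n : d → ℤ)
    (w : d → ℝ) : coeff (fun x => fderiv ℝ f x w) n = Complex.I * lin n w * coeff f n := by
  have hc : Continuous fun x => fderiv ℝ f x w := (hf.continuous_fderiv one_ne_zero).clm_apply continuous_const
  obtain ⟨C, hC⟩ := (hp.fderiv w).exists_bound hc
  obtain ⟨C₀, hC₀⟩ := hp.exists_bound hf.continuous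
  have h := hasDerivAt_integral_of_dominated_loc_of_deriv_le (μ := volume.restrict (box (0 : d → ℝ)))
    (F := fun (s : ℝ) x => chi (-n) x * f (x + s • w)) (x₀ := 0) (s := univ)
    (F' := fun (s : ℝ) x => chi (-n) x * fderiv ℝ f (x + s • w) w) (bound := fun _ => C)
    Filter.univ_mem ?_ ?_ ?_ ?_ (integrable_const _) ?_
  · have h1 : ∀ s : ℝ, ∫ x in box 0, chi (-n) x * f (x + s • w) = chi n (s • w) * coeff f n :=
      fun s => hp.coeff_translate hf.continuous n (s • w)
    have h2 := h.2
    have h6 : ∫ x in box 0, chi (-n) x * _root_.fderiv ℝ f (x + (0 : ℝ) • w) w =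
        coeff (fun x => _root_.fderiv ℝ f x w) n := by simp only [zero_smul, add_zero]; rfl
    rw [h6, funext h1] at h2
    have h3 : HasDerivAt (fun s : ℝ => chi n (s • w) * coeff f n)
        (Complex.I * lin n w * coeff f n) 0 := by
      have h4 : HasDerivAt (fun s : ℝ => chi n (s • w) * coeff f n) _ 0 := ((hasFDerivAt_chi n ((0 : ℝ) • w)).comp_hasDerivAt (0 : ℝ)
        ((hasDerivAt_id (0 : ℝ)).smul_const w)).mul_const (coeff f n)
      refine h4.congr_deriv ?_
      simp [chi]
    exact h2.unique h3
  · refine .of_forall fun s => Continuous.aestronglyMeasurable ?_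
    exact (continuous_chi _).mul (hf.continuous.comp (by fun_prop))
  · refine Integrable.of_bound (C := C₀) (Continuous.aestronglyMeasurable ?_) (.of_forall fun x => ?_)
    · exact (continuous_chi _).mul (hf.continuous.comp (by fun_prop))
    · rw [norm_mul, norm_chi, one_mul]; exact hC₀ _
  · refine Continuous.aestronglyMeasurable ?_
    exact (continuous_chi _).mul (hc.comp (g := fun x => fderiv ℝ f x w) (by fun_prop))
  · refine .of_forall fun x s _ => ?_
    rw [norm_mul, norm_chi, one_mul]; exact hC _
  · refine .of_forall fun x s _ => ?_
    refine HasDerivAt.const_mul _ ?_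
    have h5 : HasDerivAt (fun s : ℝ => f (x + s • w)) _ s := (hf.differentiable one_ne_zero (x + s • w)).hasFDerivAt.comp_hasDerivAt s
      (((hasDerivAt_id s).smul_const w).const_add x)
    exact h5.congr_deriv (by simp)

/-- Rapidly decreasing families. -/
def IsRapid (b : (d → ℤ) → ℂ) : Prop := ∀ k : ℕ, ∃ C, ∀ n, ‖n‖ ^ k * ‖b n‖ ≤ C

theorem norm_le_sum (n : d → ℤ) : ‖n‖ ≤ ∑ i, ‖n i‖ :=
  (pi_norm_le_iff_of_nonneg (Finset.sum_nonneg fun _ _ => norm_nonneg _)).2 fun i =>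
    Finset.single_le_sum (f := fun i => ‖n i‖) (fun _ _ => norm_nonneg _) (Finset.mem_univ i)

/-- Each factor `‖n‖ ≤ ∑ ‖n i‖` is traded for a partial derivative, whose coefficient carries the
factor `2π n i`. -/
theorem isRapid_coeff {f : (d → ℝ) → ℂ} (hp : IsPeriodic f) (hf : ContDiff ℝ (⊤ : ℕ∞) f) :
    IsRapid (coeff f) := by
  classical
  intro k
  induction k generalizing f with
  | zero =>
    obtain ⟨C, hC⟩ := hp.exists_bound hf.continuous
    exact ⟨C, fun n => by simpa using norm_coeff_le hC n⟩
  | succ k ih =>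
    have h1 : ∀ i : d, ∃ C, ∀ n, ‖n‖ ^ k * ‖coeff (fun x => fderiv ℝ f x (Pi.single i 1)) n‖ ≤ C :=
      fun i => ih (hp.fderiv _) ((hf.fderiv_right (m := (⊤ : ℕ∞)) (by simp)).clm_apply contDiff_const)
    choose C hC using h1
    refine ⟨∑ i, C i, fun n => ?_⟩
    calc ‖n‖ ^ (k + 1) * ‖coeff f n‖ ≤ (∑ i, ‖n i‖) * (‖n‖ ^ k * ‖coeff f n‖) := by
          rw [pow_succ, mul_comm (_ ^ k), mul_assoc]
          exact mul_le_mul_of_nonneg_right (norm_le_sum n) (by positivity)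
      _ ≤ ∑ i, C i := by
          rw [Finset.sum_mul]
          refine Finset.sum_le_sum fun i _ => le_trans ?_ (hC i n)
          rw [coeff_fderiv hp (hf.of_le (by exact_mod_cast le_top)), norm_mul, norm_mul, Complex.norm_I, one_mul, Complex.norm_real,
            lin_apply]
          have h2 : ∑ j, 2 * π * n j * (Pi.single i 1 : d → ℝ) j = 2 * π * n i := by
            rw [Finset.sum_eq_single i] <;> simp +contextual
          rw [h2, norm_mul, Real.norm_of_nonneg (by positivity)]
          have h3 : ‖((n i : ℤ) : ℝ)‖ = ‖n i‖ := rfl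
          rw [h3]
          have h4 : 1 ≤ 2 * π := by linarith [Real.pi_gt_three]
          have h5 : 0 ≤ ‖n i‖ * (‖n‖ ^ k * ‖coeff f n‖) := by positivity
          nlinarith

/-- `ℤ^d` embeds isometrically into a lattice of `ℝ^d`, where the sum of an inverse power beyond the
rank converges. -/
theorem summable_norm_inv_pow : ∃ p : ℕ, Summable fun n : d → ℤ => ‖n‖⁻¹ ^ p := by
  classical
  let b := Pi.basisFun ℝ d
  let L := Submodule.span ℤ (Set.range b)
  have hmem : ∀ n : d → ℤ, (fun i => (n i : ℝ)) ∈ L := by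
    intro n
    rw [Module.Basis.mem_span_iff_repr_mem]
    intro i
    exact ⟨n i, by simp [b]⟩
  refine ⟨Module.finrank ℤ L + 1, ((ZLattice.summable_norm_pow_inv L _ (Nat.lt_succ_self _)).comp_injective
    (i := fun n : d → ℤ => (⟨_, hmem n⟩ : L)) ?_).congr fun n => ?_⟩
  · intro n m h
    funext i
    have h1 : ((n i : ℤ) : ℝ) = m i := congrFun (congrArg Subtype.val h) i
    exact_mod_cast h1
  · have : ‖(⟨_, hmem n⟩ : L)‖ = ‖n‖ := by
      change ‖(fun i => (n i : ℝ))‖ = ‖n‖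
      simp only [Pi.norm_def]
      rfl
    simp only [Function.comp_apply, this]

theorem IsRapid.summable {b : (d → ℤ) → ℂ} (hb : IsRapid b) (k : ℕ) :
    Summable fun n => ‖n‖ ^ k * ‖b n‖ := by
  obtain ⟨p, hp⟩ := summable_norm_inv_pow (d := d)
  obtain ⟨C, hC⟩ := hb (k + p)
  refine (hp.mul_left C).of_norm_bounded_eventually ?_
  -- The index `0` is excepted: there `‖n‖⁻¹` is zero by convention and the bound may fail.
  refine (Set.finite_singleton (0 : d → ℤ)).subset fun n hn => ?_
  by_contra h0
  refine hn ?_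
  have h1 : 0 < ‖n‖ := norm_pos_iff.2 h0
  change ‖‖n‖ ^ k * ‖b n‖‖ ≤ C * ‖n‖⁻¹ ^ p
  rw [Real.norm_of_nonneg (by positivity), inv_pow, ← div_eq_mul_inv, le_div_iff₀ (by positivity)]
  refine le_trans (le_of_eq ?_) (hC n)
  rw [pow_add]; ring

/-- The Fourier series with coefficients `b`. -/
def series (b : (d → ℤ) → ℂ) (x : d → ℝ) : ℂ := ∑' n, b n * chi n x

theorem norm_lin_le : ∃ C, 0 ≤ C ∧ ∀ n : d → ℤ, ‖lin n‖ ≤ C * ‖n‖ := by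
  refine ⟨∑ i : d, 2 * π * ‖(ContinuousLinearMap.proj i : (d → ℝ) →L[ℝ] ℝ)‖, by positivity, fun n => ?_⟩
  rw [Finset.sum_mul]
  refine (norm_sum_le _ _).trans (Finset.sum_le_sum fun i _ => ?_)
  rw [norm_smul, norm_mul, Real.norm_of_nonneg (by positivity)]
  have h3 : ‖((n i : ℤ) : ℝ)‖ = ‖n i‖ := rfl
  rw [h3, mul_right_comm]
  exact mul_le_mul_of_nonneg_left (norm_le_pi_norm n i) (by positivity)

theorem IsRapid.of_norm_le {b b' : (d → ℤ) → ℂ} (hb : IsRapid b) {C : ℝ} {j : ℕ}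
    (hC : 0 ≤ C) (h : ∀ n, ‖b' n‖ ≤ C * ‖n‖ ^ j * ‖b n‖) : IsRapid b' := by
  intro k
  obtain ⟨D, hD⟩ := hb (k + j)
  refine ⟨C * D, fun n => ?_⟩
  calc ‖n‖ ^ k * ‖b' n‖ ≤ ‖n‖ ^ k * (C * ‖n‖ ^ j * ‖b n‖) := by gcongr; exact h n
    _ = C * (‖n‖ ^ (k + j) * ‖b n‖) := by rw [pow_add]; ring
    _ ≤ C * D := by gcongr; exact hD n

theorem IsRapid.add {b b' : (d → ℤ) → ℂ} (hb : IsRapid b) (hb' : IsRapid b') :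
    IsRapid fun n => b n + b' n := by
  intro k
  obtain ⟨C, hC⟩ := hb k
  obtain ⟨C', hC'⟩ := hb' k
  refine ⟨C + C', fun n => ?_⟩
  calc ‖n‖ ^ k * ‖b n + b' n‖ ≤ ‖n‖ ^ k * (‖b n‖ + ‖b' n‖) := by gcongr; exact norm_add_le _ _
    _ = ‖n‖ ^ k * ‖b n‖ + ‖n‖ ^ k * ‖b' n‖ := by ring
    _ ≤ C + C' := add_le_add (hC n) (hC' n)

theorem IsRapid.const_mul {b : (d → ℤ) → ℂ} (hb : IsRapid b) (c : ℂ) : IsRapid fun n => c * b n :=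
  hb.of_norm_le (C := ‖c‖) (j := 0) (norm_nonneg _) fun n => by simp

theorem IsRapid.summable_chi {b : (d → ℤ) → ℂ} (hb : IsRapid b) (x : d → ℝ) :
    Summable fun n => b n * chi n x :=
  .of_norm <| by simpa [norm_chi] using hb.summable 0

theorem IsRapid.series_add {b b' : (d → ℤ) → ℂ} (hb : IsRapid b) (hb' : IsRapid b') (x : d → ℝ) :
    series (fun n => b n + b' n) x = series b x + series b' x := by
  rw [series, series, series, ← (hb.summable_chi x).tsum_add (hb'.summable_chi x)]
  exact tsum_congr fun n => by ring

theorem series_const_mul (b : (d → ℤ) → ℂ) (c : ℂ) (x : d → ℝ) :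
    series (fun n => c * b n) x = c * series b x := by
  rw [series, series, ← tsum_mul_left]
  exact tsum_congr fun n => by ring

theorem series_single_zero (c : ℂ) (x : d → ℝ) : series (fun n => if n = 0 then c else 0) x = c := by
  classical
  rw [series, tsum_eq_single 0 (by intro n hn; simp [hn])]
  simp [chi, lin]

theorem isRapid_single_zero (c : ℂ) : IsRapid fun n : d → ℤ => if n = 0 then c else 0 := by
  intro k
  refine ⟨‖c‖ * (if k = 0 then 1 else 0) , fun n => ?_⟩
  by_cases hn : n = 0
  · subst hn
    rcases k with _ | k <;> simp
  · simp [hn]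
    split_ifs <;> positivity

theorem IsRapid.lin_mul {b : (d → ℤ) → ℂ} (hb : IsRapid b) (w : d → ℝ) :
    IsRapid fun n => Complex.I * lin n w * b n := by
  obtain ⟨C, hC, h⟩ := norm_lin_le (d := d)
  refine hb.of_norm_le (C := C * ‖w‖) (j := 1) (by positivity) fun n => ?_
  rw [norm_mul, norm_mul, Complex.norm_I, one_mul, Complex.norm_real, pow_one]
  gcongr
  calc ‖lin n w‖ ≤ ‖lin n‖ * ‖w‖ := (lin n).le_opNorm w
    _ ≤ C * ‖n‖ * ‖w‖ := by gcongr; exact h n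
    _ = _ := by ring

theorem IsRapid.hasFDerivAt {b : (d → ℤ) → ℂ} (hb : IsRapid b) (x : d → ℝ) :
    ∃ L : (d → ℝ) →L[ℝ] ℂ, HasFDerivAt (series b) L x ∧
      ∀ w, L w = series (fun n => Complex.I * lin n w * b n) x := by
  obtain ⟨C, hC, h⟩ := norm_lin_le (d := d)
  have hs : Summable fun n => C * (‖n‖ ^ 1 * ‖b n‖) := (hb.summable 1).mul_left C
  have hbd : ∀ n x, ‖b n • ((Complex.I * chi n x) • (Complex.ofRealCLM.comp (lin n)))‖ ≤
      C * (‖n‖ ^ 1 * ‖b n‖) := by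
    intro n x
    rw [norm_smul, norm_smul, norm_mul, Complex.norm_I, norm_chi, one_mul, one_mul, pow_one, ← mul_assoc,
      mul_comm]
    gcongr
    refine ContinuousLinearMap.opNorm_le_bound _ (by positivity) fun w => ?_
    rw [ContinuousLinearMap.comp_apply, Complex.ofRealCLM_apply, Complex.norm_real]
    exact ((lin n).le_opNorm w).trans (by gcongr; exact h n)
  have hd := hasFDerivAt_tsum hs (fun n x => (hasFDerivAt_chi n x).const_mul (b n)) hbd
    (x₀ := 0) (hb.summable_chi 0) x
  refine ⟨_, hd, fun w => ?_⟩
  have hs2 : Summable fun n => b n • ((Complex.I * chi n x) • (Complex.ofRealCLM.comp (lin n))) :=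
    .of_norm_bounded hs fun n => hbd n x
  refine ((ContinuousLinearMap.apply ℝ ℂ w).map_tsum hs2).trans ?_
  refine tsum_congr fun n => ?_
  simp
  ring

/-- Every directional derivative is again a series with rapidly decreasing coefficients, so
induction on the order applies. -/
theorem IsRapid.contDiff {b : (d → ℤ) → ℂ} (hb : IsRapid b) : ContDiff ℝ (⊤ : ℕ∞) (series b) := by
  rw [contDiff_infty]
  intro k
  induction k generalizing b with
  | zero =>
    rw [Nat.cast_zero, contDiff_zero, continuous_iff_continuousAt]
    intro x
    obtain ⟨L, hL, -⟩ := hb.hasFDerivAt x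
    exact hL.continuousAt
  | succ k ih =>
    rw [Nat.cast_succ, contDiff_succ_iff_fderiv_apply]
    refine ⟨fun x => ?_, by simp, fun w => ?_⟩
    · obtain ⟨L, hL, -⟩ := hb.hasFDerivAt x
      exact hL.differentiableAt
    · convert ih (hb.lin_mul w) using 2 with x
      obtain ⟨L, hL, hw⟩ := hb.hasFDerivAt x
      rw [hL.fderiv, hw]

theorem IsRapid.fderiv_series {b : (d → ℤ) → ℂ} (hb : IsRapid b) (x w : d → ℝ) :
    fderiv ℝ (series b) x w = series (fun n => Complex.I * lin n w * b n) x := by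
  obtain ⟨L, hL, hw⟩ := hb.hasFDerivAt x
  rw [hL.fderiv, hw]

theorem isPeriodic_series (b : (d → ℤ) → ℂ) : IsPeriodic (series b) := by
  intro m x
  refine tsum_congr fun n => ?_
  rw [chi_add, chi_int, mul_one]

theorem series_coeff {f : (d → ℝ) → ℂ} (hp : IsPeriodic f) (hf : ContDiff ℝ (⊤ : ℕ∞) f) :
    series (coeff f) = f := by
  obtain ⟨F, hF⟩ := hp.exists_descent hf.continuous
  have h1 : mFourierCoeff F = coeff f := funext fun n => mFourierCoeff_eq hF n 0
  funext x
  have h2 := hasSum_mFourier_series_apply_of_summable (f := F) (by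
    rw [h1]; exact .of_norm <| by simpa using (isRapid_coeff hp hf).summable 0)
    (fun i => (x i : UnitAddCircle))
  rw [h1, hF] at h2
  simp only [mFourier_eq_chi, smul_eq_mul] at h2
  exact h2.tsum_eq

end TorusFourier

end

/-! ### The operator `∂̄` on Fourier coefficients -/

noncomputable section

namespace TorusQuotient

open Topology TorusFourier
open scoped Real

/-- The real coordinates of `ℂ³` with respect to the basis `1, ζ`. -/
def coords : V →L[ℝ] (Fin 3 × Fin 2 → ℝ) :=
  LinearMap.toContinuousLinearMap
    { toFun := fun z p => if p.2 = 0 then (z p.1).re + (z p.1).im / √3 else 2 * (z p.1).im / √3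
      map_add' := fun z w => by funext p; by_cases h : p.2 = 0 <;> simp [h] <;> ring
      map_smul' := fun c z => by funext p; by_cases h : p.2 = 0 <;> simp [h] <;> ring }

theorem coords_apply_zero (z : V) (i : Fin 3) : coords z (i, 0) = (z i).re + (z i).im / √3 := rfl

theorem coords_apply_one (z : V) (i : Fin 3) : coords z (i, 1) = 2 * (z i).im / √3 := rfl

/-- The inverse of `coords`. -/
def ofCoords : (Fin 3 × Fin 2 → ℝ) →L[ℝ] V :=
  LinearMap.toContinuousLinearMap
    { toFun := fun x i => x (i, 0) + x (i, 1) * ζ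
      map_add' := fun z w => by funext p; simp; ring
      map_smul' := fun c z => by funext p; simp; ring }

theorem ofCoords_apply (x : Fin 3 × Fin 2 → ℝ) (i : Fin 3) :
    ofCoords x i = x (i, 0) + x (i, 1) * ζ := rfl

theorem ofCoords_coords (z : V) : ofCoords (coords z) = z := by
  funext i
  rw [ofCoords_apply, coords_apply_zero, coords_apply_one]
  apply Complex.ext
  · simp [ζ_re]; ring
  · simp [ζ_im]; field_simp

theorem coords_ofCoords (x : Fin 3 × Fin 2 → ℝ) : coords (ofCoords x) = x := by
  funext ⟨i, k⟩
  have h3 : √3 ≠ 0 := by positivity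
  fin_cases k
  · change coords _ (i, 0) = x (i, 0)
    rw [coords_apply_zero, ofCoords_apply]
    simp [ζ_re, ζ_im]; field_simp; ring
  · change coords _ (i, 1) = x (i, 1)
    rw [coords_apply_one, ofCoords_apply]
    simp [ζ_im]; field_simp

theorem ofCoords_int (m : Fin 3 × Fin 2 → ℤ) : ofCoords (fun p => (m p : ℝ)) ∈ Λ₁ :=
  mem_Λ₁.2 fun i => mem_eis.2 ⟨m (i, 0), m (i, 1), by rw [ofCoords_apply]; push_cast; rfl⟩

theorem exists_coords_int {l : V} (hl : l ∈ Λ₁) : ∃ m : Fin 3 × Fin 2 → ℤ, coords l = fun p => (m p : ℝ) := by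
  choose a b h using fun i => mem_eis.1 (mem_Λ₁.1 hl i)
  refine ⟨fun p => if p.2 = 0 then a p.1 else b p.1, ?_⟩
  have : l = ofCoords (fun p => ((if p.2 = 0 then a p.1 else b p.1 : ℤ) : ℝ)) := by
    funext i
    rw [ofCoords_apply, h]
    simp
  rw [this, coords_ofCoords]

/-- The symbol of the operator `∂/∂z̄_j`. -/
def symbol (j : Fin 3) (n : Fin 3 × Fin 2 → ℤ) : ℂ :=
  (Complex.I * lin n (coords (Pi.single j 1)) +
    Complex.I * (Complex.I * lin n (coords (Pi.single j Complex.I)))) / 2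

theorem lin_coords (n : Fin 3 × Fin 2 → ℤ) (z : V) :
    lin n (coords z) = ∑ i, 2 * π * (n (i, 0) * ((z i).re + (z i).im / √3) +
      n (i, 1) * (2 * (z i).im / √3)) := by
  rw [lin_apply, Fintype.sum_prod_type]
  refine Finset.sum_congr rfl fun i _ => ?_
  rw [Fin.sum_univ_two, coords_apply_zero, coords_apply_one]
  ring

theorem normSq_symbol (j : Fin 3) (n : Fin 3 × Fin 2 → ℤ) :
    Complex.normSq (symbol j n) = π ^ 2 * (n (j, 0) ^ 2 + (n (j, 0) + 2 * n (j, 1)) ^ 2 / 3) := by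
  have h1 : lin n (coords (Pi.single j 1)) = 2 * π * n (j, 0) := by
    rw [lin_coords, Finset.sum_eq_single j]
    · simp
    · intro i _ hi; simp [hi]
    · simp
  have h2 : lin n (coords (Pi.single j Complex.I)) = 2 * π * ((n (j, 0) + 2 * n (j, 1)) / √3) := by
    rw [lin_coords, Finset.sum_eq_single j]
    · simp; ring
    · intro i _ hi; simp [hi]
    · simp
  have h3 : √3 ^ 2 = 3 := Real.sq_sqrt (by norm_num)
  have h4 : symbol j n = ((-(π * ((n (j, 0) + 2 * n (j, 1)) / √3)) : ℝ) : ℂ) + ((π * n (j, 0) : ℝ) : ℂ) * Complex.I := by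
    rw [symbol, h1, h2]
    push_cast
    linear_combination (π * ((n (j, 0) + 2 * n (j, 1)) / √3 : ℂ)) * Complex.I_sq
  rw [h4, Complex.normSq_add_mul_I]
  have h5 : (√3)⁻¹ ^ 2 = 1 / 3 := by rw [inv_pow, h3]; norm_num
  linear_combination (π ^ 2 * (n (j, 0) + 2 * n (j, 1)) ^ 2) * h5

/-- Ellipticity: the summand of `j` is `π ^ 2 / 3` times the integer `3 * n (j, 0) ^ 2 + (n (j, 0) +
2 * n (j, 1)) ^ 2`, positive for a suitable `j`, and `π ^ 2 ≥ 3`. -/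
theorem one_le_sum_normSq_symbol {n : Fin 3 × Fin 2 → ℤ} (hn : n ≠ 0) :
    1 ≤ ∑ j, Complex.normSq (symbol j n) := by
  obtain ⟨⟨j, k⟩, hjk⟩ := Function.ne_iff.1 hn
  refine le_trans ?_ (Finset.single_le_sum (f := fun j => Complex.normSq (symbol j n))
    (fun _ _ => Complex.normSq_nonneg _) (Finset.mem_univ j))
  rw [normSq_symbol]
  have h1 : 1 ≤ 3 * n (j, 0) ^ 2 + (n (j, 0) + 2 * n (j, 1)) ^ 2 := by
    rcases eq_or_ne (n (j, 0)) 0 with h0 | h0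
    · have h2 : n (j, 1) ≠ 0 := by
        intro h2
        fin_cases k
        · exact hjk h0
        · exact hjk h2
      rw [h0]
      have := Int.one_le_abs h2
      nlinarith [sq_abs (n (j, 1))]
    · have := Int.one_le_abs h0
      nlinarith [sq_abs (n (j, 0)), sq_nonneg (n (j, 0) + 2 * n (j, 1))]
  have h2 : (1 : ℝ) ≤ 3 * n (j, 0) ^ 2 + (n (j, 0) + 2 * n (j, 1)) ^ 2 := by exact_mod_cast h1
  have h3 := Real.pi_gt_three
  nlinarith

theorem symbol_zero (j : Fin 3) : symbol j 0 = 0 := by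
  have h := normSq_symbol j 0
  simp at h
  exact h

theorem isPeriodic_comp_ofCoords {f : V → ℂ} (hf : ∀ l ∈ Λ₁, ∀ z, f (z + l) = f z) :
    IsPeriodic (f ∘ ofCoords) := by
  intro m x
  rw [Function.comp_apply, map_add, hf _ (ofCoords_int m), Function.comp_apply]

theorem series_coords_add (b : (Fin 3 × Fin 2 → ℤ) → ℂ) {l : V} (hl : l ∈ Λ₁) (z : V) :
    series b (coords (z + l)) = series b (coords z) := by
  obtain ⟨m, hm⟩ := exists_coords_int hl
  rw [map_add, hm, isPeriodic_series]

theorem isRapid_symbol_mul {b : (Fin 3 × Fin 2 → ℤ) → ℂ} (hb : IsRapid b) (j : Fin 3) :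
    IsRapid fun n => symbol j n * b n := by
  convert ((hb.lin_mul (coords (Pi.single j 1))).add
    ((hb.lin_mul (coords (Pi.single j Complex.I))).const_mul Complex.I)).const_mul (1 / 2) using 2 with n
  rw [symbol]; ring

theorem dbar_series {b : (Fin 3 × Fin 2 → ℤ) → ℂ} (hb : IsRapid b) (j : Fin 3) (z : V) :
    dbar j (fun w => series b (coords w)) z = series (fun n => symbol j n * b n) (coords z) := by
  have h : ∀ w, fderiv ℝ (fun w => series b (coords w)) z w =
      series (fun n => Complex.I * lin n (coords w) * b n) (coords z) := by
    intro w
    have h1 := ((hb.contDiff.differentiable (by simp)) (coords z)).hasFDerivAt.comp z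
      coords.hasFDerivAt
    rw [← hb.fderiv_series]
    exact congrArg (fun L => L w) h1.fderiv
  rw [dbar, h, h, ← series_const_mul, ← (hb.lin_mul _).series_add ((hb.lin_mul _).const_mul _),
    div_eq_inv_mul, ← series_const_mul]
  congr 1
  funext n
  rw [symbol]; ring

theorem coeff_dbar {f : V → ℂ} (hf : ContDiff ℝ (⊤ : ℕ∞) f) (hp : ∀ l ∈ Λ₁, ∀ z, f (z + l) = f z)
    (j : Fin 3) (n : Fin 3 × Fin 2 → ℤ) :
    coeff (fun x => dbar j f (ofCoords x)) n = symbol j n * coeff (f ∘ ofCoords) n := by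
  have hc : ContDiff ℝ (⊤ : ℕ∞) (f ∘ ofCoords) := hf.comp ofCoords.contDiff
  have hper := isPeriodic_comp_ofCoords hp
  have hb := isRapid_coeff hper hc
  have h1 : f = fun z => series (coeff (f ∘ ofCoords)) (coords z) := by
    funext z
    rw [series_coeff hper hc, Function.comp_apply, ofCoords_coords]
  have h2 : ∀ x, dbar j f (ofCoords x) = (fderiv ℝ (f ∘ ofCoords) x (coords (Pi.single j 1)) +
      Complex.I * fderiv ℝ (f ∘ ofCoords) x (coords (Pi.single j Complex.I))) / 2 := by
    intro x
    have h3 := (hf.differentiable (by simp) (ofCoords x)).hasFDerivAt.comp x ofCoords.hasFDerivAt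
    rw [h3.fderiv, dbar]
    simp [ofCoords_coords]
  have hint : ∀ w, MeasureTheory.Integrable (fun x => chi (-n) x * fderiv ℝ (f ∘ ofCoords) x w)
      (MeasureTheory.volume.restrict (box 0)) := by
    intro w
    have hcw : Continuous fun x => fderiv ℝ (f ∘ ofCoords) x w :=
      (hc.continuous_fderiv (by simp)).clm_apply continuous_const
    obtain ⟨C, hC⟩ := (hper.fderiv w).exists_bound hcw
    refine MeasureTheory.Integrable.of_bound (C := C)
      ((continuous_chi _).mul hcw).aestronglyMeasurable (.of_forall fun x => ?_)
    rw [norm_mul, norm_chi, one_mul]; exact hC x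
  have hc1 : ContDiff ℝ 1 (f ∘ ofCoords) := hc.of_le (by exact_mod_cast le_top)
  have k1 := coeff_fderiv hper hc1 n (coords (Pi.single j 1))
  have k2 := coeff_fderiv hper hc1 n (coords (Pi.single j Complex.I))
  rw [symbol, add_div, add_mul, ← mul_div_right_comm, ← mul_div_right_comm, ← k1, mul_assoc, ← k2]
  simp only [coeff, h2]
  rw [← MeasureTheory.integral_const_mul, ← MeasureTheory.integral_div, ← MeasureTheory.integral_div,
    ← MeasureTheory.integral_add]
  · congr 1; funext x; ring
  · exact (hint _).div_const _
  · exact ((hint _).const_mul _).div_const _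

/-- Hodge decomposition of `∂̄`-closed forms on the cube of the Fermat curve. -/
theorem exists_eq_const_add_dbar {ω : Fin 3 → V → ℂ} (hω : ∀ j, ContDiff ℝ (⊤ : ℕ∞) (ω j))
    (hp : ∀ j, ∀ l ∈ Λ₁, ∀ z, ω j (z + l) = ω j z)
    (hcl : ∀ j k z, dbar k (ω j) z = dbar j (ω k) z) :
    ∃ (c : Fin 3 → ℂ) (v : V → ℂ), ContDiff ℝ (⊤ : ℕ∞) v ∧ (∀ l ∈ Λ₁, ∀ z, v (z + l) = v z) ∧
      ∀ j z, ω j z = c j + dbar j v z := by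
  have hper := fun j => isPeriodic_comp_ofCoords (hp j)
  have hc : ∀ j, ContDiff ℝ (⊤ : ℕ∞) (ω j ∘ ofCoords) := fun j => (hω j).comp ofCoords.contDiff
  let a j := coeff (ω j ∘ ofCoords)
  have ha : ∀ j, IsRapid (a j) := fun j => isRapid_coeff (hper j) (hc j)
  have hsym : ∀ j k n, symbol k n * a j n = symbol j n * a k n := by
    intro j k n
    rw [← coeff_dbar (hω j) (hp j), ← coeff_dbar (hω k) (hp k)]
    congr 1
    funext x
    exact hcl j k _
  let S (n : Fin 3 × Fin 2 → ℤ) : ℂ := ∑ j, (Complex.normSq (symbol j n) : ℂ)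
  -- The least-squares solution of the system `a j n = symbol j n * b n`. At `n = 0` it is `0` by
  -- division by zero, and the constant terms are left over.
  let b (n : Fin 3 × Fin 2 → ℤ) : ℂ := (∑ j, (starRingEnd ℂ) (symbol j n) * a j n) / S n
  have hS : ∀ n, n ≠ 0 → 1 ≤ ‖S n‖ := by
    intro n hn
    have h1 : S n = ((∑ j, Complex.normSq (symbol j n) : ℝ) : ℂ) := by push_cast; rfl
    rw [h1, Complex.norm_real]
    exact (one_le_sum_normSq_symbol hn).trans (le_abs_self _)
  have hconj : ∀ j, IsRapid fun n => (starRingEnd ℂ) (symbol j n) * a j n := fun j =>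
    (isRapid_symbol_mul (ha j) j).of_norm_le (C := 1) (j := 0) zero_le_one fun n => by simp
  have hb : IsRapid b := by
    refine (((hconj 0).add (hconj 1)).add (hconj 2)).of_norm_le (C := 1) (j := 0) zero_le_one fun n => ?_
    rw [pow_zero, one_mul, one_mul, norm_div, Fin.sum_univ_three]
    by_cases hn : n = 0
    · simp [hn, symbol_zero]
    · exact div_le_self (norm_nonneg _) (hS n hn)
  -- Closedness, in the form `hsym`, makes the least-squares solution exact away from `n = 0`.
  have hab : ∀ j n, a j n = (if n = 0 then a j 0 else 0) + symbol j n * b n := by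
    intro j n
    by_cases hn : n = 0
    · simp [hn, symbol_zero]
    · have h0 : S n ≠ 0 := by
        intro h0
        have := hS n hn
        rw [h0, norm_zero] at this
        linarith
      simp only [hn, if_false, zero_add, b]
      rw [← mul_div_assoc, eq_div_iff h0, Finset.mul_sum, mul_comm, Finset.sum_mul]
      refine Finset.sum_congr rfl fun k _ => ?_
      rw [← Complex.mul_conj]
      linear_combination (starRingEnd ℂ) (symbol k n) * hsym j k n
  refine ⟨fun j => a j 0, fun z => series b (coords z), hb.contDiff.comp coords.contDiff,
    fun l hl z => series_coords_add b hl z, fun j z => ?_⟩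
  rw [dbar_series hb]
  have h1 : ω j z = series (a j) (coords z) := by
    rw [series_coeff (hper j) (hc j), Function.comp_apply, ofCoords_coords]
  change ω j z = a j 0 + _
  rw [h1, ← series_single_zero (a j 0) (coords z),
    ← (isRapid_single_zero _).series_add (isRapid_symbol_mul hb j)]
  congr 1
  funext n
  exact hab j n

end TorusQuotient

end

/-! ### Infinitesimal rigidity of the three examples -/

noncomputable section

namespace TorusQuotient

open Topology TorusFourier TorusGroup

/-- A constant form on the torus which is `∂̄`-exact vanishes. -/
theorem const_eq_zero_of_eq_dbar {u : V → ℂ} (hu : ContDiff ℝ (⊤ : ℕ∞) u)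
    (hp : ∀ l ∈ Λ₁, ∀ z, u (z + l) = u z) {j : Fin 3} {c : ℂ} (h : ∀ z, c = dbar j u z) : c = 0 := by
  have h1 := coeff_dbar hu hp j 0
  rw [symbol_zero, zero_mul] at h1
  simp only [← h, coeff] at h1
  simpa [chi, lin] using h1

theorem dbar_comp_add (u : V → ℂ) (j : Fin 3) (z a : V) : dbar j (fun w => u (w + a)) z = dbar j u (z + a) := by
  rw [dbar, dbar, fderiv_comp_add_right]

section dbar

variable {u v : V → ℂ} (hu : Differentiable ℝ u) (hv : Differentiable ℝ v) (j : Fin 3) (z : V)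
include hu

theorem dbar_const_mul (c : ℂ) : dbar j (fun w => c * u w) z = c * dbar j u z := by
  rw [dbar, dbar, fderiv_const_mul (hu z)]
  simp only [_root_.smul_apply, smul_eq_mul]
  ring

theorem dbar_comp_mul (m : ℂ) : dbar j (fun w => u (m • w)) z = (starRingEnd ℂ) m * dbar j u (m • z) := by
  have h1 : HasFDerivAt (fun w => u (m • w)) ((fderiv ℝ u (m • z)).comp
      ((m • ContinuousLinearMap.id ℂ V).restrictScalars ℝ)) z :=
    (hu (m • z)).hasFDerivAt.comp z ((m • ContinuousLinearMap.id ℂ V).restrictScalars ℝ).hasFDerivAt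
  have h2 : ∀ x : ℂ, m • (Pi.single j x : V) =
      (m * x).re • (Pi.single j 1 : V) + (m * x).im • (Pi.single j Complex.I : V) := by
    intro x
    rw [← Pi.single_smul, ← Pi.single_smul, ← Pi.single_smul, ← Pi.single_add]
    congr 1
    apply Complex.ext <;> simp
  rw [dbar, h1.fderiv, dbar]
  simp only [ContinuousLinearMap.comp_apply, ContinuousLinearMap.coe_restrictScalars', _root_.smul_apply,
    ContinuousLinearMap.id_apply, h2, map_add, map_smul, Complex.real_smul]
  have h3 : (starRingEnd ℂ) m = m.re - m.im * Complex.I := by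
    apply Complex.ext <;> simp
  rw [h3]
  simp only [Complex.mul_re, Complex.mul_im, Complex.I_re, Complex.I_im,
    mul_one, mul_zero, zero_sub, add_zero]
  push_cast
  linear_combination (m.im : ℂ) / 2 * fderiv ℝ u (m • z) (Pi.single j Complex.I) * Complex.I_sq

include hv

theorem dbar_add : dbar j (fun w => u w + v w) z = dbar j u z + dbar j v z := by
  rw [dbar, dbar, dbar, fderiv_fun_add (hu z) (hv z)]
  simp only [_root_.add_apply]
  ring

end dbar

/-- The solution over `Λ₁` is averaged over the translates by `0`, `w`, `2w`, which makes it
periodic for the larger lattice; the form itself is already invariant. -/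
theorem exists_eq_const_add_dbar_of_sup {w : V} (hw : w + w + w ∈ Λ₁) {ω : Fin 3 → V → ℂ}
    (hω : ∀ j, ContDiff ℝ (⊤ : ℕ∞) (ω j))
    (hp : ∀ j, ∀ l ∈ Λ₁ ⊔ Submodule.span ℤ {w}, ∀ z, ω j (z + l) = ω j z)
    (hcl : ∀ j k z, dbar k (ω j) z = dbar j (ω k) z) :
    ∃ (c : Fin 3 → ℂ) (v : V → ℂ), ContDiff ℝ (⊤ : ℕ∞) v ∧
      (∀ l ∈ Λ₁ ⊔ Submodule.span ℤ {w}, ∀ z, v (z + l) = v z) ∧ ∀ j z, ω j z = c j + dbar j v z := by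
  obtain ⟨c, v, hv, hvp, h⟩ := exists_eq_const_add_dbar hω
    (fun j l hl => hp j l (Submodule.mem_sup_left hl)) hcl
  have hv1 : ∀ a, ContDiff ℝ (⊤ : ℕ∞) fun z => v (z + a) := fun a => hv.comp (contDiff_id.add contDiff_const)
  have hd : ∀ a, Differentiable ℝ fun z => v (z + a) := fun a => (hv1 a).differentiable (by simp)
  refine ⟨c, fun z => 1 / 3 * (v z + v (z + w) + v (z + (w + w))), ?_, ?_, fun j z => ?_⟩
  · exact contDiff_const.mul ((hv.add (hv1 w)).add (hv1 (w + w)))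
  · let P : AddSubgroup V :=
      { carrier := {l | ∀ z, 1 / 3 * (v (z + l) + v (z + l + w) + v (z + l + (w + w))) =
          1 / 3 * (v z + v (z + w) + v (z + (w + w)))}
        zero_mem' := fun z => by simp only [add_zero]
        add_mem' := fun {a b} ha hb z => by
          rw [show z + (a + b) = z + b + a by abel]; exact (ha (z + b)).trans (hb z)
        neg_mem' := fun {a} ha z => by rw [← ha (z + -a)]; simp only [neg_add_cancel_right] }
    have hle : Λ₁ ⊔ Submodule.span ℤ {w} ≤ AddSubgroup.toIntSubmodule P := by
      refine sup_le (fun l hl z => ?_) ?_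
      · rw [add_right_comm z l w, add_right_comm z l, hvp l hl, hvp l hl, hvp l hl]
      · rw [Submodule.span_singleton_le_iff_mem]
        intro z
        have h1 : z + w + (w + w) = z + (w + w + w) := by abel
        rw [h1, hvp _ hw, add_assoc z]
        ring
    intro l hl z
    exact hle hl z
  · have hdv : Differentiable ℝ v := hv.differentiable (by simp)
    rw [dbar_const_mul ((hdv.fun_add (hd w)).fun_add (hd (w + w))), dbar_add (hdv.fun_add (hd w)) (hd (w + w)),
      dbar_add hdv (hd w), dbar_comp_add v, dbar_comp_add v]
    have hw' : w ∈ Λ₁ ⊔ Submodule.span ℤ {w} :=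
      Submodule.mem_sup_right (Submodule.mem_span_singleton_self _)
    have h2 := hp j w hw' z
    have h3 := hp j (w + w) (add_mem hw' hw') z
    have h4 := h j z
    rw [h, h] at h2 h3
    linear_combination h4 - (1 / 3) * h2 - (1 / 3) * h3

/-- Multiplication by `ζ` alone suffices: it pulls a constant form `c` back to `ζ⁻¹ * c * conj ζ = ζ
* c`. Invariance of the class then makes `(ζ - 1) * c` exact, and an exact constant vanishes. -/
theorem isRigidAction_of_sup {w : V} (hw : w + w + w ∈ Λ₁) {A : TorusGroup} [DiscreteTopology A.Λ]
    (hΛ : A.Λ = Λ₁ ⊔ Submodule.span ℤ {w}) (hk : A.Lifts (affine ![ζ, ζ, ζ] 0)) :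
    IsRigidAction A := by
  intro ω hω hcl hG
  obtain ⟨σ, hσ, hσk⟩ := hk
  obtain ⟨η, ⟨F, hF, hσF, hη⟩, u, hu, huη⟩ := hG σ hσ
  have hscal : ∀ z, affine ![ζ, ζ, ζ] 0 z = ζ • z := by
    intro z; funext i; fin_cases i <;> simp [affine]
  have h1 : ∀ z, F z - ζ • z ∈ A.Λ := by
    intro z
    rw [← A.torusProj_eq_iff, ← hscal, ← hσk]
    exact (hσF z).symm
  have hFz : ∀ z, F z = ζ • z + F 0 := by
    intro z
    have := A.const_of_mem (F := fun z => F z - ζ • z) (by have := hF.continuous; fun_prop) h1 z 0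
    simp only [smul_zero, sub_zero] at this
    rw [← this]; abel
  have hF0 : F 0 ∈ A.Λ := by simpa using h1 0
  have hjac : ∀ z, jacobian F z = Matrix.diagonal fun _ => ζ := by
    intro z
    have h2 : HasFDerivAt F (ζ • ContinuousLinearMap.id ℂ V) z := by
      rw [show F = fun z => ζ • z + F 0 from funext hFz]
      exact ((ContinuousLinearMap.id ℂ V).hasFDerivAt.const_smul ζ).add_const _
    ext i j
    rw [jacobian, h2.fderiv]
    simp [Matrix.diagonal_apply, Pi.single_apply]
  have hηω : ∀ z i j, η z i j = ζ * ω (ζ • z) i j := by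
    intro z i j
    have h2 := congrFun (congrFun (hη z) i) j
    rw [hjac, Matrix.diagonal_map (map_zero _), Matrix.diagonal_mul, Matrix.mul_diagonal, hFz, hω.2 _ hF0,
      conj_ζ] at h2
    apply mul_left_cancel₀ ζ_ne_zero
    rw [h2]; ring
  have hrow := fun i => exists_eq_const_add_dbar_of_sup hw (ω := fun j z => ω z i j) (fun j => hω.1 i j)
    (fun j l hl z => by rw [hω.2 l (hΛ ▸ hl)]) (fun j k z => hcl i j k z)
  choose c v hv hvp hωv using hrow
  have hc : ∀ i j, c i j = 0 := by
    intro i j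
    have hui : ContDiff ℝ (⊤ : ℕ∞) fun z => u z i := contDiff_pi.1 hu.1 i
    have hvζ : ContDiff ℝ (⊤ : ℕ∞) fun z => v i (ζ • z) := (hv i).comp (contDiff_const_smul ζ)
    have hdu := hui.differentiable (by simp)
    have hdv := (hv i).differentiable (by simp)
    have hdvζ := hvζ.differentiable (by simp)
    have hper : ∀ l ∈ Λ₁, ∀ z, u (z + l) i + v i (z + l) + -ζ ^ 2 * v i (ζ • (z + l)) =
        u z i + v i z + -ζ ^ 2 * v i (ζ • z) := by
      intro l hl z
      have hζl : ζ • l ∈ Λ₁ := by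
        rw [mem_Λ₁] at hl ⊢
        exact fun i => mul_mem_eis ζ_mem_eis (hl i)
      rw [hu.2 l (hΛ ▸ Submodule.mem_sup_left hl), hvp i l (Submodule.mem_sup_left hl), smul_add,
        hvp i _ (Submodule.mem_sup_left hζl)]
    -- In the primitive, the factor `-ζ ^ 2` compensates `∂̄ (v ∘ ζ) = ζ ^ 2 * (∂̄ v) ∘ ζ`, using `ζ
    -- ^ 2 * ζ ^ 2 = ζ`.
    have h0 : (ζ - 1) * c i j = 0 := by
      refine const_eq_zero_of_eq_dbar (u := fun z => u z i + v i z + -ζ ^ 2 * v i (ζ • z)) (j := j)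
        ((hui.add (hv i)).add (contDiff_const.mul hvζ)) hper fun z => ?_
      rw [dbar_add (hdu.fun_add hdv) (hdvζ.const_mul _), dbar_add hdu hdv, dbar_const_mul hdvζ,
        dbar_comp_mul hdv, conj_ζ, ← huη]
      simp only [Matrix.sub_apply, hηω, hωv]
      linear_combination ζ * dbar j (v i) (ζ • z) * ζ_pow_three
    exact (mul_eq_zero.1 h0).resolve_left (sub_ne_zero.2 ζ_ne_one)
  refine ⟨fun z i => v i z, ⟨contDiff_pi.2 hv, fun l hl z => funext fun i => hvp i l (hΛ ▸ hl) z⟩,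
    fun z i j => ?_⟩
  rw [hωv, hc, zero_add]

theorem IsAffineQuotient.isRigidZ3CubeQuotient {A : TorusGroup} (hA : IsAffineQuotient A)
    (hr : IsRigidAction A) : IsRigidZ3CubeQuotient A where
  discrete := hA.discrete
  span_top := hA.span_top
  holomorphic σ hσ := by
    obtain ⟨γ, hγ⟩ := hA.exists_affine σ hσ
    refine ⟨hA.continuous hσ, fun U φ _ h => ?_⟩
    have h1 := h.comp γ.differentiable_complex.differentiableOn (s := γ ⁻¹' (A.torusProj ⁻¹' U)) fun z hz => hz
    have h2 : A.torusProj ⁻¹' (σ ⁻¹' U) = γ ⁻¹' (A.torusProj ⁻¹' U) := by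
      ext z; simp only [Set.mem_preimage, hγ]
    rw [HolomorphicOn, h2]
    refine h1.congr fun z _ => ?_
    simp only [Function.comp_apply, hγ]
  group_iso := hA.group_iso
  translation_free := hA.translation_free
  isolated := hA.isolated
  rigid := hr

theorem isRigidZ3CubeQuotient_Y9 : IsRigidZ3CubeQuotient Y9 := by
  obtain ⟨h, hl⟩ := isAffineQuotient_Y9
  have := h.discrete
  refine h.isRigidZ3CubeQuotient (isRigidAction_of_sup (w := 0) (by simp) ?_ (liftsTors_one_iff.1 ?_))
  · change Λ₁ = _
    simp
  · convert hl 1 using 1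
    funext i; fin_cases i <;> simp

theorem two_add_one_smul_mem : ![t, t, 0] + ![t, t, 0] + ![t, t, 0] ∈ Λ₁ := by
  have h : t + t + t ∈ eis := mem_eis.2 ⟨1, 2, by rw [t]; push_cast; ring⟩
  rw [mem_Λ₁]
  intro i
  fin_cases i
  · exact h
  · exact h
  · simp

theorem isRigidZ3CubeQuotient_Y10 : IsRigidZ3CubeQuotient Y10 := by
  obtain ⟨h, hl⟩ := isAffineQuotient_Y10
  have := h.discrete
  refine h.isRigidZ3CubeQuotient
    (isRigidAction_of_sup two_add_one_smul_mem rfl (liftsTors_one_iff.1 ?_))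
  convert hl 1 using 1 <;> decide

theorem isRigidZ3CubeQuotient_Y10' : IsRigidZ3CubeQuotient Y10' := by
  obtain ⟨h, hl⟩ := isAffineQuotient_Y10'
  have := h.discrete
  refine h.isRigidZ3CubeQuotient
    (isRigidAction_of_sup two_add_one_smul_mem rfl (liftsTors_one_iff.1 ?_))
  convert hl 1 using 1 <;> decide

end TorusQuotient

end

noncomputable section

namespace TorusQuotient

open Topology TorusGroup

/-! ### Complex conjugation -/

theorem conj_mem_eis {x : ℂ} (hx : x ∈ eis) : (starRingEnd ℂ) x ∈ eis := by
  obtain ⟨a, b, rfl⟩ := mem_eis.1 hx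
  refine mem_eis.2 ⟨a - b, -b, ?_⟩
  simp only [map_add, map_mul, conj_ζ, map_intCast, ζ_sq]
  push_cast; ring

/-- Complex conjugation of the coordinates of `ℂ³`. -/
def conjV : V ≃L[ℝ] V := ContinuousLinearEquiv.piCongrRight fun _ => Complex.conjCLE

theorem conjV_apply (z : V) (i : Fin 3) : conjV z i = (starRingEnd ℂ) (z i) := rfl

theorem conjV_conjV (z : V) : conjV (conjV z) = z := by
  funext i; simp [conjV_apply]

theorem conjV_mul (z w : V) : conjV (z * w) = conjV z * conjV w := by
  funext i; simp [conjV_apply]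

theorem conjV_dz (e : Fin 3 → ZMod 3) : conjV (dz e) = dz (-e) := by
  funext i
  rw [conjV_apply, dz, dz, map_pow, conj_ζ, Pi.neg_apply]
  induction e i using zmod_cases with
  | h0 => simp
  | h1 => exact pow_one _
  | h2 =>
    change (ζ ^ 2) ^ 2 = ζ ^ 1
    linear_combination ζ * ζ_pow_three

theorem conjV_mem_Λ₁ {l : V} (hl : l ∈ Λ₁) : conjV l ∈ Λ₁ := by
  rw [mem_Λ₁] at hl ⊢
  exact fun i => conj_mem_eis (hl i)

theorem conj_t : (starRingEnd ℂ) t = -t := by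
  have : (starRingEnd ℂ) t = (1 + 2 * ζ ^ 2) / 3 := by
    rw [t, map_div₀, map_add, map_mul, map_one, conj_ζ]
    rw [Complex.conj_ofNat, Complex.conj_ofNat]
  rw [this, ζ_sq, t]; ring

/-- Conjugation fixes `1/3` and negates `t`. -/
theorem conjV_tors_sub_mem (n m : Fin 3 → ZMod 3) : conjV (tors n m) - tors n (-m) ∈ Λ₁ := by
  have h1 := tors_add_sub_mem 0 m 0 (-m)
  have h0 : tors (0 + 0) (m + -m) = 0 := by funext i; simp [tors]
  rw [h0, sub_zero] at h1
  convert Λ₁.neg_mem h1 using 1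
  funext i
  simp only [Pi.sub_apply, conjV_apply, tors, Pi.neg_apply, Pi.add_apply, map_add, map_mul, conj_t, map_div₀,
    Complex.conj_natCast, Pi.zero_apply, ZMod.val_zero, Nat.cast_zero]
  have h3 : (starRingEnd ℂ) 3 = 3 := Complex.conj_ofNat 3
  rw [h3]; ring

theorem conjV_mem_Λ₂ {l : V} (hl : l ∈ Λ₂) : conjV l ∈ Λ₂ := by
  obtain ⟨l, hl₁, v, hv, rfl⟩ := Submodule.mem_sup.1 hl
  obtain ⟨k, rfl⟩ := Submodule.mem_span_singleton.1 hv
  rw [map_add]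
  refine Λ₂.add_mem (Λ₁_le_Λ₂ (conjV_mem_Λ₁ hl₁)) (Submodule.mem_sup_right ?_)
  rw [Submodule.mem_span_singleton]
  refine ⟨-k, ?_⟩
  rw [map_zsmul, neg_smul, ← smul_neg]
  congr 1
  funext i
  fin_cases i <;> simp [conjV_apply, conj_t]

theorem proj_conjV_of_proj_eq {A B : TorusGroup} (hA : IsAffineQuotient A)
    {n m : (Fin 3 → ZMod 3) → Fin 3 → ZMod 3} (h : ∀ e, A.LiftsTors e (n e) (m e))
    (h' : ∀ e, B.LiftsTors (-e) (n e) (-m e)) (hΛ : ∀ l ∈ A.Λ, conjV l ∈ B.Λ) (h₁ : Λ₁ ≤ B.Λ)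
    {z w : V} (hzw : A.proj z = A.proj w) : B.proj (conjV z) = B.proj (conjV w) := by
  rw [proj_eq_iff] at hzw ⊢
  obtain ⟨σ, hσ, hσz⟩ := hzw
  obtain ⟨e, he⟩ := hA.exists_exponent h hσ
  obtain ⟨τ, hτ, hτ'⟩ := h' e
  refine ⟨τ, hτ, ?_⟩
  rw [hτ', torusProj_eq_iff]
  rw [he, torusProj_eq_iff] at hσz
  convert B.Λ.sub_mem (hΛ _ hσz) (h₁ (conjV_tors_sub_mem (n e) (m e))) using 1
  simp only [affine, map_sub, map_add, conjV_mul, conjV_dz]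
  ring

/-- Conjugation turns the data `(e, n, m)` into `(-e, n, -m)`. In the formulas for the translation
parts this reverses the sign `s` by which the two groups differ. -/
theorem exists_diffeomorphism_conj : ∃ f : Y10.Space ≃ₜ Y10'.Space,
    IsDiffeomorphism Y10.proj Y10'.proj f ∧ ∀ z, f (Y10.proj z) = Y10'.proj (conjV z) := by
  obtain ⟨f, hf⟩ := exists_homeomorph (A := Y10) (B := Y10') conjV.toHomeomorph fun z w => by
    constructor
    · refine proj_conjV_of_proj_eq isAffineQuotient_Y10.1 isAffineQuotient_Y10.2 (fun e => ?_)
        (fun _ => conjV_mem_Λ₂) Λ₁_le_Λ₂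
      convert isAffineQuotient_Y10'.2 (-e) using 1
      · funext i; fin_cases i <;> simp <;> ring
      · funext i; fin_cases i <;> simp <;> ring
    · intro h
      rw [← conjV_conjV z, ← conjV_conjV w]
      refine proj_conjV_of_proj_eq isAffineQuotient_Y10'.1 isAffineQuotient_Y10'.2 (fun e => ?_)
        (fun _ => conjV_mem_Λ₂) Λ₁_le_Λ₂ h
      convert isAffineQuotient_Y10.2 (-e) using 1
      · funext i; fin_cases i <;> simp <;> ring
      · funext i; fin_cases i <;> simp <;> ring
  exact ⟨f, isDiffeomorphism_of_lift (Φ := conjV.toHomeomorph) conjV.contDiff conjV.symm.contDiff hf, hf⟩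

end TorusQuotient

end

noncomputable section

namespace TorusQuotient

open Topology TorusGroup

/-! ### Isomorphisms of the groups of affine maps -/

variable {A B : TorusGroup}

/-- The translation by a lattice vector. -/
def translation (l : A.Λ) : A.crystal :=
  ⟨AffineEquiv.constVAdd ℂ V l, lifts_id.congr fun z => by simp⟩

theorem translation_apply (l : A.Λ) (z : V) : (translation l).1 z = z + l := by
  simp [translation, add_comm]

theorem crystal_ext {γ δ : A.crystal} (h : ∀ z, γ.1 z = δ.1 z) : γ = δ :=
  Subtype.ext (AffineEquiv.ext h)

theorem crystal_mul_apply (γ δ : A.crystal) (z : V) : (γ * δ).1 z = γ.1 (δ.1 z) := rfl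

theorem translation_add (l l' : A.Λ) : translation (l + l') = translation l * translation l' :=
  crystal_ext fun z => by
    simp only [crystal_mul_apply, translation_apply, Submodule.coe_add]; ring

theorem translation_injective : Function.Injective (translation (A := A)) := fun l l' h =>
  Subtype.ext (by simpa [translation_apply] using congrArg (fun γ : A.crystal => γ.1 0) h)

/-- The linear part of the element `γ` is `dz e`. -/
def HasExponent (γ : A.crystal) (e : Fin 3 → ZMod 3) : Prop :=
  ∃ c, ∀ z, γ.1 z = affine (dz e) c z

theorem dz_zero : dz 0 = 1 := by funext i; simp [dz]

theorem HasExponent.unique {γ : A.crystal} {e e' : Fin 3 → ZMod 3} (h : HasExponent γ e)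
    (h' : HasExponent γ e') : e = e' := by
  obtain ⟨c, hc⟩ := h
  obtain ⟨c', hc'⟩ := h'
  apply dz_injective
  have h0 := (hc 0).symm.trans (hc' 0)
  have h1 := (hc 1).symm.trans (hc' 1)
  simp only [affine, mul_zero, zero_add, mul_one] at h0 h1
  rw [h0] at h1
  exact add_right_cancel h1

theorem HasExponent.translation_mul {γ : A.crystal} {e : Fin 3 → ZMod 3} (h : HasExponent γ e)
    (l : A.Λ) : HasExponent (translation l * γ) e := by
  obtain ⟨c, hc⟩ := h
  exact ⟨c + l, fun z => by rw [crystal_mul_apply, translation_apply, hc]; simp only [affine]; ring⟩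

/-- Conjugation of a translation. -/
theorem HasExponent.mul_translation {γ : A.crystal} {e : Fin 3 → ZMod 3} (h : HasExponent γ e)
    {l l' : A.Λ} : γ * translation l = translation l' * γ ↔ (l' : V) = dz e * l := by
  obtain ⟨c, hc⟩ := h
  constructor
  · intro h
    have h0 := congrArg (fun γ : A.crystal => γ.1 0) h
    simp only [crystal_mul_apply, translation_apply, hc, affine] at h0
    linear_combination -h0
  · intro h
    refine crystal_ext fun z => ?_
    simp only [crystal_mul_apply, translation_apply, hc, affine, h]
    ring

namespace IsNormal

variable (hA : IsNormal A) (hB : IsNormal B)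

include hA in
theorem exists_hasExponent (γ : A.crystal) : ∃ e, HasExponent γ e := by
  have := hA.isAffineQuotient.discrete
  obtain ⟨σ, hσ, hσγ⟩ := γ.2
  choose c hc using hA.exists_lift
  obtain ⟨e, he⟩ := hA.isAffineQuotient.exists_exponent hc hσ
  have hcont : Continuous γ.1 := γ.1.continuous_of_finiteDimensional
  have h1 := fun z => A.const_of_mem (F := fun z => γ.1 z - affine (dz e) (c e) z)
    (by unfold affine; fun_prop) (fun z => by
      rw [← torusProj_eq_iff, ← hσγ, ← he]) z 0
  refine ⟨e, c e + (γ.1 0 - affine (dz e) (c e) 0), fun z => ?_⟩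
  rw [← h1 z]
  simp only [affine]; ring

include hA in
theorem exists_hasExponent_lift (e : Fin 3 → ZMod 3) : ∃ γ : A.crystal, HasExponent γ e := by
  obtain ⟨c, hc⟩ := hA.exists_lift e
  refine ⟨⟨diagAff (dz e) c (dz_ne_zero e), ?_⟩, c, fun z => diagAff_apply _ _⟩
  rw [mem_crystal]
  convert hc using 1
  exact funext fun z => diagAff_apply _ _

include hA in
theorem exists_eq_translation_mul {γ δ : A.crystal} {e : Fin 3 → ZMod 3} (h : HasExponent γ e)
    (h' : HasExponent δ e) : ∃ l, γ = translation l * δ := by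
  have hγ := γ.2
  have hδ := δ.2
  obtain ⟨c, hc⟩ := h
  obtain ⟨c', hc'⟩ := h'
  rw [mem_crystal, show (γ.1 : V → V) = _ from funext hc] at hγ
  rw [mem_crystal, show (δ.1 : V → V) = _ from funext hc'] at hδ
  refine ⟨⟨c - c', hA.isAffineQuotient.affine_unique hγ hδ⟩, crystal_ext fun z => ?_⟩
  rw [crystal_mul_apply, translation_apply, hc, hc']
  simp only [affine]; ring

include hA in
-- A purely group-theoretic description of translations, hence preserved by isomorphisms: cubes have
-- trivial linear part, so translations commute with them.
theorem exists_eq_translation_iff (γ : A.crystal) :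
    (∃ l, γ = translation l) ↔ ∀ δ : A.crystal, Commute γ (δ ^ 3) := by
  constructor
  · rintro ⟨l, rfl⟩ δ
    obtain ⟨e, c, hc⟩ := hA.exists_hasExponent δ
    have h3 : dz e * (dz e * dz e) = 1 := by
      rw [← dz_add, ← dz_add, ← dz_zero]
      congr 1
      funext i
      have h3 : (3 : ZMod 3) = 0 := rfl
      simp only [Pi.add_apply, Pi.zero_apply]
      linear_combination e i * h3
    refine crystal_ext fun z => ?_
    simp only [pow_succ, pow_zero, one_mul, crystal_mul_apply, translation_apply, hc, affine]
    linear_combination (-(l : V)) * h3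
  · intro h
    obtain ⟨e, c, hc⟩ := hA.exists_hasExponent γ
    have he : dz e = 1 := by
      -- The cube of the translation by `(1,1,1)` is the translation by three times this vector;
      -- commuting with it forces `dz e` to fix `(1,1,1)`.
      let l : A.Λ := ⟨1, hA.le (mem_Λ₁.2 fun _ => one_mem_eis)⟩
      have h0 := congrArg (fun γ : A.crystal => γ.1 0) (h (translation l))
      simp only [pow_succ, pow_zero, one_mul, crystal_mul_apply, translation_apply, hc, affine] at h0
      have hl : (l : V) = 1 := rfl
      rw [hl] at h0
      funext i
      have h1 := congrFun h0 i
      simp only [Pi.add_apply, Pi.mul_apply, Pi.zero_apply, Pi.one_apply] at h1 ⊢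
      linear_combination (1 / 3 : ℂ) * h1
    have he0 : e = 0 := dz_injective (he.trans dz_zero.symm)
    subst he0
    obtain ⟨l, hl⟩ := hA.exists_eq_translation_mul (γ := γ) (δ := 1) ⟨c, hc⟩
      ⟨0, fun z => by simp [affine, dz_zero]⟩
    exact ⟨l, by rw [hl, mul_one]⟩

include hA hB in
/-- An isomorphism between the groups of affine maps induces an isomorphism between the lattices, and
a permutation of the linear parts which is compatible with it. -/
theorem exists_lattice_equiv (α : A.crystal ≃* B.crystal) :
    ∃ (φ : A.Λ →+ B.Λ) (ψ : (Fin 3 → ZMod 3) → Fin 3 → ZMod 3), Function.Surjective φ ∧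
      Function.Injective ψ ∧ (∀ l, α (translation l) = translation (φ l)) ∧
      (∀ γ e, HasExponent γ e → HasExponent (α γ) (ψ e)) ∧
      ∀ e, ∀ l l' : A.Λ, (l' : V) = dz e * l → (φ l' : V) = dz (ψ e) * φ l := by
  have h1 : ∀ γ, (∃ l, γ = translation l) → ∃ l, α γ = translation l := by
    intro γ hγ
    rw [hA.exists_eq_translation_iff] at hγ
    rw [hB.exists_eq_translation_iff]
    intro δ
    have := (hγ (α.symm δ)).map α
    simpa using this
  have h2 : ∀ γ, (∃ l, γ = translation l) → ∃ l, α.symm γ = translation l := by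
    intro γ hγ
    rw [hB.exists_eq_translation_iff] at hγ
    rw [hA.exists_eq_translation_iff]
    intro δ
    have := (hγ (α δ)).map α.symm
    simpa using this
  choose φ hφ using fun l => h1 (translation l) ⟨l, rfl⟩
  choose γ hγ using hA.exists_hasExponent_lift
  choose ψ hψ using fun e => hB.exists_hasExponent (α (γ e))
  have hψ' : ∀ δ e, HasExponent δ e → HasExponent (α δ) (ψ e) := by
    intro δ e hδ
    obtain ⟨l, rfl⟩ := hA.exists_eq_translation_mul hδ (hγ e)
    rw [map_mul, hφ]
    exact (hψ e).translation_mul _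
  have hsurj : Function.Surjective φ := by
    intro l
    obtain ⟨l', hl'⟩ := h2 _ ⟨l, rfl⟩
    refine ⟨l', translation_injective ?_⟩
    rw [← hφ, ← hl', MulEquiv.apply_symm_apply]
  refine ⟨AddMonoidHom.mk' φ fun l l' => translation_injective ?_, ψ, hsurj, ?_, hφ, hψ', ?_⟩
  · rw [translation_add, ← hφ, ← hφ, ← hφ, translation_add, map_mul]
  · intro e e' hee
    obtain ⟨l, hl⟩ := hB.exists_eq_translation_mul (hψ e) (hee ▸ hψ e')
    obtain ⟨l, rfl⟩ := hsurj l
    rw [← hφ, ← map_mul] at hl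
    have h3 := hγ e
    rw [α.injective hl] at h3
    exact h3.unique ((hγ e').translation_mul l)
  · intro e l l' hl
    have := congrArg α ((hγ e).mul_translation.2 hl)
    rw [map_mul, map_mul, hφ, hφ] at this
    exact (hψ e).mul_translation.1 this

include hA hB in
theorem exists_equivariant_lift (f : A.Space ≃ₜ B.Space) :
    ∃ (N : Set V) (F : V → V) (φ : A.Λ →+ B.Λ) (ψ : (Fin 3 → ZMod 3) → Fin 3 → ZMod 3),
      N.Countable ∧ IsClosed N ∧ ContinuousOn F Nᶜ ∧ (∀ z ∉ N, F z ∉ B.sing) ∧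
      (∀ z ∉ N, B.proj (F z) = f (A.proj z)) ∧ Function.Surjective φ ∧ Function.Injective ψ ∧
      (∀ e, ∀ l l' : A.Λ, (l' : V) = dz e * l → (φ l' : V) = dz (ψ e) * φ l) ∧
      (∀ l : A.Λ, ∀ z ∉ N, z + l ∉ N ∧ F (z + l) = F z + φ l) ∧
      ∀ e c, A.Lifts (affine (dz e) c) → ∃ c', B.Lifts (affine (dz (ψ e)) c') ∧
        ∀ z ∉ N, affine (dz e) c z ∉ N ∧ F (affine (dz e) c z) = affine (dz (ψ e)) c' (F z) := by
  obtain ⟨N, F, α, hN, hNc, hF, hFs, hFf, hFα⟩ :=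
    hA.isAffineQuotient.exists_equivariant_lift hB.isAffineQuotient f
  obtain ⟨φ, ψ, hφs, hψi, hφ, hψ, hφψ⟩ := hA.exists_lattice_equiv hB α
  refine ⟨N, F, φ, ψ, hN, hNc, hF, hFs, hFf, hφs, hψi, hφψ, fun l z hz => ?_, fun e c hc => ?_⟩
  · have := hFα (translation l) z hz
    rwa [hφ, translation_apply, translation_apply] at this
  · let γ : A.crystal := ⟨diagAff (dz e) c (dz_ne_zero e), by
      rw [mem_crystal]
      convert hc using 1
      exact funext fun z => diagAff_apply _ _⟩
    have hγ : ∀ z, γ.1 z = affine (dz e) c z := fun z => diagAff_apply _ _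
    obtain ⟨c', hc'⟩ := hψ γ e ⟨c, hγ⟩
    refine ⟨c', ?_, fun z hz => ?_⟩
    · have := (α γ).2
      rwa [mem_crystal, show ((α γ).1 : V → V) = _ from funext hc'] at this
    · have := hFα γ z hz
      rwa [hγ, hc'] at this

end IsNormal

theorem single_mem_Λ₁ {i : Fin 3} {x : ℂ} : Pi.single i x ∈ Λ₁ ↔ x ∈ eis := by
  rw [mem_Λ₁]
  refine ⟨fun h => by simpa using h i, fun h j => ?_⟩
  by_cases hj : j = i
  · subst hj; simpa using h
  · simp [hj]

theorem exists_tors_mem_Λ₂ {l : V} (hl : l ∈ Λ₂) :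
    ∃ x : ZMod 3, l - tors 0 ![x, x, 0] ∈ Λ₁ := by
  obtain ⟨m, h⟩ := exists_tors_of_mem (one_sub_ζ_mul_mem_of_mem_Λ₂ hl)
  have h1 : tors 0 m ∈ Λ₂ := by simpa using Λ₂.sub_mem hl (Λ₁_le_Λ₂ h)
  obtain ⟨-, h01, h2⟩ := tors_mem_Λ₂.1 h1
  refine ⟨m 0, ?_⟩
  have : m = ![m 0, m 0, 0] := by
    funext i; fin_cases i <;> simp [h01, h2]
  rwa [← this]

theorem mem_Λ₁_of_apply_eq_zero {l : V} (hl : l ∈ Λ₂) {i : Fin 3} (hi : i ≠ 2) (h : l i ∈ eis) :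
    l ∈ Λ₁ := by
  obtain ⟨x, hx⟩ := exists_tors_mem_Λ₂ hl
  have h1 := eis.sub_mem h (mem_Λ₁.1 hx i)
  rw [Pi.sub_apply, sub_sub_cancel, tors_apply_mem_eis] at h1
  have h0 : x = 0 := by
    fin_cases i
    · exact h1.2
    · exact h1.2
    · exact absurd rfl hi
  have h2 : tors 0 ![x, x, 0] ∈ Λ₁ := by
    rw [tors_mem_Λ₁, h0]
    exact ⟨rfl, by funext i; fin_cases i <;> rfl⟩
  simpa using Λ₁.add_mem hx h2

theorem single_mem_Λ₂ {i : Fin 3} {x : ℂ} : Pi.single i x ∈ Λ₂ ↔ x ∈ eis := by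
  refine ⟨fun h => ?_, fun h => Λ₁_le_Λ₂ (single_mem_Λ₁.2 h)⟩
  rw [← single_mem_Λ₁ (i := i)]
  by_cases hi : i = 0
  · exact mem_Λ₁_of_apply_eq_zero h (i := 1) (by decide) (by subst hi; simp)
  · exact mem_Λ₁_of_apply_eq_zero h (i := 0) (by decide) (by simp [Ne.symm hi])

theorem IsAffineQuotient.isNormal (hA : IsAffineQuotient A)
    {n m : (Fin 3 → ZMod 3) → Fin 3 → ZMod 3} (h : ∀ e, A.LiftsTors e (n e) (m e))
    (hn : n 1 = 0) (hm : m 1 = 0) (hs : ∀ i x, Pi.single i x ∈ A.Λ ↔ x ∈ eis) : IsNormal A := by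
  refine ⟨hA, fun e => ⟨_, h e⟩, hs, ?_⟩
  have h1 := h 1
  have h0 : tors 0 0 = 0 := by funext i; simp [tors]
  rwa [hn, hm, LiftsTors, h0] at h1

theorem isNormal_Y9 : IsNormal Y9 :=
  isAffineQuotient_Y9.1.isNormal isAffineQuotient_Y9.2 rfl (by decide) fun _ _ => single_mem_Λ₁

theorem isNormal_Y10 : IsNormal Y10 :=
  isAffineQuotient_Y10.1.isNormal isAffineQuotient_Y10.2 (by decide) (by decide)
    fun _ _ => single_mem_Λ₂

theorem isNormal_Y10' : IsNormal Y10' :=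
  isAffineQuotient_Y10'.1.isNormal isAffineQuotient_Y10'.2 (by decide) (by decide)
    fun _ _ => single_mem_Λ₂

theorem exists_eq_single {y : V} (h : ∀ p q, p ≠ q → y p = 0 ∨ y q = 0) :
    ∃ p x, y = Pi.single p x := by
  by_cases h0 : y = 0
  · exact ⟨0, 0, by rw [h0, Pi.single_zero]⟩
  · obtain ⟨p, hp⟩ := Function.ne_iff.1 h0
    refine ⟨p, y p, funext fun q => ?_⟩
    by_cases hq : q = p
    · subst hq; simp
    · rw [Pi.single_eq_of_ne hq]
      exact (h p q (Ne.symm hq)).resolve_left hp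

/-- A vector on an axis is fixed by nine linear parts, and `ψ` is injective, so the same holds for
its image, which must therefore lie on an axis and hence in `Λ₁`. Axis vectors generate `Λ₁`, so `φ`
could not be onto `Λ₂`. -/
theorem IsNormal.isEmpty_homeomorph_Y9 (hB : IsNormal B) (hΛ : B.Λ = Λ₂) :
    IsEmpty (Y9.Space ≃ₜ B.Space) := by
  refine ⟨fun f => ?_⟩
  obtain ⟨N, F, φ, ψ, -, -, -, -, -, hφ, hψ, hφψ, -⟩ := isNormal_Y9.exists_equivariant_lift hB f
  have haxis : ∀ (j : Fin 3) (x : ℂ) (hx : Pi.single j x ∈ Y9.Λ), (φ ⟨_, hx⟩ : V) ∈ Λ₁ := by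
    intro j x hx
    set y : V := ((φ ⟨_, hx⟩ : B.Λ) : V) with hy
    have hfix : ∀ e : Fin 3 → ZMod 3, e j = 0 → y = dz (ψ e) * y := by
      intro e he
      refine hφψ e ⟨_, hx⟩ ⟨_, hx⟩ ?_
      funext i
      by_cases hi : i = j
      · subst hi; simp [dz, he]
      · simp [hi]
    have hfix' : ∀ e : Fin 3 → ZMod 3, e j = 0 → ∀ p, y p ≠ 0 → ψ e p = 0 := by
      intro e he p hp
      have h1 := congrFun (hfix e he) p
      rw [Pi.mul_apply, eq_comm, mul_eq_right₀ hp] at h1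
      exact ζ_pow_val_injective (by simpa [dz] using h1)
    obtain ⟨p, x', hyp⟩ := exists_eq_single (y := y) fun p q hpq => by
      by_contra! hcon
      obtain ⟨r, hr⟩ : ∃ r, ∀ i : Fin 3, i = p ∨ i = q ∨ i = r := by
        clear * - hpq; revert p q; decide
      obtain ⟨j₁, j₂, h1, h2, h12⟩ : ∃ j₁ j₂ : Fin 3, j ≠ j₁ ∧ j ≠ j₂ ∧ j₁ ≠ j₂ := by
        clear * -; revert j; decide
      -- The nine exponents vanishing at `j`. If the image had two nonzero coordinates `p`, `q`,
      -- their images under `ψ` would be determined by the entry at `r`, which has only three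
      -- values.
      let u : ZMod 3 × ZMod 3 → Fin 3 → ZMod 3 := fun a => Pi.single j₁ a.1 + Pi.single j₂ a.2
      have hu : ∀ a, u a j = 0 := fun a => by simp [u, h1, h2]
      have hinj : Function.Injective fun a => ψ (u a) r := by
        intro a b hab
        have h3 : ψ (u a) = ψ (u b) := by
          funext i
          rcases hr i with rfl | rfl | rfl
          · rw [hfix' _ (hu a) _ hcon.1, hfix' _ (hu b) _ hcon.1]
          · rw [hfix' _ (hu a) _ hcon.2, hfix' _ (hu b) _ hcon.2]
          · exact hab
        have h4 := hψ h3
        have h5 := congrFun h4 j₁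
        have h6 := congrFun h4 j₂
        simp [u, h12, h12.symm] at h5 h6
        exact Prod.ext h5 h6
      have := Fintype.card_le_of_injective _ hinj
      simp [ZMod.card] at this
    have hyB : y ∈ B.Λ := (φ ⟨_, hx⟩).2
    rw [hyp, hB.single_mem] at hyB
    rw [hyp]
    exact single_mem_Λ₁.2 hyB
  have hall : ∀ l : Y9.Λ, (φ l : V) ∈ Λ₁ := by
    intro l
    have hm : ∀ i, Pi.single i (l.1 i) ∈ Y9.Λ := fun i => single_mem_Λ₁.2 (mem_Λ₁.1 l.2 i)
    have hl : l = ∑ i, (⟨_, hm i⟩ : Y9.Λ) := by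
      refine Subtype.ext ?_
      rw [AddSubmonoidClass.coe_finsetSum]
      exact (Finset.univ_sum_single l.1).symm
    rw [hl, map_sum, AddSubmonoidClass.coe_finsetSum]
    exact Λ₁.sum_mem fun i _ => haxis i _ _
  have hmem : tors 0 ![1, 1, 0] ∈ B.Λ := hΛ ▸ tors_mem_Λ₂.2 (by decide)
  obtain ⟨l, hl⟩ := hφ ⟨_, hmem⟩
  have h1 := hall l
  rw [hl] at h1
  exact absurd (congrFun (tors_mem_Λ₁.1 h1).2 0) (by decide)

end TorusQuotient

end

noncomputable section

namespace TorusQuotient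

open Topology TorusGroup

/-! ### Biholomorphic maps are induced by affine maps -/

variable {A B : TorusGroup}

theorem IsAffineQuotient.exists_isOpen_injOn_proj (hA : IsAffineQuotient A) {w : V}
    (hw : w ∉ A.sing) : ∃ W : Set V, IsOpen W ∧ w ∈ W ∧ Set.InjOn A.proj W := by
  have := hA.discrete
  obtain ⟨W, hW, hwW, hinj⟩ := A.exists_isOpen_injOn_torusProj w
  obtain ⟨e, he, h⟩ := hA.isCoveringMapOn.isLocalHomeomorphOn (A.torusProj w) ⟨w, hw, rfl⟩
  refine ⟨W ∩ A.torusProj ⁻¹' e.source, hW.inter (e.open_source.preimage A.torusProj_continuous),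
    ⟨hwW, he⟩, fun z hz z' hz' hzz => hinj hz.1 hz'.1 (e.injOn hz.2 hz'.2 ?_)⟩
  rw [← h]
  exact hzz

theorem IsAffineQuotient.differentiableAt_lift (hA : IsAffineQuotient A) (hB : IsAffineQuotient B)
    {f : A.Space ≃ₜ B.Space} (hf : IsBiholomorphism A.proj B.proj f) {N : Set V} {F : V → V}
    (hN : IsClosed N) (hF : ContinuousOn F Nᶜ) (hFs : ∀ z ∉ N, F z ∉ B.sing)
    (hFf : ∀ z ∉ N, B.proj (F z) = f (A.proj z)) {z : V} (hz : z ∉ N) :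
    DifferentiableAt ℂ F z := by
  obtain ⟨W, hW, hzW, hinj⟩ := hB.exists_isOpen_injOn_proj (hFs z hz)
  have hnhds : Nᶜ ∈ 𝓝 z := hN.isOpen_compl.mem_nhds hz
  refine TorusQuotient.differentiableAt_lift hA.isOpenQuotientMap_proj.continuous f.continuous
    hB.isOpenQuotientMap_proj.isOpenMap (fun w w' h => ?_) (fun U φ hU => (hf U φ hU).1)
    (hF.continuousAt hnhds) ?_ hW hinj hzW
  · obtain ⟨γ, hγ, h⟩ := hB.exists_mem_crystal h.symm
    exact ⟨γ, h.symm, IsAffineQuotient.proj_crystal hγ⟩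
  · filter_upwards [hnhds] with w hw using hFf w hw

/-- A holomorphic map outside a countable set which is equivariant with respect to the
translations by the lattice of the cube of the Fermat curve is affine. -/
theorem exists_affine_of_countable {N : Set V} (hN : N.Countable) {F : V → V}
    (hF : ∀ z ∉ N, DifferentiableAt ℂ F z) {φ : Λ₁ → V}
    (hφ : ∀ l : Λ₁, ∀ z ∉ N, F (z + l) = F z + φ l) :
    ∃ (M : V →ₗ[ℂ] V) (v : V), ∀ z ∉ N, F z = M z + v := by
  have hdisc : DiscreteTopology Λ₁ := inferInstance
  have he : ∀ j, (Pi.single j 1 : V) ∈ Λ₁ := fun j => single_mem_Λ₁.2 one_mem_eis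
  let a : Fin 3 → V := fun j => φ ⟨_, he j⟩
  -- The coordinates of points of `N`. A line parallel to the `j`-th axis misses `N` once another
  -- coordinate avoids `C`, so `F` is entire along it.
  let C : Set ℂ := ⋃ i : Fin 3, (fun z : V => z i) '' N
  have hC : C.Countable := Set.countable_iUnion fun i => hN.image _
  have hCN : ∀ z : V, ∀ i, z i ∉ C → z ∉ N := fun z i hz hzN =>
    hz (Set.mem_iUnion.2 ⟨i, z, hzN, rfl⟩)
  have hline : ∀ (z : V) (i j : Fin 3), i ≠ j → z i ∉ C → ∀ s : ℂ,
      F (z + Pi.single j s) = F z + s • a j := by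
    intro z i j hij hz s
    have hout : ∀ s, z + Pi.single j s ∉ N := fun s => hCN _ i (by simpa [hij] using hz)
    -- The restriction to the line is viewed as a function on all of `ℂ³`, depending on one
    -- coordinate, so that `eq_linear_of_periodic` applies.
    have hd : Differentiable ℂ fun w : V => F (z + Pi.single j (w j)) := by
      intro w
      refine DifferentiableAt.comp w (hF _ (hout _)) ?_
      have : DifferentiableAt ℂ (fun w : V => (Pi.single j (w j) : V)) w :=
        ((ContinuousLinearMap.single ℂ (fun _ : Fin 3 => ℂ) j).comp
          (ContinuousLinearMap.proj (φ := fun _ : Fin 3 => ℂ) j)).differentiableAt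
      exact this.const_add z
    obtain ⟨M, hM⟩ := eq_linear_of_periodic span_Λ₁ hd fun l hl w => by
      have hm : (Pi.single j (l j) : V) ∈ Λ₁ := single_mem_Λ₁.2 (mem_Λ₁.1 hl j)
      have h1 := hφ ⟨_, hm⟩ _ (hout (w j))
      have h2 := hφ ⟨_, hm⟩ _ (hout 0)
      simp only [Pi.single_zero, add_zero] at h2
      simp only [Pi.add_apply, Pi.single_add, ← add_assoc, h1, h2, Pi.zero_apply, Pi.single_zero,
        add_zero]
      ring
    have h1 := hM (Pi.single j s)
    have h2 := hM (Pi.single j 1)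
    have h3 := hφ ⟨_, he j⟩ _ (hout 0)
    have h4 : (Pi.single j s : V) = s • Pi.single j 1 := by
      rw [← Pi.single_smul, smul_eq_mul, mul_one]
    simp only [Pi.single_zero, add_zero] at h3
    simp only [Pi.single_eq_same, Pi.zero_apply, Pi.single_zero, add_zero] at h1 h2
    rw [h3] at h2
    have h5 : M (Pi.single j 1) = a j := by
      linear_combination (exp := 1) -h2
    have h6 : M (Pi.single j s) = s • a j := by rw [h4, map_smul, h5]
    rw [h1, h6, add_comm]
  let M : V →ₗ[ℂ] V := ∑ j, (LinearMap.proj j : V →ₗ[ℂ] ℂ).smulRight (a j)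
  have hM : ∀ z, M z = ∑ j, z j • a j := fun z => by simp [M]
  have hMs : ∀ j s, M (Pi.single j s) = s • a j := by
    intro j s
    rw [hM, Finset.sum_eq_single j (fun i _ hi => by simp [hi]) (by simp)]
    simp
  have hstep : ∀ (z : V) (i j : Fin 3), i ≠ j → z i ∉ C → ∀ s : ℂ,
      F (Function.update z j s) - M (Function.update z j s) = F z - M z := by
    intro z i j hij hz s
    have h1 : Function.update z j s = z + Pi.single j (s - z j) := by
      funext k
      by_cases hk : k = j
      · subst hk; simp
      · simp [hk]
    rw [h1, hline z i j hij hz, map_add, hMs]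
    abel
  -- Two points of this dense set are joined by changing one coordinate at a time, along lines
  -- missing `N`.
  let D : Set V := Set.univ.pi fun _ => Cᶜ
  have hD : Dense D := dense_pi _ fun _ _ => hC.dense_compl ℝ
  have hconst : ∀ z ∈ D, ∀ w ∈ D, F z - M z = F w - M w := by
    intro z hz w hw
    have hz' : ∀ i, z i ∉ C := fun i => hz i (Set.mem_univ i)
    have hw' : ∀ i, w i ∉ C := fun i => hw i (Set.mem_univ i)
    have h0 := hstep z 1 0 (by decide) (hz' 1) (w 0)
    have h1 := hstep (Function.update z 0 (w 0)) 2 1 (by decide)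
      (by simpa using hz' 2) (w 1)
    have h2 := hstep (Function.update (Function.update z 0 (w 0)) 1 (w 1)) 0 2 (by decide)
      (by simpa using hw' 0) (w 2)
    have h3 : Function.update (Function.update (Function.update z 0 (w 0)) 1 (w 1)) 2 (w 2) = w := by
      funext i; fin_cases i <;> simp
    rw [h3] at h2
    rw [h2, h1, h0]
  obtain ⟨z₀, hz₀⟩ := hD.nonempty
  refine ⟨M, F z₀ - M z₀, fun z hz => ?_⟩
  have : (𝓝[D] z).NeBot := mem_closure_iff_nhdsWithin_neBot.1 (hD z)
  have hMc : Continuous M := M.continuous_of_finiteDimensional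
  refine tendsto_nhds_unique (l := 𝓝[D] z) (f := F)
    ((hF z hz).continuousAt.tendsto.mono_left nhdsWithin_le_nhds)
    (Filter.Tendsto.congr' (f₁ := fun w => M w + (F z₀ - M z₀)) ?_
      ((Continuous.tendsto (by fun_prop) z).mono_left nhdsWithin_le_nhds))
  filter_upwards [self_mem_nhdsWithin] with w hw
  rw [hconst z₀ hz₀ w hw]
  abel

/-- A biholomorphic map is induced by an affine map whose linear part is monomial. -/
theorem IsNormal.exists_monomial_lift (hA : IsNormal A) (hB : IsNormal B)
    (h : Biholomorphic A B) : ∃ (σ : Fin 3 → Fin 3) (D v : V), (∀ i, D i ≠ 0) ∧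
      (∀ l ∈ A.Λ, D * (l ∘ σ) ∈ B.Λ) ∧ (∀ l ∈ B.Λ, ∃ l' ∈ A.Λ, l = D * (l' ∘ σ)) ∧
      ∀ e c, A.Lifts (affine (dz e) c) →
        B.Lifts (affine (dz (e ∘ σ)) (D * (c ∘ σ) + v - dz (e ∘ σ) * v)) := by
  obtain ⟨f, hf⟩ := h
  obtain ⟨N, F, φ, ψ, hN, hNc, hFc, hFs, hFf, hφ, hψ, hφψ, hFφ, hFψ⟩ := hA.exists_equivariant_lift hB f
  obtain ⟨M, v, hM⟩ := exists_affine_of_countable hN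
    (fun z hz => hA.isAffineQuotient.differentiableAt_lift hB.isAffineQuotient hf hNc hFc hFs hFf hz)
    (φ := fun l => φ ⟨l, hA.le l.2⟩) (fun l z hz => (hFφ ⟨l, hA.le l.2⟩ z hz).2)
  obtain ⟨z₀, hz₀⟩ : ∃ z₀, z₀ ∉ N := (hN.dense_compl ℝ).nonempty
  have hMφ : ∀ l : A.Λ, M l = φ l := by
    intro l
    obtain ⟨h1, h2⟩ := hFφ l z₀ hz₀
    rw [hM _ h1, hM _ hz₀, map_add] at h2
    linear_combination (exp := 1) h2
  have hs : ∀ j, (Pi.single j 1 : V) ∈ A.Λ := fun j => (hA.single_mem j 1).2 one_mem_eis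
  let m : Fin 3 → Fin 3 → ℂ := fun i j => M (Pi.single j 1) i
  have hm : ∀ z i, M z i = ∑ j, z j * m i j := by
    intro z i
    conv_lhs => rw [← Finset.univ_sum_single z, map_sum, Finset.sum_apply]
    refine Finset.sum_congr rfl fun j _ => ?_
    rw [show (Pi.single j (z j) : V) = z j • Pi.single j 1 by
      rw [← Pi.single_smul, smul_eq_mul, mul_one], map_smul]
    rfl
  -- Equivariance compares eigenvalues: a nonzero entry identifies the `i`-th exponent after `ψ`
  -- with the `j`-th before. Two nonzero entries in a row would identify two independent exponents.
  have hexp : ∀ i j, m i j ≠ 0 → ∀ e, ψ e i = e j := by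
    intro i j hij e
    have hmem : dz e * Pi.single j 1 ∈ A.Λ := by
      obtain ⟨c, hc⟩ := hA.exists_lift e
      exact hc.mul_mem (hs j)
    have h1 := hφψ e ⟨_, hs j⟩ ⟨_, hmem⟩ rfl
    rw [← hMφ, ← hMφ] at h1
    have h2 : dz e * Pi.single j 1 = dz e j • (Pi.single j 1 : V) := by
      funext k
      by_cases hk : k = j
      · subst hk; simp
      · simp [hk]
    have h3 := congrFun h1 i
    simp only [h2, map_smul, Pi.smul_apply, Pi.mul_apply, smul_eq_mul] at h3
    exact (ζ_pow_val_injective (mul_right_cancel₀ hij h3)).symm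
  have hrow : ∀ i, ∃ j, m i j ≠ 0 := by
    intro i
    by_contra! hcon
    obtain ⟨l, hl⟩ := hφ ⟨Pi.single i 1, (hB.single_mem i 1).2 one_mem_eis⟩
    have h1 := hm l i
    rw [hMφ, hl] at h1
    simp [hcon] at h1
  choose σ hσ using hrow
  have hψσ : ∀ e, ψ e = e ∘ σ := fun e => funext fun i => hexp i (σ i) (hσ i) e
  have hzero : ∀ i j, j ≠ σ i → m i j = 0 := by
    intro i j hj
    by_contra hij
    have h1 := hexp i j hij (Pi.single j 1)
    rw [hψσ, Function.comp_apply, Pi.single_eq_same, Pi.single_eq_of_ne (Ne.symm hj)] at h1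
    exact zero_ne_one h1
  have hMσ : ∀ z, M z = (fun i => m i (σ i)) * (z ∘ σ) := by
    intro z
    funext i
    rw [hm, Finset.sum_eq_single (σ i) (fun j _ hj => by rw [hzero i j hj, mul_zero]) (by simp)]
    rw [mul_comm]; rfl
  refine ⟨σ, fun i => m i (σ i), v, hσ, fun l hl => ?_, fun l hl => ?_, fun e c hc => ?_⟩
  · rw [← hMσ, hMφ ⟨l, hl⟩]
    exact (φ ⟨l, hl⟩).2
  · obtain ⟨l', hl'⟩ := hφ ⟨l, hl⟩
    refine ⟨l', l'.2, ?_⟩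
    rw [← hMσ, hMφ, hl']
  · obtain ⟨c', hc', h1⟩ := hFψ e c hc
    obtain ⟨h2, h3⟩ := h1 z₀ hz₀
    rw [hM _ h2, hM _ hz₀, hψσ] at h3
    rw [hψσ] at hc'
    convert hc' using 2
    simp only [affine] at h3
    simp only [hMσ] at h3
    have h4 : (dz e * z₀ + c) ∘ σ = dz (e ∘ σ) * (z₀ ∘ σ) + c ∘ σ := rfl
    rw [h4] at h3
    linear_combination h3

end TorusQuotient

end

noncomputable section

namespace TorusQuotient

open Topology TorusGroup

/-! ### The two complex structures -/

theorem tors_sub_sub_mem (n m n' m' : Fin 3 → ZMod 3) :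
    tors n m - tors n' m' - tors (n - n') (m - m') ∈ Λ₁ := by
  have h := tors_add_sub_mem (n - n') (m - m') n' m'
  rw [sub_add_cancel, sub_add_cancel] at h
  convert Λ₁.neg_mem h using 1
  ring

/-- Multiplication of the torsion points by an Eisenstein integer depends, up to multiples of `t`,
only on the residue of the integer modulo `1 - ζ`. -/
theorem exists_residue {D : V} (hD : ∀ i, D i ∈ eis) :
    ∃ r : Fin 3 → ZMod 3, ∀ n m, ∃ m', D * tors n m - tors (r * n) m' ∈ Λ₁ ∧
      ∀ i, n i = 0 → m' i = r i * m i := by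
  choose a b hab using fun i => mem_eis.1 (hD i)
  refine ⟨fun i => (a i + b i : ℤ), fun n m => ?_⟩
  obtain ⟨k, rfl⟩ := exists_intCast n
  obtain ⟨l, rfl⟩ := exists_intCast m
  refine ⟨fun i => ((a i + b i) * l i - b i * k i : ℤ), ?_, fun i hi => ?_⟩
  · have h1 : D * ((fun i => (k i : ℂ) / 3 + l i * t) - tors (fun i => k i) (fun i => l i)) ∈ Λ₁ :=
      mem_Λ₁.2 fun i => mul_mem_eis (hD i) (mem_Λ₁.1 (tors_intCast_sub_mem k l) i)
    have h2 := tors_intCast_sub_mem (fun i => (a i + b i) * k i)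
      (fun i => (a i + b i) * l i - b i * k i)
    have h3 : (fun i => -(b i * l i : ℤ) + (b i * k i - b i * l i : ℤ) * ζ : V) ∈ Λ₁ :=
      mem_Λ₁.2 fun i => by
        have := mem_eis_int (-(b i * l i)) (b i * k i - b i * l i)
        push_cast at this ⊢
        exact this
    have h4 : ((fun i => ((a i + b i : ℤ) : ZMod 3)) * fun i => (k i : ZMod 3)) =
        fun i => (((a i + b i) * k i : ℤ) : ZMod 3) := by
      funext i; rw [Int.cast_mul]; rfl
    rw [h4]
    convert Λ₁.sub_mem (Λ₁.add_mem h2 h3) h1 using 1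
    funext i
    simp only [Pi.sub_apply, Pi.add_apply, Pi.mul_apply, hab i]
    push_cast
    rw [t]
    linear_combination ((2 * b i * l i : ℂ) / 3) * ζ_sq
  · have hi' : (k i : ZMod 3) = 0 := hi
    push_cast
    rw [hi', mul_zero, sub_zero]

/-- Conjugation by a translation does not affect coordinates with eigenvalue one, where `w`
vanishes. There translation parts can be compared directly, modulo the code vector `(x, x, 0)`. -/
theorem residue_eq {D : V} {r : Fin 3 → ZMod 3}
    (hr : ∀ n m, ∃ m', D * tors n m - tors (r * n) m' ∈ Λ₁ ∧ ∀ i, n i = 0 → m' i = r i * m i)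
    {n m n' m' : Fin 3 → ZMod 3} {w : V} (h : D * tors n m + w - tors n' m' ∈ Λ₂) :
    ∃ x : ZMod 3, ∀ i, w i = 0 → r i * n i = n' i ∧
      (n i = 0 → r i * m i - m' i = (![x, x, 0] : Fin 3 → ZMod 3) i) := by
  obtain ⟨μ, hμ, hμ'⟩ := hr n m
  obtain ⟨x, hx⟩ := exists_tors_mem_Λ₂ h
  refine ⟨x, fun i hi => ?_⟩
  have h1 := tors_sub_sub_mem (r * n) μ n' m'
  have h2 := tors_sub_sub_mem (r * n - n') (μ - m') 0 ![x, x, 0]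
  have h3 := mem_Λ₁.1 (Λ₁.sub_mem (Λ₁.sub_mem (Λ₁.sub_mem hx hμ) h1) h2) i
  have h4 : tors (r * n - n' - 0) (μ - m' - ![x, x, 0]) i ∈ eis := by
    convert h3 using 1
    simp only [Pi.sub_apply, Pi.add_apply, hi]
    ring
  rw [tors_apply_mem_eis] at h4
  simp only [Pi.sub_apply, Pi.mul_apply, Pi.zero_apply, sub_zero] at h4
  refine ⟨sub_eq_zero.1 h4.1, fun hn => ?_⟩
  rw [← hμ' i hn]
  exact sub_eq_zero.1 h4.2

/-- Preservation of the code makes the monomial map respect the first two coordinates and gives it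
one residue `r 0 = r 1` there. The reflection in the third coordinate determines this residue
through `m`, one in the first two through `n`, and the results have opposite signs. -/
theorem not_biholomorphic_Y10_Y10' : ¬ Biholomorphic Y10 Y10' := by
  intro h
  obtain ⟨σ, D, v, hD0, hDm, hDs, hlift⟩ := isNormal_Y10.exists_monomial_lift isNormal_Y10' h
  change ∀ l ∈ Λ₂, D * (l ∘ σ) ∈ Λ₂ at hDm
  change ∀ l ∈ Λ₂, ∃ l' ∈ Λ₂, l = D * (l' ∘ σ) at hDs
  have hσ : Function.Injective σ := by
    intro i j hij
    by_contra hne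
    obtain ⟨l, -, hl⟩ := hDs _ (single_mem_Λ₂ (i := i).2 one_mem_eis)
    have h1 := congrFun hl i
    have h2 := congrFun hl j
    rw [Pi.single_eq_same, Pi.mul_apply, Function.comp_apply] at h1
    rw [Pi.single_eq_of_ne (Ne.symm hne), Pi.mul_apply, Function.comp_apply, ← hij] at h2
    rw [(mul_eq_zero.1 h2.symm).resolve_left (hD0 j), mul_zero] at h1
    exact one_ne_zero h1
  have hD : ∀ i, D i ∈ eis := by
    intro i
    rw [← single_mem_Λ₂ (i := i)]
    convert hDm _ (single_mem_Λ₂ (i := σ i).2 one_mem_eis) using 1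
    funext j
    by_cases hj : j = i
    · subst hj; simp
    · simp [hj, hσ.ne hj]
  obtain ⟨r, hr⟩ := exists_residue hD
  -- The lattice vector `(t, t, 0)` is hit by a lattice vector congruent to `tors 0 ![x, x, 0]`; the
  -- residues of its first two coordinates are compared.
  obtain ⟨x, hx0, hx1⟩ : ∃ x : ZMod 3, r 0 * (![x, x, 0] : Fin 3 → ZMod 3) (σ 0) = 1 ∧
      r 1 * (![x, x, 0] : Fin 3 → ZMod 3) (σ 1) = 1 := by
    obtain ⟨l, hl, hl'⟩ := hDs _ (tors_mem_Λ₂ (n := 0) (m := ![1, 1, 0]).2 (by decide))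
    obtain ⟨x, hx⟩ := exists_tors_mem_Λ₂ hl
    obtain ⟨μ, hμ, hμ'⟩ := hr 0 (![x, x, 0] ∘ σ)
    have h1 : D * ((l - tors 0 ![x, x, 0]) ∘ σ) ∈ Λ₁ :=
      mem_Λ₁.2 fun i => mul_mem_eis (hD i) (mem_Λ₁.1 hx (σ i))
    have h2 := tors_sub_sub_mem (r * 0) μ 0 ![1, 1, 0]
    have h3 : tors (r * 0 - 0) (μ - ![1, 1, 0]) ∈ Λ₁ := by
      have h4 := Λ₁.neg_mem (Λ₁.add_mem (Λ₁.add_mem h1 hμ) h2)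
      convert h4 using 1
      rw [hl']
      have h5 : (l - tors 0 ![x, x, 0]) ∘ σ = l ∘ σ - tors 0 (![x, x, 0] ∘ σ) := rfl
      rw [h5]
      ring
    have h4 := (tors_mem_Λ₁.1 h3).2
    refine ⟨x, ?_, ?_⟩
    · have := hμ' 0 rfl
      rw [Function.comp_apply] at this
      rw [← this]
      exact sub_eq_zero.1 (congrFun h4 0)
    · have := hμ' 1 rfl
      rw [Function.comp_apply] at this
      rw [← this]
      exact sub_eq_zero.1 (congrFun h4 1)
  -- The two translation parts for the exponent `e ∘ σ` in `Y10'`, transported and explicit, agree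
  -- modulo `Λ₂`; this is read off in the coordinates with eigenvalue one.
  have key : ∀ e : Fin 3 → ZMod 3, ∃ x : ZMod 3, ∀ i, e (σ i) = 0 →
      r i * (![e 1 - e 0, e 1 - e 0, 0] : Fin 3 → ZMod 3) (σ i) =
        (![e (σ 0) - e (σ 1), e (σ 0) - e (σ 1), 0] : Fin 3 → ZMod 3) i ∧
      ((![e 1 - e 0, e 1 - e 0, 0] : Fin 3 → ZMod 3) (σ i) = 0 →
        r i * (![0, (e 0 - e 1) ^ 2 + e 0 + e 1 + e 2, e 1 - e 2] : Fin 3 → ZMod 3) (σ i) -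
          (![0, -(e (σ 0) - e (σ 1)) ^ 2 + e (σ 0) + e (σ 1) + e (σ 2), e (σ 1) - e (σ 2)] :
            Fin 3 → ZMod 3) i = (![x, x, 0] : Fin 3 → ZMod 3) i) := by
    intro e
    have h1 := hlift e _ (isAffineQuotient_Y10.2 e)
    have h2 := isAffineQuotient_Y10'.1.affine_unique h1 (isAffineQuotient_Y10'.2 (e ∘ σ))
    rw [add_sub_assoc] at h2
    obtain ⟨x, hx⟩ := residue_eq hr (n := ![e 1 - e 0, e 1 - e 0, 0] ∘ σ)
      (m := ![0, (e 0 - e 1) ^ 2 + e 0 + e 1 + e 2, e 1 - e 2] ∘ σ) h2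
    exact ⟨x, fun i hi => hx i (by simp [dz, hi])⟩
  have hcases : σ 0 = 0 ∧ σ 1 = 1 ∧ σ 2 = 2 ∨ σ 0 = 1 ∧ σ 1 = 0 ∧ σ 2 = 2 := by
    have h02 : σ 0 ≠ 2 := fun h => by rw [h] at hx0; simp at hx0
    have h12 : σ 1 ≠ 2 := fun h => by rw [h] at hx1; simp at hx1
    have h1 : σ 0 ≠ σ 1 := hσ.ne (by decide)
    have h2 : σ 0 ≠ σ 2 := hσ.ne (by decide)
    have h3 : σ 1 ≠ σ 2 := hσ.ne (by decide)
    omega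
  have hr01 : r 0 = r 1 := by
    have : (![x, x, 0] : Fin 3 → ZMod 3) (σ 0) = x ∧ (![x, x, 0] : Fin 3 → ZMod 3) (σ 1) = x := by
      rcases hcases with ⟨h0, h1, -⟩ | ⟨h0, h1, -⟩ <;> rw [h0, h1] <;> exact ⟨rfl, rfl⟩
    rw [this.1] at hx0
    rw [this.2] at hx1
    have hx : x ≠ 0 := by rintro rfl; simp at hx0
    exact mul_right_cancel₀ hx (hx0.trans hx1.symm)
  have h11 : (1 : ZMod 3) ≠ -1 := by decide
  obtain ⟨y, hy⟩ := key (Pi.single 2 1)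
  rcases hcases with ⟨h0, h1, h2⟩ | ⟨h0, h1, h2⟩
  · obtain ⟨z, hz⟩ := key (Pi.single 1 1)
    have hz0 := hz 0
    have hy0 := hy 0
    have hy1 := hy 1
    simp [h0, h1, h2] at hz0 hy0 hy1
    rw [← hy0, sub_eq_zero] at hy1
    rw [← hr01, hz0] at hy1
    exact h11 hy1.symm
  · obtain ⟨z, hz⟩ := key (Pi.single 0 1)
    have hz0 := hz 0
    have hy0 := hy 0
    have hy1 := hy 1
    simp [h0, h1, h2] at hz0 hy0 hy1
    rw [← hy0, hz0] at hy1
    exact h11 hy1.symm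

end TorusQuotient

end

theorem proposition4p10 :
    -- the three examples belong to the class of quotients in question
    (TorusQuotient.IsRigidZ3CubeQuotient TorusQuotient.Y9 ∧
      TorusQuotient.IsRigidZ3CubeQuotient TorusQuotient.Y10 ∧
      TorusQuotient.IsRigidZ3CubeQuotient TorusQuotient.Y10') ∧
    -- every such quotient is biholomorphic to one of them
    (∀ A : TorusQuotient.TorusGroup, TorusQuotient.IsRigidZ3CubeQuotient A →
      TorusQuotient.Biholomorphic A TorusQuotient.Y9 ∨
      TorusQuotient.Biholomorphic A TorusQuotient.Y10 ∨
      TorusQuotient.Biholomorphic A TorusQuotient.Y10') ∧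
    -- they are pairwise not biholomorphic
    (¬ TorusQuotient.Biholomorphic TorusQuotient.Y9 TorusQuotient.Y10 ∧
      ¬ TorusQuotient.Biholomorphic TorusQuotient.Y9 TorusQuotient.Y10' ∧
      ¬ TorusQuotient.Biholomorphic TorusQuotient.Y10 TorusQuotient.Y10') ∧
    -- complex conjugation induces a diffeomorphism of `Y₁₀` with `Y₁₀'`
    (∃ f : TorusQuotient.Y10.Space ≃ₜ TorusQuotient.Y10'.Space,
      TorusQuotient.IsDiffeomorphism TorusQuotient.Y10.proj TorusQuotient.Y10'.proj f ∧
      ∀ z : Fin 3 → ℂ, f (TorusQuotient.Y10.proj z) =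
        TorusQuotient.Y10'.proj fun i => (starRingEnd ℂ) (z i)) ∧
    -- neither of the two is diffeomorphic to `Y₉`
    (¬ TorusQuotient.Diffeomorphic TorusQuotient.Y10 TorusQuotient.Y9 ∧
      ¬ TorusQuotient.Diffeomorphic TorusQuotient.Y10' TorusQuotient.Y9) := by
  have h10 := TorusQuotient.isNormal_Y10.isEmpty_homeomorph_Y9 rfl
  have h10' := TorusQuotient.isNormal_Y10'.isEmpty_homeomorph_Y9 rfl
  exact ⟨⟨TorusQuotient.isRigidZ3CubeQuotient_Y9, TorusQuotient.isRigidZ3CubeQuotient_Y10,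
    TorusQuotient.isRigidZ3CubeQuotient_Y10'⟩,
    fun A hA => hA.isAffineQuotient.classification,
    ⟨fun ⟨f, _⟩ => h10.false f, fun ⟨f, _⟩ => h10'.false f,
      TorusQuotient.not_biholomorphic_Y10_Y10'⟩,
    TorusQuotient.exists_diffeomorphism_conj,
    fun ⟨f, _⟩ => h10.false f.symm, fun ⟨f, _⟩ => h10'.false f.symm⟩
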